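/- Let $N\ge 1$, $p\in\left(2+\frac4N,\,2+\frac8N\right)$ and $\varepsilon>0$, and let functions be real-valued or complex-valued (the statement holds in either case). For $u\in H^2(\mathbb R^N)$ write $$P_p(u)=\|\Delta u\|_{2}^{\frac{N(p-2)-4}{2}}\,\|\nabla u\|_{2}^{\frac{8-N(p-2)}{2}}\,\|u\|_{2}^{p-2},\qquad W_p(u)=\frac{P_p(u)}{\|u\|_p^p}\quad(u\neq0).$$ The mixed Gagliardo–Nirenberg inequality $$\|u\|_p^p\le C\,P_p(u)\qquad\text{for all }u\in H^2(\mathbb R^N)\tag{GN$_C$}$$ (which includes $H^2(\mathbb R^N)\subset L^p(\mathbb R^N)$) has a smallest constant $C=C_{N,p}\in(0,\infty)$. With this constant, the following holds. 1. There is an optimizer $v\in H^2(\mathbb R^N)\setminus\{0\}$, that is, $\|v\|_p^p=C\,P_p(v)$, with $\|\nabla v\|_2=\|\Delta v\|_2=1$ and $W_p(v)=C^{-1}$, and there are $\lambda,\mu>0$ and $\omega>0$ such that $Q:=\lambda v(\mu\,\cdot)\in H^2(\mathbb R^N)$ is again an optimizer of (GN$_C$) and is a weak solution of $$\varepsilon\Delta^2Q-\Delta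 Q+\omega Q=|Q|^{p-2}Q\quad\text{in }\mathbb R^N,$$ i.e. $\varepsilon\int\Delta Q\,\Delta\varphi+\int\nabla Q\cdot\nabla\varphi+\omega\int Q\varphi=\int|Q|^{p-2}Q\varphi$ for all $\varphi\in C_c^\infty(\mathbb R^N)$. 2. There exist normalized minimizing sequences of $W_p$: sequences $(w_n)\subset H^2(\mathbb R^N)\setminus\{0\}$ with $\|\nabla w_n\|_2=\|\Delta w_n\|_2=1$ for all $n$ and $W_p(w_n)\to C^{-1}$. For every such sequence there are a subsequence $(w_{k_n})$ and translations $y_n\in\mathbb R^N$ such that $w_{k_n}(\cdot+y_n)$ converges in $H^2(\mathbb R^N)$ to some $v$ with all the properties in 1. -/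

import Mathlib

open MeasureTheory Filter Topology
open scoped ContDiff Laplacian

noncomputable section

namespace MixedGN

variable {𝕜 : Type*} [RCLike 𝕜] {N : ℕ}

/-- `g` is the weak partial derivative `∂ᵢ u` on `ℝᴺ`. -/
structure HasWeakPartial (i : Fin N) (u g : EuclideanSpace ℝ (Fin N) → 𝕜) : Prop where
  locallyIntegrable_fun : LocallyIntegrable u volume
  locallyIntegrable_deriv : LocallyIntegrable g volume
  integral_eq : ∀ φ : EuclideanSpace ℝ (Fin N) → ℝ, ContDiff ℝ ∞ φ → HasCompactSupport φ →
    ∫ x, (fderiv ℝ φ x (EuclideanSpace.single i 1)) • u x = - ∫ x, φ x • g x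

/-- Weak partial derivatives are unique almost everywhere. -/
theorem HasWeakPartial.ae_eq {i : Fin N} {u g h : EuclideanSpace ℝ (Fin N) → 𝕜}
    (hg : HasWeakPartial i u g) (hh : HasWeakPartial i u h) : g =ᵐ[volume] h := by
  refine ae_eq_of_integral_contDiff_smul_eq hg.locallyIntegrable_deriv
    hh.locallyIntegrable_deriv fun φ hφ hc => ?_
  exact neg_injective ((hg.integral_eq φ hφ hc).symm.trans (hh.integral_eq φ hφ hc))

open Classical in
/-- The weak partial derivative `∂ᵢ u` (a representative of it; `0` if there is none). -/
def weakPartial (i : Fin N) (u : EuclideanSpace ℝ (Fin N) → 𝕜) :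
    EuclideanSpace ℝ (Fin N) → 𝕜 :=
  if h : ∃ g, HasWeakPartial i u g then h.choose else 0

theorem HasWeakPartial.weakPartial_ae_eq {i : Fin N} {u g : EuclideanSpace ℝ (Fin N) → 𝕜}
    (hg : HasWeakPartial i u g) : weakPartial i u =ᵐ[volume] g := by
  have h : ∃ g, HasWeakPartial i u g := ⟨g, hg⟩
  rw [weakPartial, dif_pos h]
  exact h.choose_spec.ae_eq hg

/-- Membership in the Sobolev space `H²(ℝᴺ)`: `u`, its first and its second weak partial
derivatives belong to `L²(ℝᴺ)`. -/
structure MemH2 (u : EuclideanSpace ℝ (Fin N) → 𝕜) : Prop where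
  memLp : MemLp u 2 volume
  partials : ∀ i, ∃ g, HasWeakPartial i u g ∧ MemLp g 2 volume ∧
    ∀ j, ∃ h, HasWeakPartial j g h ∧ MemLp h 2 volume

/-- The weak gradient `∇u`. -/
def weakGrad (u : EuclideanSpace ℝ (Fin N) → 𝕜) (x : EuclideanSpace ℝ (Fin N)) :
    EuclideanSpace 𝕜 (Fin N) :=
  WithLp.toLp 2 fun i => weakPartial i u x

/-- The weak Laplacian `Δu = ∑ᵢ ∂ᵢ ∂ᵢ u`. -/
def weakLaplacian (u : EuclideanSpace ℝ (Fin N) → 𝕜) (x : EuclideanSpace ℝ (Fin N)) : 𝕜 :=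
  ∑ i, weakPartial i (weakPartial i u) x

/-- The norm `‖u‖_q` of `L^q(ℝᴺ)`. -/
def normLp (q : ℝ) (u : EuclideanSpace ℝ (Fin N) → 𝕜) : ℝ :=
  (eLpNorm u (ENNReal.ofReal q) volume).toReal

/-- `‖u‖_{D^{1,2}} = ‖∇u‖₂`. -/
def normD1 (u : EuclideanSpace ℝ (Fin N) → 𝕜) : ℝ :=
  (eLpNorm (weakGrad u) 2 volume).toReal

/-- `‖u‖_{D^{2,2}} = ‖Δu‖₂`. -/
def normD2 (u : EuclideanSpace ℝ (Fin N) → 𝕜) : ℝ :=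
  (eLpNorm (weakLaplacian u) 2 volume).toReal

/-- The product
`‖u‖_{D^{2,2}}^{(N(p-2)-4)/2} ‖u‖_{D^{1,2}}^{(8-N(p-2))/2} ‖u‖₂^{p-2}`. -/
def mixedProduct (p : ℝ) (u : EuclideanSpace ℝ (Fin N) → 𝕜) : ℝ :=
  normD2 u ^ ((N * (p - 2) - 4) / 2) * normD1 u ^ ((8 - N * (p - 2)) / 2) *
    normLp 2 u ^ (p - 2)

variable (𝕜 N) in
/-- The mixed Gagliardo-Nirenberg inequality holds on `H²(ℝᴺ)` with the constant `C`
(in particular `H²(ℝᴺ) ⊆ L^p(ℝᴺ)`). -/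
def MixedGNInequality (p C : ℝ) : Prop :=
  ∀ u : EuclideanSpace ℝ (Fin N) → 𝕜, MemH2 u →
    MemLp u (ENNReal.ofReal p) volume ∧ normLp p u ^ p ≤ C * mixedProduct p u

variable (𝕜 N) in
/-- `C` is the best constant `C_{N,p}` of the mixed Gagliardo-Nirenberg inequality. -/
def IsBestConstant (p C : ℝ) : Prop :=
  IsLeast {C : ℝ | MixedGNInequality 𝕜 N p C} C

/-- `u ∈ H²(ℝᴺ) \ {0}`. -/
def MemH2NeZero (u : EuclideanSpace ℝ (Fin N) → 𝕜) : Prop :=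
  MemH2 u ∧ ¬ u =ᵐ[volume] 0

/-- `u ∈ H²(ℝᴺ) \ {0}` attains equality in the mixed Gagliardo-Nirenberg inequality with
constant `C` (to be used for the best constant `C`). -/
def IsOptimizer (p C : ℝ) (u : EuclideanSpace ℝ (Fin N) → 𝕜) : Prop :=
  MemH2NeZero u ∧ normLp p u ^ p = C * mixedProduct p u

/-- The Weinstein functional `W_p`. -/
def weinstein (p : ℝ) (u : EuclideanSpace ℝ (Fin N) → 𝕜) : ℝ :=
  mixedProduct p u / normLp p u ^ p

/-- A sequence in `H²(ℝᴺ) \ {0}` with `‖∇wₙ‖₂ = ‖Δwₙ‖₂ = 1` and `W_p(wₙ) → C⁻¹`. -/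
structure IsNormalizedMinimizingSeq (p C : ℝ)
    (w : ℕ → EuclideanSpace ℝ (Fin N) → 𝕜) : Prop where
  mem : ∀ n, MemH2NeZero (w n)
  normD1_eq : ∀ n, normD1 (w n) = 1
  normD2_eq : ∀ n, normD2 (w n) = 1
  tendsto : Tendsto (fun n => weinstein p (w n)) atTop (𝓝 C⁻¹)

/-- An optimizer with `‖∇v‖₂ = ‖Δv‖₂ = 1` and `W_p(v) = C⁻¹`. -/
structure IsNormalizedOptimizer (p C : ℝ) (v : EuclideanSpace ℝ (Fin N) → 𝕜) : Prop where
  optimizer : IsOptimizer p C v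
  normD1_eq : normD1 v = 1
  normD2_eq : normD2 v = 1
  weinstein_eq : weinstein p v = C⁻¹

/-- `wₙ → v` in `H²(ℝᴺ)` (for functions in `H²(ℝᴺ)`, whose norm is equivalent to
`‖u‖₂ + ‖∇u‖₂ + ‖Δu‖₂`). -/
def TendstoH2 (w : ℕ → EuclideanSpace ℝ (Fin N) → 𝕜) (v : EuclideanSpace ℝ (Fin N) → 𝕜) :
    Prop :=
  Tendsto (fun n => normLp 2 (w n - v)) atTop (𝓝 0) ∧
  Tendsto (fun n => normD1 (w n - v)) atTop (𝓝 0) ∧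
  Tendsto (fun n => normD2 (w n - v)) atTop (𝓝 0)

/-- `Q ∈ H²(ℝᴺ)` is a weak solution of `ε Δ²Q - ΔQ + freq Q = |Q|^{p-2} Q`. Real test functions
suffice, as the identity is an identity in `𝕜`. -/
structure IsWeakSolution (p ε freq : ℝ) (Q : EuclideanSpace ℝ (Fin N) → 𝕜) : Prop where
  memH2 : MemH2 Q
  memLp : MemLp Q (ENNReal.ofReal p) volume
  weak_eq : ∀ φ : EuclideanSpace ℝ (Fin N) → ℝ, ContDiff ℝ ∞ φ → HasCompactSupport φ →
    ε • (∫ x, (Δ φ x) • weakLaplacian Q x)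
      + (∫ x, ∑ i, (fderiv ℝ φ x (EuclideanSpace.single i 1)) • weakPartial i Q x)
      + freq • (∫ x, φ x • Q x)
    = ∫ x, φ x • (‖Q x‖ ^ (p - 2) • Q x)

/-- The rescaling `x ↦ a v(b x)`. -/
def rescale (a b : ℝ) (v : EuclideanSpace ℝ (Fin N) → 𝕜) : EuclideanSpace ℝ (Fin N) → 𝕜 :=
  fun x => a • v (b • x)

/-- Some rescaling `Q = a v(b ·)` of `v` is an optimizer and weakly solves
`ε Δ²Q - ΔQ + freq Q = |Q|^{p-2} Q` for some frequency `freq > 0`. -/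
def RescalesToSolution (p C ε : ℝ) (v : EuclideanSpace ℝ (Fin N) → 𝕜) : Prop :=
  ∃ a b freq : ℝ, 0 < a ∧ 0 < b ∧ 0 < freq ∧
    IsOptimizer p C (rescale a b v) ∧ IsWeakSolution p ε freq (rescale a b v)

end MixedGN

end

open MeasureTheory Filter Topology
open scoped ContDiff Laplacian

noncomputable section

namespace MixedGN

variable {𝕜 : Type*} [RCLike 𝕜] {N : ℕ}

/-! The main tool is the mollification `u_t` of `u` at scale `t`. Cauchy–Schwarz gives `‖u_t‖_∞ ≲
t^(-N/2) ‖u‖₂`. Difference quotients give `‖u - u_t‖₂ ≲ t ‖∇u‖₂` and, because the kernel is even,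
also `‖u - u_t‖₂ ≲ t² ‖Δu‖₂`. With `t` chosen so that `‖u_t‖_∞ ≤ s/2`, Chebyshev's inequality for `u
- u_t` bounds the measure of `{|u| > s}` by multiples of `s^(-(2+4/N))` and of `s^(-(2+8/N))`
(`weak_type_bound`). Interpolating between these two weak-type bounds yields the mixed inequality
for every `p` strictly in between (`exists_mixedGNInequality`). The best constant is the infimum of
the admissible ones.

For compactness, `W_p` is invariant under `u ↦ a u(b ·)`, so `‖∇w‖₂ = ‖Δw‖₂ = 1` may be imposed, and
then `W_p(w) = ‖w‖₂^(p-2) / ‖w‖_p^p`. The `L²` norm stays bounded, since `‖w‖_p^p` grows more slowly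
than `‖w‖₂^(p-2)` (`exists_normLp_two_bound`). A mollification of `w` at some fixed scale has a peak
of fixed height (`exists_nonvanishing`). Translating the peak to the origin makes a weak limit `v`
nonzero. The squares of the three `L²`-type norms split asymptotically between `v` and the
remainder, and `‖·‖_p^p` splits by the Brezis–Lieb lemma. Applying the inequality to both pieces
gives `1 ≤ a^α b^β c^γ + (1-a)^α (1-b)^β (1-c)^γ` with `α + β + γ = p/2 > 1`, which forces `a = b =
c = 1` (`eq_one_of_one_le_split`). So nothing is lost, convergence is strong and `v` is an optimizer
(`WeakH2.tendstoH2`).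

An optimizer minimizes `C P_p - ‖·‖_p^p`, whose first variation is a fourth-order equation with
positive coefficients. The two parameters of the rescaling bring it to the required form
(`IsNormalizedOptimizer.rescalesToSolution`). -/

/-! ### Calculus of weak partial derivatives. -/

theorem HasWeakPartial.congr {i : Fin N} {u u' g g' : EuclideanSpace ℝ (Fin N) → 𝕜}
    (h : HasWeakPartial i u g) (hu : u =ᵐ[volume] u') (hg : g =ᵐ[volume] g') :
    HasWeakPartial i u' g' where
  locallyIntegrable_fun := h.locallyIntegrable_fun.congr hu
  locallyIntegrable_deriv := h.locallyIntegrable_deriv.congr hg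
  integral_eq φ hφ hc := by
    have h1 := h.integral_eq φ hφ hc
    rw [integral_congr_ae (g := fun x => (fderiv ℝ φ x (EuclideanSpace.single i 1)) • u' x),
      integral_congr_ae (f := fun x => φ x • g x) (g := fun x => φ x • g' x)] at h1
    · exact h1
    · filter_upwards [hg] with x hx; rw [hx]
    · filter_upwards [hu] with x hx; rw [hx]

theorem integrable_test_smul {φ : EuclideanSpace ℝ (Fin N) → ℝ} (hφ : ContDiff ℝ ∞ φ)
    (hc : HasCompactSupport φ) {u : EuclideanSpace ℝ (Fin N) → 𝕜}
    (hu : LocallyIntegrable u volume) : Integrable (fun x => φ x • u x) volume :=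
  hu.integrable_smul_left_of_hasCompactSupport hφ.continuous hc

theorem integrable_fderiv_test_smul {φ : EuclideanSpace ℝ (Fin N) → ℝ} (hφ : ContDiff ℝ ∞ φ)
    (hc : HasCompactSupport φ) {u : EuclideanSpace ℝ (Fin N) → 𝕜}
    (hu : LocallyIntegrable u volume) (e : EuclideanSpace ℝ (Fin N)) :
    Integrable (fun x => (fderiv ℝ φ x e) • u x) volume :=
  hu.integrable_smul_left_of_hasCompactSupport
    ((hφ.continuous_fderiv (by simp)).clm_apply continuous_const) (hc.fderiv_apply ℝ e)

theorem HasWeakPartial.add {i : Fin N} {u v g h : EuclideanSpace ℝ (Fin N) → 𝕜}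
    (hu : HasWeakPartial i u g) (hv : HasWeakPartial i v h) :
    HasWeakPartial i (u + v) (g + h) where
  locallyIntegrable_fun := hu.locallyIntegrable_fun.add hv.locallyIntegrable_fun
  locallyIntegrable_deriv := hu.locallyIntegrable_deriv.add hv.locallyIntegrable_deriv
  integral_eq φ hφ hc := by
    simp only [Pi.add_apply, smul_add]
    rw [integral_add (integrable_fderiv_test_smul hφ hc hu.locallyIntegrable_fun _)
        (integrable_fderiv_test_smul hφ hc hv.locallyIntegrable_fun _),
      integral_add (integrable_test_smul hφ hc hu.locallyIntegrable_deriv)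
        (integrable_test_smul hφ hc hv.locallyIntegrable_deriv),
      hu.integral_eq φ hφ hc, hv.integral_eq φ hφ hc, neg_add]

theorem HasWeakPartial.const_smul {i : Fin N} {u g : EuclideanSpace ℝ (Fin N) → 𝕜}
    (hu : HasWeakPartial i u g) (c : 𝕜) : HasWeakPartial i (c • u) (c • g) where
  locallyIntegrable_fun := hu.locallyIntegrable_fun.smul c
  locallyIntegrable_deriv := hu.locallyIntegrable_deriv.smul c
  integral_eq φ hφ hc := by
    simp only [Pi.smul_apply, smul_comm _ c]
    rw [integral_smul, integral_smul, hu.integral_eq φ hφ hc, smul_neg]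

theorem HasWeakPartial.sub {i : Fin N} {u v g h : EuclideanSpace ℝ (Fin N) → 𝕜}
    (hu : HasWeakPartial i u g) (hv : HasWeakPartial i v h) :
    HasWeakPartial i (u - v) (g - h) := by
  simpa [sub_eq_add_neg] using hu.add (hv.const_smul (-1))

theorem LocallyIntegrable.comp_translate {u : EuclideanSpace ℝ (Fin N) → 𝕜}
    (hu : LocallyIntegrable u volume) (y : EuclideanSpace ℝ (Fin N)) :
    LocallyIntegrable (fun x => u (x + y)) volume := by
  have h := locallyIntegrable_map_homeomorph (Homeomorph.addRight y) (f := u) (μ := volume)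
  rw [Homeomorph.coe_addRight, map_add_right_eq_self] at h
  exact h.1 hu

theorem LocallyIntegrable.comp_dilate {u : EuclideanSpace ℝ (Fin N) → 𝕜}
    (hu : LocallyIntegrable u volume) {b : ℝ} (hb : b ≠ 0) :
    LocallyIntegrable (fun x => u (b • x)) volume := by
  have h := locallyIntegrable_map_homeomorph (Homeomorph.smulOfNeZero b hb) (f := u)
    (μ := volume)
  refine h.1 ?_
  have : Measure.map (⇑(Homeomorph.smulOfNeZero b hb))
      (volume : Measure (EuclideanSpace ℝ (Fin N))) = _ :=
    Measure.map_addHaar_smul volume hb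
  rw [this]
  intro x
  obtain ⟨s, hs, hi⟩ := hu x
  exact ⟨s, hs, by
    rw [IntegrableOn, Measure.restrict_smul]
    exact hi.smul_measure ENNReal.ofReal_ne_top⟩

theorem HasWeakPartial.translate {i : Fin N} {u g : EuclideanSpace ℝ (Fin N) → 𝕜}
    (hu : HasWeakPartial i u g) (y : EuclideanSpace ℝ (Fin N)) :
    HasWeakPartial i (fun x => u (x + y)) (fun x => g (x + y)) where
  locallyIntegrable_fun := LocallyIntegrable.comp_translate hu.locallyIntegrable_fun y
  locallyIntegrable_deriv := LocallyIntegrable.comp_translate hu.locallyIntegrable_deriv y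
  integral_eq φ hφ hc := by
    have h := hu.integral_eq (fun x => φ (x - y)) (hφ.comp (contDiff_id.sub contDiff_const))
      (hc.comp_homeomorph (Homeomorph.subRight y))
    simp only [fderiv_comp_sub] at h
    rw [← integral_add_right_eq_self _ y, ← integral_add_right_eq_self
      (fun x => φ (x - y) • g x) y] at h
    simpa using h

theorem HasWeakPartial.dilate {i : Fin N} {u g : EuclideanSpace ℝ (Fin N) → 𝕜}
    (hu : HasWeakPartial i u g) {b : ℝ} (hb : b ≠ 0) :
    HasWeakPartial i (fun x => u (b • x)) (fun x => (b : 𝕜) • g (b • x)) where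
  locallyIntegrable_fun := LocallyIntegrable.comp_dilate hu.locallyIntegrable_fun hb
  locallyIntegrable_deriv :=
    (LocallyIntegrable.comp_dilate hu.locallyIntegrable_deriv hb).smul (b : 𝕜)
  integral_eq φ hφ hc := by
    have h := hu.integral_eq (fun x => φ (b⁻¹ • x)) (hφ.comp (contDiff_const_smul _))
      (hc.comp_homeomorph (Homeomorph.smulOfNeZero b⁻¹ (inv_ne_zero hb)))
    have hd : ∀ x, fderiv ℝ (fun x => φ (b⁻¹ • x)) x = b⁻¹ • fderiv ℝ φ (b⁻¹ • x) := fun x => by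
      rw [fderiv_comp_smul]
    simp only [hd, smul_apply] at h
    have h1 := Measure.integral_comp_smul volume
      (fun x => (b⁻¹ • fderiv ℝ φ (b⁻¹ • x) (EuclideanSpace.single i 1)) • u x) b
    have h2 := Measure.integral_comp_smul volume (fun x => φ (b⁻¹ • x) • g x) b
    rw [h, smul_neg, ← h2] at h1
    simp only [inv_smul_smul₀ hb, smul_eq_mul, mul_smul, integral_smul] at h1
    have h3 : ∀ x, φ x • (b : 𝕜) • g (b • x) = b • (φ x • g (b • x)) := fun x => by
      simp only [RCLike.real_smul_eq_coe_mul, smul_eq_mul]; ring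
    simp only [h3, integral_smul]
    rw [← smul_neg, ← h1, smul_inv_smul₀ hb]

theorem hasWeakPartial_of_contDiff {f : EuclideanSpace ℝ (Fin N) → 𝕜} (hf : ContDiff ℝ 1 f)
    (i : Fin N) : HasWeakPartial i f (fun x => fderiv ℝ f x (EuclideanSpace.single i 1)) where
  locallyIntegrable_fun := hf.continuous.locallyIntegrable
  locallyIntegrable_deriv :=
    ((hf.continuous_fderiv (by simp)).clm_apply continuous_const).locallyIntegrable
  integral_eq φ hφ hc := by
    have hf' := (hf.continuous_fderiv (by simp)).clm_apply
      (continuous_const (y := EuclideanSpace.single i (1 : ℝ)))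
    rw [integral_smul_fderiv_eq_neg_fderiv_smul_of_integrable (μ := volume)
      (integrable_fderiv_test_smul hφ hc hf.continuous.locallyIntegrable _)
      (integrable_test_smul hφ hc hf'.locallyIntegrable)
      (integrable_test_smul hφ hc hf.continuous.locallyIntegrable)
      (fun x _ => (hφ.differentiable (by simp)) x)
      (fun x _ => (hf.differentiable (by simp)) x), neg_neg]

/-- `g i` and `h i j` are the weak partial derivatives `∂ᵢ u` and `∂ⱼ ∂ᵢ u`, all in `L²`. -/
structure H2Data (u : EuclideanSpace ℝ (Fin N) → 𝕜) (g : Fin N → EuclideanSpace ℝ (Fin N) → 𝕜)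
    (h : Fin N → Fin N → EuclideanSpace ℝ (Fin N) → 𝕜) : Prop where
  memLp : MemLp u 2 volume
  memLp₁ : ∀ i, MemLp (g i) 2 volume
  memLp₂ : ∀ i j, MemLp (h i j) 2 volume
  partial₁ : ∀ i, HasWeakPartial i u (g i)
  partial₂ : ∀ i j, HasWeakPartial j (g i) (h i j)

/-- By uniqueness of weak derivatives the representatives chosen by `weakPartial` agree almost
everywhere with the witnesses in `MemH2` and inherit their integrability. Conversely, any explicit
`H2Data` may be used to compute the norms, which is how sums, translates and rescalings are handled.
-/
theorem MemH2.h2Data {u : EuclideanSpace ℝ (Fin N) → 𝕜} (hu : MemH2 u) :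
    H2Data u (fun i => weakPartial i u) (fun i j => weakPartial j (weakPartial i u)) := by
  have h1 : ∀ i, ∃ g, (HasWeakPartial i u (weakPartial i u) ∧ MemLp (weakPartial i u) 2 volume) ∧
      weakPartial i u =ᵐ[volume] g ∧
      ∀ j, ∃ h, HasWeakPartial j g h ∧ MemLp h 2 volume := fun i => by
    obtain ⟨g, hg, hgL, hh⟩ := hu.partials i
    have := hg.weakPartial_ae_eq
    exact ⟨g, ⟨hg.congr .rfl this.symm, hgL.ae_eq this.symm⟩, this, hh⟩
  have h2 : ∀ i j, HasWeakPartial j (weakPartial i u) (weakPartial j (weakPartial i u)) ∧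
      MemLp (weakPartial j (weakPartial i u)) 2 volume := fun i j => by
    obtain ⟨g, -, hg, hh⟩ := h1 i
    obtain ⟨h, hh, hhL⟩ := hh j
    have hh' := hh.congr hg.symm .rfl
    have := hh'.weakPartial_ae_eq
    exact ⟨hh'.congr .rfl this.symm, hhL.ae_eq this.symm⟩
  exact ⟨hu.memLp, fun i => (h1 i).choose_spec.1.2, fun i j => (h2 i j).2,
    fun i => (h1 i).choose_spec.1.1, fun i j => (h2 i j).1⟩

namespace H2Data

variable {u v : EuclideanSpace ℝ (Fin N) → 𝕜} {g g' : Fin N → EuclideanSpace ℝ (Fin N) → 𝕜}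
  {h h' : Fin N → Fin N → EuclideanSpace ℝ (Fin N) → 𝕜}

theorem memH2 (H : H2Data u g h) : MemH2 u :=
  ⟨H.memLp, fun i => ⟨g i, H.partial₁ i, H.memLp₁ i, fun j => ⟨h i j, H.partial₂ i j, H.memLp₂ i j⟩⟩⟩

theorem weakPartial_ae (H : H2Data u g h) (i : Fin N) : weakPartial i u =ᵐ[volume] g i :=
  (H.partial₁ i).weakPartial_ae_eq

theorem weakPartial₂_ae (H : H2Data u g h) (i j : Fin N) :
    weakPartial j (weakPartial i u) =ᵐ[volume] h i j :=
  ((H.partial₂ i j).congr (H.weakPartial_ae i).symm .rfl).weakPartial_ae_eq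

theorem add (H : H2Data u g h) (H' : H2Data v g' h') : H2Data (u + v) (g + g') (h + h') :=
  ⟨H.memLp.add H'.memLp, fun i => (H.memLp₁ i).add (H'.memLp₁ i),
    fun i j => (H.memLp₂ i j).add (H'.memLp₂ i j), fun i => (H.partial₁ i).add (H'.partial₁ i),
    fun i j => (H.partial₂ i j).add (H'.partial₂ i j)⟩

theorem sub (H : H2Data u g h) (H' : H2Data v g' h') : H2Data (u - v) (g - g') (h - h') :=
  ⟨H.memLp.sub H'.memLp, fun i => (H.memLp₁ i).sub (H'.memLp₁ i),
    fun i j => (H.memLp₂ i j).sub (H'.memLp₂ i j), fun i => (H.partial₁ i).sub (H'.partial₁ i),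
    fun i j => (H.partial₂ i j).sub (H'.partial₂ i j)⟩

theorem const_smul (H : H2Data u g h) (c : 𝕜) : H2Data (c • u) (c • g) (c • h) :=
  ⟨H.memLp.const_smul c, fun i => (H.memLp₁ i).const_smul c,
    fun i j => (H.memLp₂ i j).const_smul c, fun i => (H.partial₁ i).const_smul c,
    fun i j => (H.partial₂ i j).const_smul c⟩

theorem translate (H : H2Data u g h) (y : EuclideanSpace ℝ (Fin N)) :
    H2Data (fun x => u (x + y)) (fun i x => g i (x + y)) (fun i j x => h i j (x + y)) := by
  have hm := measurePreserving_add_right (volume : Measure (EuclideanSpace ℝ (Fin N))) y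
  exact ⟨H.memLp.comp_measurePreserving hm, fun i => (H.memLp₁ i).comp_measurePreserving hm,
    fun i j => (H.memLp₂ i j).comp_measurePreserving hm, fun i => (H.partial₁ i).translate y,
    fun i j => (H.partial₂ i j).translate y⟩

end H2Data

/-! ### Dilations and smooth functions. -/

theorem eLpNorm_dilate {F : Type*} [NormedAddCommGroup F] {f : EuclideanSpace ℝ (Fin N) → F}
    (hf : AEStronglyMeasurable f volume) {q : ENNReal} (hq : q ≠ ⊤) {b : ℝ} (hb : 0 < b) :
    eLpNorm (fun x => f (b • x)) q volume
      = ENNReal.ofReal (b ^ (-(N : ℝ) / q.toReal)) * eLpNorm f q volume := by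
  have hm : Measure.map (fun x : EuclideanSpace ℝ (Fin N) => b • x) volume
      = ENNReal.ofReal |(b ^ Module.finrank ℝ (EuclideanSpace ℝ (Fin N)))⁻¹| • volume :=
    Measure.map_addHaar_smul volume hb.ne'
  have h1 : AEStronglyMeasurable f
      (Measure.map (fun x : EuclideanSpace ℝ (Fin N) => b • x) volume) := by
    rw [hm]; exact hf.smul_measure _
  have h := eLpNorm_map_measure (p := q) h1 (by fun_prop)
  rw [hm, eLpNorm_smul_measure_of_ne_top hq] at h
  refine h.symm.trans ?_
  rw [smul_eq_mul, abs_of_nonneg (by positivity), finrank_euclideanSpace, Fintype.card_fin,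
    ENNReal.ofReal_rpow_of_nonneg (by positivity) (by positivity)]
  congr 2
  rw [← Real.rpow_natCast, ← Real.rpow_neg hb.le, ← Real.rpow_mul hb.le]
  congr 1
  simp [div_eq_mul_inv]

theorem memLp_dilate {F : Type*} [NormedAddCommGroup F] {f : EuclideanSpace ℝ (Fin N) → F}
    {q : ENNReal} (hf : MemLp f q volume) (hq : q ≠ ⊤) {b : ℝ} (hb : 0 < b) :
    MemLp (fun x => f (b • x)) q volume := by
  refine ⟨?_, ?_⟩
  · refine hf.1.comp_quasiMeasurePreserving ⟨by fun_prop, ?_⟩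
    rw [Measure.map_addHaar_smul volume hb.ne']
    exact Measure.smul_absolutelyContinuous
  · rw [eLpNorm_dilate hf.1 hq hb]
    exact ENNReal.mul_lt_top ENNReal.ofReal_lt_top hf.2

theorem H2Data.rescale {u : EuclideanSpace ℝ (Fin N) → 𝕜}
    {g : Fin N → EuclideanSpace ℝ (Fin N) → 𝕜} {h : Fin N → Fin N → EuclideanSpace ℝ (Fin N) → 𝕜}
    (H : H2Data u g h) (a : ℝ) {b : ℝ} (hb : 0 < b) :
    H2Data (rescale a b u) (fun i => MixedGN.rescale (a * b) b (g i))
      (fun i j => MixedGN.rescale (a * b ^ 2) b (h i j)) := by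
  refine ⟨(memLp_dilate H.memLp (by simp) hb).const_smul a,
    fun i => (memLp_dilate (H.memLp₁ i) (by simp) hb).const_smul (a * b),
    fun i j => (memLp_dilate (H.memLp₂ i j) (by simp) hb).const_smul (a * b ^ 2),
    fun i => ?_, fun i j => ?_⟩
  · refine (((H.partial₁ i).dilate hb.ne').const_smul (a : 𝕜)).congr (.of_forall fun x => ?_)
      (.of_forall fun x => ?_)
    · simp [MixedGN.rescale, RCLike.real_smul_eq_coe_mul]
    · simp [MixedGN.rescale, RCLike.real_smul_eq_coe_mul, mul_assoc]
  · refine (((H.partial₂ i j).dilate hb.ne').const_smul ((a * b : ℝ) : 𝕜)).congr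
      (.of_forall fun x => ?_) (.of_forall fun x => ?_)
    · simp [MixedGN.rescale, RCLike.real_smul_eq_coe_mul]
    · simp [MixedGN.rescale, RCLike.real_smul_eq_coe_mul, mul_assoc, pow_two]

theorem h2Data_of_contDiff {f : EuclideanSpace ℝ (Fin N) → 𝕜} (hf : ContDiff ℝ ∞ f)
    (hc : HasCompactSupport f) :
    H2Data f (fun i x => fderiv ℝ f x (EuclideanSpace.single i 1))
      (fun i j x => fderiv ℝ (fun z => fderiv ℝ f z (EuclideanSpace.single i 1)) x
        (EuclideanSpace.single j 1)) := by
  have h1 : ∀ (f : EuclideanSpace ℝ (Fin N) → 𝕜), ContDiff ℝ ∞ f → ∀ e,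
      ContDiff ℝ ∞ (fun x => fderiv ℝ f x e) := fun f hf e =>
    (hf.fderiv_right (m := ∞) (by simp)).clm_apply contDiff_const
  exact ⟨hf.continuous.memLp_of_hasCompactSupport hc,
    fun i => (h1 f hf _).continuous.memLp_of_hasCompactSupport (hc.fderiv_apply ℝ _),
    fun i j => (h1 _ (h1 f hf _) _).continuous.memLp_of_hasCompactSupport
      ((hc.fderiv_apply ℝ _).fderiv_apply ℝ _),
    fun i => hasWeakPartial_of_contDiff (hf.of_le (by simp)) i,
    fun i j => hasWeakPartial_of_contDiff ((h1 f hf _).of_le (by simp)) j⟩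

/-! ### Norms -/

theorem normLp_two (u : EuclideanSpace ℝ (Fin N) → 𝕜) :
    normLp 2 u = (eLpNorm u 2 volume).toReal := by simp [normLp]

theorem normLp_nonneg (q : ℝ) (u : EuclideanSpace ℝ (Fin N) → 𝕜) : 0 ≤ normLp q u :=
  ENNReal.toReal_nonneg

theorem normLp_congr {q : ℝ} {u v : EuclideanSpace ℝ (Fin N) → 𝕜} (h : u =ᵐ[volume] v) :
    normLp q u = normLp q v := by rw [normLp, normLp, eLpNorm_congr_ae h]

theorem ofReal_normLp_two {u : EuclideanSpace ℝ (Fin N) → 𝕜} (hu : MemLp u 2 volume) :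
    ENNReal.ofReal (normLp 2 u) = eLpNorm u 2 volume := by
  rw [normLp_two, ENNReal.ofReal_toReal hu.2.ne]

theorem eLpNorm_two_sq {F : Type*} [NormedAddCommGroup F] {f : EuclideanSpace ℝ (Fin N) → F}
    (hf : MemLp f 2 volume) : (eLpNorm f 2 volume).toReal ^ 2 = ∫ x, ‖f x‖ ^ 2 := by
  have := hf.eLpNorm_eq_integral_rpow_norm (by simp) (by simp)
  rw [this, ENNReal.toReal_ofReal (by positivity), ← Real.rpow_natCast,
    ← Real.rpow_mul (integral_nonneg fun _ => by positivity)]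
  simp

theorem normLp_two_sq {u : EuclideanSpace ℝ (Fin N) → 𝕜} (hu : MemLp u 2 volume) :
    normLp 2 u ^ 2 = ∫ x, ‖u x‖ ^ 2 := by rw [normLp_two, eLpNorm_two_sq hu]

theorem normLp_rpow {p : ℝ} (hp : 0 < p) {u : EuclideanSpace ℝ (Fin N) → 𝕜}
    (hu : MemLp u (ENNReal.ofReal p) volume) : normLp p u ^ p = ∫ x, ‖u x‖ ^ p := by
  rw [normLp, hu.eLpNorm_eq_integral_rpow_norm (by simpa using hp) (by simp),
    ENNReal.toReal_ofReal (by positivity), ENNReal.toReal_ofReal hp.le,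
    ← Real.rpow_mul (integral_nonneg fun _ => by positivity), inv_mul_cancel₀ hp.ne', Real.rpow_one]

variable {u v : EuclideanSpace ℝ (Fin N) → 𝕜} {g g' : Fin N → EuclideanSpace ℝ (Fin N) → 𝕜}
  {h h' : Fin N → Fin N → EuclideanSpace ℝ (Fin N) → 𝕜}

theorem H2Data.memLp_lap (H : H2Data u g h) : MemLp (∑ i, h i i) 2 volume :=
  memLp_finsetSum' _ fun i _ => H.memLp₂ i i

theorem H2Data.weakLaplacian_ae (H : H2Data u g h) : weakLaplacian u =ᵐ[volume] ∑ i, h i i := by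
  have := fun i => H.weakPartial₂_ae i i
  filter_upwards [ae_all_iff.2 this] with x hx
  simp [weakLaplacian, hx]

theorem H2Data.normD2_eq (H : H2Data u g h) : normD2 u = normLp 2 (∑ i, h i i) := by
  rw [normLp_two, normD2, eLpNorm_congr_ae H.weakLaplacian_ae]

theorem H2Data.normD1_sq (H : H2Data u g h) : normD1 u ^ 2 = ∑ i, normLp 2 (g i) ^ 2 := by
  have h1 : weakGrad u =ᵐ[volume] fun x => WithLp.toLp 2 fun i => g i x := by
    filter_upwards [ae_all_iff.2 H.weakPartial_ae] with x hx
    simp [weakGrad, hx]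
  have h2 : MemLp (fun x => (WithLp.toLp 2 fun i => g i x : EuclideanSpace 𝕜 (Fin N))) 2 volume :=
    MemLp.of_eval_piLp H.memLp₁
  rw [normD1, eLpNorm_congr_ae h1, eLpNorm_two_sq h2]
  simp only [EuclideanSpace.norm_sq_eq]
  rw [integral_finsetSum _ fun i _ => (memLp_two_iff_integrable_sq_norm (H.memLp₁ i).1).1
    (H.memLp₁ i)]
  exact Finset.sum_congr rfl fun i _ => (normLp_two_sq (H.memLp₁ i)).symm

theorem normD1_nonneg (u : EuclideanSpace ℝ (Fin N) → 𝕜) : 0 ≤ normD1 u := ENNReal.toReal_nonneg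

theorem normD2_nonneg (u : EuclideanSpace ℝ (Fin N) → 𝕜) : 0 ≤ normD2 u := ENNReal.toReal_nonneg

theorem normLp_dilate {q : ℝ} (hq : 0 < q) (hu : AEStronglyMeasurable u volume) {a b : ℝ}
    (ha : 0 ≤ a) (hb : 0 < b) :
    normLp q (rescale a b u) = a * b ^ (-(N : ℝ) / q) * normLp q u := by
  have h1 : rescale a b u = a • fun x => u (b • x) := rfl
  rw [normLp, h1, eLpNorm_const_smul, eLpNorm_dilate hu (by simp) hb, ENNReal.toReal_mul,
    ENNReal.toReal_mul, ENNReal.toReal_ofReal (by positivity), ENNReal.toReal_ofReal hq.le,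
    normLp]
  simp [abs_of_nonneg ha, mul_assoc]

theorem normLp_translate {q : ℝ} (hu : AEStronglyMeasurable u volume)
    (y : EuclideanSpace ℝ (Fin N)) : normLp q (fun x => u (x + y)) = normLp q u := by
  rw [normLp, normLp]
  congr 1
  exact eLpNorm_comp_measurePreserving hu (measurePreserving_add_right volume y)

theorem normD1_translate (hu : MemH2 u) (y : EuclideanSpace ℝ (Fin N)) :
    normD1 (fun x => u (x + y)) = normD1 u := by
  have h1 := (hu.h2Data.translate y).normD1_sq
  simp only [normLp_translate (hu.h2Data.memLp₁ _).1] at h1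
  rw [← hu.h2Data.normD1_sq] at h1
  exact (pow_left_inj₀ (normD1_nonneg _) (normD1_nonneg _) two_ne_zero).1 h1

theorem normD2_translate (hu : MemH2 u) (y : EuclideanSpace ℝ (Fin N)) :
    normD2 (fun x => u (x + y)) = normD2 u := by
  rw [(hu.h2Data.translate y).normD2_eq, hu.h2Data.normD2_eq,
    ← normLp_translate hu.h2Data.memLp_lap.1 y]
  congr 1
  ext x
  simp

theorem normD1_rescale (hu : MemH2 u) {a b : ℝ} (ha : 0 ≤ a) (hb : 0 < b) :
    normD1 (rescale a b u) = a * b * b ^ (-(N : ℝ) / 2) * normD1 u := by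
  have h1 := (hu.h2Data.rescale a hb).normD1_sq
  simp only [normLp_dilate two_pos (hu.h2Data.memLp₁ _).1 (mul_nonneg ha hb.le) hb,
    mul_pow _ (normLp 2 _)] at h1
  rw [← Finset.mul_sum, ← hu.h2Data.normD1_sq, ← mul_pow] at h1
  have := normD1_nonneg u
  exact (pow_left_inj₀ (normD1_nonneg _) (by positivity) two_ne_zero).1 h1

theorem normD2_rescale (hu : MemH2 u) {a b : ℝ} (ha : 0 ≤ a) (hb : 0 < b) :
    normD2 (rescale a b u) = a * b ^ 2 * b ^ (-(N : ℝ) / 2) * normD2 u := by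
  rw [(hu.h2Data.rescale a hb).normD2_eq, hu.h2Data.normD2_eq,
    ← normLp_dilate two_pos hu.h2Data.memLp_lap.1 (by positivity) hb]
  congr 1
  ext x
  simp [rescale, Finset.smul_sum]

/-! ### Integral inequalities for convolutions -/

/-- A form of Minkowski's integral inequality. -/
theorem eLpNorm_integral_le {α β F : Type*} [MeasurableSpace α] [MeasurableSpace β]
    [NormedAddCommGroup F] [NormedSpace ℝ F] {μ : Measure α} {ν : Measure β} [SFinite μ]
    [IsFiniteMeasure ν] {q : ENNReal} (hq : 1 ≤ q) (hq' : q ≠ ⊤) {f : α → β → F}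
    (hf : AEStronglyMeasurable (Function.uncurry f) (μ.prod ν)) {K : ENNReal}
    (hK : ∀ᵐ y ∂ν, eLpNorm (fun x => f x y) q μ ≤ K) :
    eLpNorm (fun x => ∫ y, f x y ∂ν) q μ ≤ ν Set.univ * K := by
  have hq0 : q ≠ 0 := (zero_lt_one.trans_le hq).ne'
  set r := q.toReal with hr
  have hr1 : 1 ≤ r := by
    have := ENNReal.toReal_mono hq' hq
    simpa using this
  have hr0 : 0 < r := by linarith
  have hK' : ∀ᵐ y ∂ν, ∫⁻ x, ‖f x y‖ₑ ^ r ∂μ ≤ K ^ r := by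
    filter_upwards [hK] with y hy
    rw [eLpNorm_eq_lintegral_rpow_enorm_toReal hq0 hq'] at hy
    have := ENNReal.rpow_le_rpow hy hr0.le
    rwa [← ENNReal.rpow_mul, one_div, inv_mul_cancel₀ hr0.ne', ENNReal.rpow_one] at this
  -- Hölder in `y` against the constant 1 costs a power of the total mass of `ν`. Tonelli then
  -- reduces the claim to the bounds for fixed `y`.
  have h1 : ∀ᵐ x ∂μ, ‖∫ y, f x y ∂ν‖ₑ ^ r
      ≤ (∫⁻ y, ‖f x y‖ₑ ^ r ∂ν) * ν Set.univ ^ (r - 1) := by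
    filter_upwards [hf.prodMk_left] with x hx
    have h2 := eLpNorm_le_eLpNorm_mul_rpow_measure_univ hq hx
    rw [eLpNorm_one_eq_lintegral_enorm, eLpNorm_eq_lintegral_rpow_enorm_toReal hq0 hq'] at h2
    have h3 := ENNReal.rpow_le_rpow ((enorm_integral_le_lintegral_enorm _).trans h2) hr0.le
    rw [ENNReal.mul_rpow_of_nonneg _ _ hr0.le, ← ENNReal.rpow_mul, one_div,
      inv_mul_cancel₀ hr0.ne', ENNReal.rpow_one, ← ENNReal.rpow_mul] at h3
    have h4 : r - 1 = (1 / ENNReal.toReal 1 - q.toReal⁻¹) * r := by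
      rw [← hr, ENNReal.toReal_one]
      field_simp
    rw [h4]
    exact h3
  have h4 : ∫⁻ x, ‖∫ y, f x y ∂ν‖ₑ ^ r ∂μ ≤ (ν Set.univ * K) ^ r := by
    calc ∫⁻ x, ‖∫ y, f x y ∂ν‖ₑ ^ r ∂μ
        ≤ ∫⁻ x, (∫⁻ y, ‖f x y‖ₑ ^ r ∂ν) * ν Set.univ ^ (r - 1) ∂μ := lintegral_mono_ae h1
      _ = (∫⁻ x, (∫⁻ y, ‖f x y‖ₑ ^ r ∂ν) ∂μ) * ν Set.univ ^ (r - 1) :=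
          lintegral_mul_const' _ _ (by
            exact ENNReal.rpow_ne_top_of_nonneg (by linarith) (measure_ne_top _ _))
      _ = (∫⁻ y, (∫⁻ x, ‖f x y‖ₑ ^ r ∂μ) ∂ν) * ν Set.univ ^ (r - 1) := by
          rw [lintegral_lintegral_swap]
          exact hf.enorm.pow_const r
      _ ≤ (∫⁻ _, K ^ r ∂ν) * ν Set.univ ^ (r - 1) := by
          gcongr ?_ * _
          exact lintegral_mono_ae hK'
      _ = (ν Set.univ * K) ^ r := by
          rw [lintegral_const, ENNReal.mul_rpow_of_nonneg _ _ hr0.le, mul_assoc, mul_comm]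
          congr 1
          nth_rewrite 1 [← ENNReal.rpow_one (ν Set.univ)]
          rw [← ENNReal.rpow_add_of_nonneg _ _ zero_le_one (by linarith)]
          ring_nf
  rw [eLpNorm_eq_lintegral_rpow_enorm_toReal hq0 hq', ← hr]
  calc (∫⁻ x, ‖∫ y, f x y ∂ν‖ₑ ^ r ∂μ) ^ (1 / r) ≤ ((ν Set.univ * K) ^ r) ^ (1 / r) := by
        gcongr
    _ = ν Set.univ * K := by
        rw [← ENNReal.rpow_mul, one_div, mul_inv_cancel₀ hr0.ne', ENNReal.rpow_one]

/-- A bounded weight with compact support is dominated by a multiple of Lebesgue measure on that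
compact set, which is finite. The crude constant `m |s|`, in place of the `L¹` norm of the weight,
suffices below. -/
theorem eLpNorm_integral_weight_le {q : ENNReal} (hq : 1 ≤ q) (hq' : q ≠ ⊤)
    {ψ : EuclideanSpace ℝ (Fin N) → ℝ} (hψ : Continuous ψ) {m : ℝ} (hm : ∀ y, ‖ψ y‖ ≤ m)
    {s : Set (EuclideanSpace ℝ (Fin N))} (hs : IsCompact s) (hψs : ∀ y ∉ s, ψ y = 0)
    {f : EuclideanSpace ℝ (Fin N) → EuclideanSpace ℝ (Fin N) → 𝕜}
    (hf : AEStronglyMeasurable (Function.uncurry f) (volume.prod volume)) {K : ENNReal}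
    (hK : ∀ y ∈ s, eLpNorm (fun x => f x y) q volume ≤ K) :
    eLpNorm (fun x => ∫ y, ψ y • f x y) q volume ≤ volume s * (ENNReal.ofReal m * K) := by
  have : IsFiniteMeasure (volume.restrict s) := ⟨by simpa using hs.measure_lt_top⟩
  have h1 : ∀ x, ∫ y, ψ y • f x y = ∫ y in s, ψ y • f x y := fun x =>
    (setIntegral_eq_integral_of_forall_compl_eq_zero fun y hy => by simp [hψs y hy]).symm
  simp only [h1]
  have h2 := eLpNorm_integral_le (μ := (volume : Measure (EuclideanSpace ℝ (Fin N))))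
    (ν := volume.restrict s) (f := fun x y => ψ y • f x y) hq hq' ?_
    (K := ENNReal.ofReal m * K) ?_
  · simpa using h2
  · have h3 : AEStronglyMeasurable (Function.uncurry fun x y => ψ y • f x y)
        ((volume : Measure (EuclideanSpace ℝ (Fin N))).prod volume) :=
      (hψ.comp continuous_snd).aestronglyMeasurable.smul hf
    exact h3.mono_ac (Measure.AbsolutelyContinuous.prod .rfl Measure.restrict_le_self.absolutelyContinuous)
  · refine (ae_restrict_iff' hs.measurableSet).2 (.of_forall fun y hy => ?_)
    refine (eLpNorm_const_smul_le (c := ψ y) (f := fun x => f x y)).trans ?_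
    gcongr
    · rw [← ofReal_norm]
      exact ENNReal.ofReal_le_ofReal (hm y)
    · exact hK y hy

/-- Convolution with a real weight. -/
def conv (ψ : EuclideanSpace ℝ (Fin N) → ℝ) (u : EuclideanSpace ℝ (Fin N) → 𝕜) :
    EuclideanSpace ℝ (Fin N) → 𝕜 :=
  convolution ψ u (ContinuousLinearMap.lsmul ℝ ℝ) volume

theorem conv_apply (ψ : EuclideanSpace ℝ (Fin N) → ℝ) (u : EuclideanSpace ℝ (Fin N) → 𝕜)
    (x : EuclideanSpace ℝ (Fin N)) : conv ψ u x = ∫ y, ψ y • u (x - y) := rfl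

theorem conv_swap (ψ : EuclideanSpace ℝ (Fin N) → ℝ) (u : EuclideanSpace ℝ (Fin N) → 𝕜)
    (x : EuclideanSpace ℝ (Fin N)) : conv ψ u x = ∫ y, ψ (x - y) • u y :=
  convolution_eq_swap _

theorem conv_congr (ψ : EuclideanSpace ℝ (Fin N) → ℝ) {u v : EuclideanSpace ℝ (Fin N) → 𝕜}
    (h : u =ᵐ[volume] v) : conv ψ u = conv ψ v := by
  ext x
  rw [conv_swap, conv_swap]
  refine integral_congr_ae ?_
  filter_upwards [h] with y hy
  rw [hy]

theorem conv_translate (ψ : EuclideanSpace ℝ (Fin N) → ℝ) (u : EuclideanSpace ℝ (Fin N) → 𝕜)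
    (z x : EuclideanSpace ℝ (Fin N)) : conv ψ (fun x => u (x + z)) x = conv ψ u (x + z) := by
  rw [conv_apply, conv_apply]
  congr 1
  ext y
  rw [sub_add_eq_add_sub]

section Test

variable {ψ : EuclideanSpace ℝ (Fin N) → ℝ} {u g : EuclideanSpace ℝ (Fin N) → 𝕜}

theorem integrable_conv (hψ : Continuous ψ) (hc : HasCompactSupport ψ)
    (hu : LocallyIntegrable u volume) (x : EuclideanSpace ℝ (Fin N)) :
    Integrable (fun y => ψ (x - y) • u y) volume :=
  hu.integrable_smul_left_of_hasCompactSupport (hψ.comp (continuous_sub_left x))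
    (hc.comp_homeomorph (Homeomorph.subLeft x))

theorem conv_sub (hψ : Continuous ψ) (hc : HasCompactSupport ψ) {v : EuclideanSpace ℝ (Fin N) → 𝕜}
    (hu : LocallyIntegrable u volume) (hv : LocallyIntegrable v volume) :
    conv ψ (u - v) = conv ψ u - conv ψ v := by
  ext x
  simp only [Pi.sub_apply, conv_swap, smul_sub]
  exact integral_sub (integrable_conv hψ hc hu x) (integrable_conv hψ hc hv x)

theorem conv_sum (hψ : Continuous ψ) (hc : HasCompactSupport ψ) {ι : Type*} (s : Finset ι)
    {v : ι → EuclideanSpace ℝ (Fin N) → 𝕜} (hv : ∀ i ∈ s, LocallyIntegrable (v i) volume) :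
    conv ψ (∑ i ∈ s, v i) = ∑ i ∈ s, conv ψ (v i) := by
  ext x
  simp only [Finset.sum_apply, conv_swap, Finset.smul_sum]
  exact integral_finsetSum _ fun i hi => integrable_conv hψ hc (hv i hi) x

theorem conv_contDiff (hψ : ContDiff ℝ ∞ ψ) (hc : HasCompactSupport ψ)
    (hu : LocallyIntegrable u volume) : ContDiff ℝ ∞ (conv ψ u) :=
  hc.contDiff_convolution_left _ hψ hu

theorem fderiv_conv_apply (hψ : ContDiff ℝ ∞ ψ) (hc : HasCompactSupport ψ)
    (hu : LocallyIntegrable u volume) (e x : EuclideanSpace ℝ (Fin N)) :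
    fderiv ℝ (conv ψ u) x e = conv (fun y => fderiv ℝ ψ y e) u x := by
  have h := hc.hasFDerivAt_convolution_left (ContinuousLinearMap.lsmul ℝ ℝ (E := 𝕜))
    (hψ.of_le (by simp)) hu x
  rw [conv, h.fderiv, conv_apply, convolution_def, ContinuousLinearMap.integral_apply]
  · rfl
  · exact (hc.fderiv ℝ).convolutionExists_left
      (ContinuousLinearMap.precompL (EuclideanSpace ℝ (Fin N))
        (ContinuousLinearMap.lsmul ℝ ℝ (E := 𝕜)))
      (hψ.continuous_fderiv (by simp)) hu x

/-- Testing the weak derivative against `y ↦ ψ (x - y)` moves the derivative from the kernel onto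
`u`. -/
theorem HasWeakPartial.fderiv_conv {i : Fin N} (h : HasWeakPartial i u g) (hψ : ContDiff ℝ ∞ ψ)
    (hc : HasCompactSupport ψ) (x : EuclideanSpace ℝ (Fin N)) :
    fderiv ℝ (conv ψ u) x (EuclideanSpace.single i 1) = conv ψ g x := by
  have h1 := h.integral_eq (fun y => ψ (x - y)) (hψ.comp (contDiff_const.sub contDiff_id))
    (hc.comp_homeomorph (Homeomorph.subLeft x))
  have h2 : ∀ y, fderiv ℝ (fun y => ψ (x - y)) y = - fderiv ℝ ψ (x - y) := fun y => by
    have h3 : HasFDerivAt (fun y => x - y) (-ContinuousLinearMap.id ℝ _) y := by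
      simpa using (hasFDerivAt_id y).const_sub x
    have h4 := ((hψ.differentiable (by simp)) (x - y)).hasFDerivAt.comp y h3
    rw [show (fun y => ψ (x - y)) = ψ ∘ fun y => x - y from rfl, h4.fderiv]
    ext v; simp
  simp only [h2, neg_apply, neg_smul, integral_neg, neg_inj] at h1
  rw [fderiv_conv_apply hψ hc h.locallyIntegrable_fun, conv_swap, conv_swap, h1]

theorem aestronglyMeasurable_comp_sub (hu : AEStronglyMeasurable u volume) :
    AEStronglyMeasurable (fun p : EuclideanSpace ℝ (Fin N) × EuclideanSpace ℝ (Fin N) =>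
      u (p.1 - p.2)) (volume.prod volume) :=
  hu.comp_quasiMeasurePreserving (quasiMeasurePreserving_sub_of_right_invariant volume volume)

theorem eLpNorm_comp_add (hu : AEStronglyMeasurable u volume) (q : ENNReal)
    (y : EuclideanSpace ℝ (Fin N)) : eLpNorm (fun x => u (x + y)) q volume = eLpNorm u q volume :=
  eLpNorm_comp_measurePreserving hu (measurePreserving_add_right volume y)

theorem memLp_conv {q : ENNReal} (hq : 1 ≤ q) (hq' : q ≠ ⊤) (hψ : Continuous ψ)
    (hc : HasCompactSupport ψ) (hu : MemLp u q volume) : MemLp (conv ψ u) q volume := by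
  refine ⟨(hc.continuous_convolution_left _ hψ (hu.locallyIntegrable hq)).aestronglyMeasurable, ?_⟩
  obtain ⟨m, hm⟩ := hψ.bounded_above_of_compact_support hc
  refine (eLpNorm_integral_weight_le hq hq' hψ hm hc.isCompact
    (fun y hy => image_eq_zero_of_notMem_tsupport hy) (f := fun x y => u (x - y))
    (aestronglyMeasurable_comp_sub hu.1) (K := eLpNorm u q volume) fun y _ => ?_).trans_lt ?_
  · simp only [sub_eq_add_neg]
    rw [eLpNorm_comp_add hu.1]
  · exact ENNReal.mul_lt_top hc.isCompact.measure_lt_top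
      (ENNReal.mul_lt_top ENNReal.ofReal_lt_top hu.2)

end Test

/-! ### Mollification -/

/-- A bump function at scale `t`. -/
def bump {t : ℝ} (ht : 0 < t) : ContDiffBump (0 : EuclideanSpace ℝ (Fin N)) :=
  ⟨t / 2, t, by positivity, by linarith⟩

/-- The mollifier at scale `t`. -/
def mol {t : ℝ} (ht : 0 < t) : EuclideanSpace ℝ (Fin N) → ℝ := (bump ht).normed volume

section Mol

variable {t : ℝ} (ht : 0 < t)

theorem mol_contDiff : ContDiff ℝ ∞ (mol (N := N) ht) := (bump ht).contDiff_normed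

theorem mol_hasCompactSupport : HasCompactSupport (mol (N := N) ht) :=
  (bump ht).hasCompactSupport_normed

theorem mol_continuous : Continuous (mol (N := N) ht) := (mol_contDiff ht).continuous

theorem mol_nonneg (y : EuclideanSpace ℝ (Fin N)) : 0 ≤ mol ht y := (bump ht).nonneg_normed y

theorem mol_neg (y : EuclideanSpace ℝ (Fin N)) : mol ht (-y) = mol ht y := (bump ht).normed_neg y

/-- The bump equals 1 on the ball of half the radius, so its integral is at least `2 ^ (-N)` times
the volume of the full ball. -/
theorem mol_norm_le (y : EuclideanSpace ℝ (Fin N)) :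
    ‖mol ht y‖ ≤ 2 ^ N / volume.real (Metric.closedBall (0 : EuclideanSpace ℝ (Fin N)) t) := by
  have := (bump (N := N) ht).normed_le_div_measure_closedBall_rOut volume 2
    (show t ≤ 2 * (t / 2) by linarith) y
  rw [Real.norm_of_nonneg (mol_nonneg ht y)]
  simpa [mol, bump] using this

theorem mol_eq_zero {y : EuclideanSpace ℝ (Fin N)} (hy : y ∉ Metric.closedBall 0 t) :
    mol ht y = 0 := by
  have : y ∉ tsupport (mol ht) := by
    rw [mol, ContDiffBump.tsupport_normed_eq]; exact hy
  exact image_eq_zero_of_notMem_tsupport this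

theorem integral_mol : ∫ y, mol (N := N) ht y = 1 := (bump ht).integral_normed

theorem integral_mol_smul (c : 𝕜) : ∫ y, mol (N := N) ht y • c = c :=
  (bump ht).integral_normed_smul volume c

theorem measureReal_closedBall_pos {t : ℝ} (ht : 0 < t) :
    0 < volume.real (Metric.closedBall (0 : EuclideanSpace ℝ (Fin N)) t) :=
  ENNReal.toReal_pos (Metric.measure_closedBall_pos _ _ ht).ne'
    (isCompact_closedBall _ _).measure_ne_top

/-- The volume of the ball cancels against the bound of `mol_norm_le`, so the constant `2 ^ N` does
not depend on the scale. -/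
theorem eLpNorm_integral_mol_le {q : ENNReal} (hq : 1 ≤ q) (hq' : q ≠ ⊤)
    {f : EuclideanSpace ℝ (Fin N) → EuclideanSpace ℝ (Fin N) → 𝕜}
    (hf : AEStronglyMeasurable (Function.uncurry f) (volume.prod volume)) {K : ENNReal}
    (hK : ∀ y, ‖y‖ ≤ t → eLpNorm (fun x => f x y) q volume ≤ K) :
    eLpNorm (fun x => ∫ y, mol ht y • f x y) q volume ≤ 2 ^ N * K := by
  refine (eLpNorm_integral_weight_le hq hq' (mol_continuous ht) (mol_norm_le ht)
    (isCompact_closedBall 0 t) (fun y hy => mol_eq_zero ht hy) hf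
    (fun y hy => hK y (by simpa using hy))).trans_eq ?_
  rw [← mul_assoc]
  congr 1
  have h := measureReal_closedBall_pos (N := N) ht
  rw [← ENNReal.ofReal_toReal (isCompact_closedBall _ _).measure_ne_top,
    ← ENNReal.ofReal_mul (by positivity)]
  change ENNReal.ofReal (volume.real _ * _) = _
  rw [mul_div_cancel₀ _ h.ne', ENNReal.ofReal_pow zero_le_two]
  simp

/-- Mollification at scale `t`. -/
def mollify (u : EuclideanSpace ℝ (Fin N) → 𝕜) : EuclideanSpace ℝ (Fin N) → 𝕜 := conv (mol ht) u

variable {u : EuclideanSpace ℝ (Fin N) → 𝕜}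

theorem eLpNorm_mollify_le {q : ENNReal} (hq : 1 ≤ q) (hq' : q ≠ ⊤)
    (hu : AEStronglyMeasurable u volume) :
    eLpNorm (mollify ht u) q volume ≤ 2 ^ N * eLpNorm u q volume := by
  refine eLpNorm_integral_mol_le ht hq hq' (f := fun x y => u (x - y))
    (aestronglyMeasurable_comp_sub hu) fun y _ => ?_
  simp only [sub_eq_add_neg]
  rw [eLpNorm_comp_add hu]

theorem memLp_mollify {q : ENNReal} (hq : 1 ≤ q) (hq' : q ≠ ⊤) (hu : MemLp u q volume) :
    MemLp (mollify ht u) q volume :=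
  memLp_conv hq hq' (mol_continuous ht) (mol_hasCompactSupport ht) hu

variable (N) in
/-- The constant in `norm_mollify_le`. -/
def molConst : ℝ := 2 ^ N / √(volume.real (Metric.closedBall (0 : EuclideanSpace ℝ (Fin N)) 1))

theorem molConst_pos : 0 < molConst N := by
  have := measureReal_closedBall_pos (N := N) zero_lt_one
  unfold molConst; positivity

/-- Cauchy–Schwarz on the ball of radius `t`: by `mol_norm_le` the `L²` norm of the kernel is at
most `2 ^ N` over the square root of the volume, which is proportional to `t ^ N`. -/
theorem norm_mollify_le (hu : MemLp u 2 volume) (x : EuclideanSpace ℝ (Fin N)) :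
    ‖mollify ht u x‖ ≤ molConst N * t ^ (-(N : ℝ) / 2) * normLp 2 u := by
  set s := Metric.closedBall (0 : EuclideanSpace ℝ (Fin N)) t
  have hV : volume.real s = t ^ N * volume.real (Metric.closedBall (0 : EuclideanSpace ℝ (Fin N)) 1) := by
    rw [measureReal_def, measureReal_def, Measure.addHaar_closedBall' _ _ ht.le,
      ENNReal.toReal_mul, ENNReal.toReal_ofReal (by positivity)]
    simp
  have hs := measureReal_closedBall_pos (N := N) ht
  have h1 : ‖mollify ht u x‖ₑ ≤ eLpNorm (mol (N := N) ht • fun y => u (x - y)) 1 (volume.restrict s) := by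
    rw [eLpNorm_one_eq_lintegral_enorm, mollify, conv_apply,
      ← setIntegral_eq_integral_of_forall_compl_eq_zero (s := s)
        (fun y hy => by simp [mol_eq_zero ht hy])]
    exact enorm_integral_le_lintegral_enorm _
  have hux : AEStronglyMeasurable (fun y => u (x - y)) volume :=
    hu.1.comp_quasiMeasurePreserving (quasiMeasurePreserving_sub_left_of_right_invariant volume x)
  have h2 := eLpNorm_smul_le_mul_eLpNorm (p := 2) (q := 2) (r := 1) (μ := volume.restrict s)
    hux.restrict (mol_continuous ht).aestronglyMeasurable
  have h3 : eLpNorm (fun y => u (x - y)) 2 (volume.restrict s) ≤ eLpNorm u 2 volume :=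
    (eLpNorm_mono_measure _ Measure.restrict_le_self).trans_eq
      (eLpNorm_comp_measurePreserving hu.1 (Measure.measurePreserving_sub_left volume x))
  have h4 := eLpNorm_le_of_ae_bound (p := 2) (μ := volume.restrict s)
    (Eventually.of_forall (mol_norm_le (N := N) ht))
  have h5 : ‖mollify ht u x‖ₑ ≤ _ := h1.trans (h2.trans (mul_le_mul' h4 h3))
  have hsf : volume s ≠ ⊤ := (isCompact_closedBall _ _).measure_ne_top
  rw [← ofReal_normLp_two hu, Measure.restrict_apply_univ, ← ENNReal.ofReal_toReal hsf,
    ENNReal.ofReal_rpow_of_nonneg ENNReal.toReal_nonneg (by simp),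
    ← ENNReal.ofReal_mul (by positivity), ← ENNReal.ofReal_mul (by positivity),
    ← ofReal_norm, ENNReal.ofReal_le_ofReal_iff (mul_nonneg (by positivity) (normLp_nonneg _ _))] at h5
  refine h5.trans_eq ?_
  congr 1
  change volume.real s ^ _ * (2 ^ N / volume.real s) = _
  have h6 : (ENNReal.toReal 2)⁻¹ = 1 / 2 := by simp
  rw [h6, ← Real.sqrt_eq_rpow, molConst]
  have h7 : √(volume.real s) = t ^ ((N : ℝ) / 2) *
      √(volume.real (Metric.closedBall (0 : EuclideanSpace ℝ (Fin N)) 1)) := by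
    rw [hV, Real.sqrt_mul (by positivity), Real.sqrt_eq_rpow (t ^ N), ← Real.rpow_natCast,
      ← Real.rpow_mul ht.le, mul_one_div]
  have h8 : √(volume.real s) * (2 ^ N / volume.real s) = 2 ^ N / √(volume.real s) := by
    have := Real.sq_sqrt hs.le
    have h9 : 0 < √(volume.real s) := Real.sqrt_pos.2 hs
    field_simp
    rw [this, div_self hs.ne']
  rw [h8, h7, neg_div, Real.rpow_neg ht.le]
  field_simp

theorem tendsto_mollify_ae (hu : LocallyIntegrable u volume) :
    ∀ᵐ x, Tendsto (fun n : ℕ => mollify (Nat.one_div_pos_of_nat (α := ℝ) (n := n)) u x) atTop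
      (𝓝 (u x)) := by
  refine ContDiffBump.ae_convolution_tendsto_right_of_locallyIntegrable (K := 2) ?_ ?_ hu
  · exact tendsto_one_div_add_atTop_nhds_zero_nat
  · exact .of_forall fun n => by simp only [bump]; linarith

end Mol

/-- Fatou's lemma. It transfers bounds that are uniform in the scale from mollified functions to the
function itself. -/
theorem eLpNorm_le_of_ae_tendsto {F : Type*} [NormedAddCommGroup F] {q : ENNReal}
    {f : ℕ → EuclideanSpace ℝ (Fin N) → F} {v : EuclideanSpace ℝ (Fin N) → F}
    (hf : ∀ n, AEStronglyMeasurable (f n) volume)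
    (h : ∀ᵐ x, Tendsto (fun n => f n x) atTop (𝓝 (v x))) {K : ENNReal}
    (hK : ∀ n, eLpNorm (f n) q volume ≤ K) : eLpNorm v q volume ≤ K := by
  refine (Lp.eLpNorm_lim_le_liminf_eLpNorm hf v h).trans ?_
  exact (liminf_le_liminf (.of_forall hK)).trans_eq (liminf_const K)

/-! ### Difference quotients and mollification errors -/

/-- The increment is the integral of the directional derivative along the segment from `x` to `x +
z`. Minkowski's inequality and translation invariance finish. -/
theorem eLpNorm_sub_translate_le_of_contDiff {f : EuclideanSpace ℝ (Fin N) → 𝕜}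
    (hf : ContDiff ℝ 1 f) (z : EuclideanSpace ℝ (Fin N)) :
    eLpNorm (fun x => f (x + z) - f x) 2 volume
      ≤ ‖z‖ₑ * ∑ i, eLpNorm (fun x => fderiv ℝ f x (EuclideanSpace.single i 1)) 2 volume := by
  have hfd : Continuous (fderiv ℝ f) := hf.continuous_fderiv (by simp)
  have h1 : ∀ x, f (x + z) - f x = ∫ s in Set.Ioc (0 : ℝ) 1, fderiv ℝ f (x + s • z) z := by
    intro x
    have hd : ∀ s : ℝ, HasDerivAt (fun s : ℝ => f (x + s • z)) (fderiv ℝ f (x + s • z) z) s := by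
      intro s
      have h2 : HasDerivAt (fun s : ℝ => x + s • z) z s := by
        simpa using ((hasDerivAt_id s).smul_const z).const_add x
      exact ((hf.differentiable (by simp)) _).hasFDerivAt.comp_hasDerivAt s h2
    have hcont : Continuous fun s : ℝ => fderiv ℝ f (x + s • z) z := by fun_prop
    have := intervalIntegral.integral_eq_sub_of_hasDerivAt (a := 0) (b := 1) (fun s _ => hd s)
      (hcont.intervalIntegrable _ _)
    rw [intervalIntegral.integral_of_le zero_le_one] at this
    simpa using this.symm
  simp only [h1]
  have h2 : Continuous (Function.uncurry fun (x : EuclideanSpace ℝ (Fin N)) (s : ℝ) =>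
      fderiv ℝ f (x + s • z) z) := by
    unfold Function.uncurry
    fun_prop
  refine (eLpNorm_integral_le (ν := volume.restrict (Set.Ioc (0 : ℝ) 1)) (q := 2)
    (by norm_num) (by simp) h2.aestronglyMeasurable (K := ‖z‖ₑ * ∑ i, eLpNorm (fun x =>
      fderiv ℝ f x (EuclideanSpace.single i 1)) 2 volume) (.of_forall fun s => ?_)).trans_eq
    (by simp)
  have h3 : Continuous fun x => fderiv ℝ f x z := by fun_prop
  rw [eLpNorm_comp_add (u := fun x => fderiv ℝ f x z) h3.aestronglyMeasurable]
  have h4 : (fun x => fderiv ℝ f x z)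
      = ∑ i, (fun x => z i • fderiv ℝ f x (EuclideanSpace.single i 1)) := by
    ext x
    have hz : z = ∑ i, z i • EuclideanSpace.single i (1 : ℝ) := by
      ext j; simp [Finset.sum_apply, Pi.single_apply]
    conv_lhs => rw [hz]
    simp
  rw [h4, Finset.mul_sum]
  refine (eLpNorm_sum_le (fun i _ => ?_) (by norm_num)).trans (Finset.sum_le_sum fun i _ => ?_)
  · exact (by fun_prop : Continuous fun x => z i • fderiv ℝ f x
      (EuclideanSpace.single i 1)).aestronglyMeasurable
  · refine (eLpNorm_const_smul_le (c := z i)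
      (f := fun x => fderiv ℝ f x (EuclideanSpace.single i 1))).trans ?_
    gcongr
    rw [enorm_le_iff_norm_le]
    exact PiLp.norm_apply_le z i

/-- The smooth case applies to mollifications, whose derivatives are the mollified `g i`; this costs
`2 ^ N`. The limit is taken by `eLpNorm_le_of_ae_tendsto`. -/
theorem eLpNorm_sub_translate_le {u : EuclideanSpace ℝ (Fin N) → 𝕜}
    {g : Fin N → EuclideanSpace ℝ (Fin N) → 𝕜} (hg : ∀ i, HasWeakPartial i u (g i))
    (hu : LocallyIntegrable u volume) (z : EuclideanSpace ℝ (Fin N)) :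
    eLpNorm (fun x => u (x + z) - u x) 2 volume
      ≤ ‖z‖ₑ * (2 ^ N * ∑ i, eLpNorm (g i) 2 volume) := by
  have hc := fun n : ℕ => conv_contDiff (mol_contDiff (N := N)
    (Nat.one_div_pos_of_nat (α := ℝ) (n := n))) (mol_hasCompactSupport _) hu
  refine eLpNorm_le_of_ae_tendsto (f := fun n x =>
    mollify (Nat.one_div_pos_of_nat (α := ℝ) (n := n)) u (x + z)
      - mollify (Nat.one_div_pos_of_nat (α := ℝ) (n := n)) u x) (fun n => ?_) ?_ fun n => ?_
  · have : Continuous (mollify (Nat.one_div_pos_of_nat (α := ℝ) (n := n)) u) := (hc n).continuous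
    exact (by fun_prop : Continuous fun x => mollify _ u (x + z) - mollify _ u x).aestronglyMeasurable
  · have h1 := tendsto_mollify_ae hu
    have h2 := (measurePreserving_add_right volume z).quasiMeasurePreserving.ae h1
    filter_upwards [h1, h2] with x hx1 hx2
    exact hx2.sub hx1
  · refine (eLpNorm_sub_translate_le_of_contDiff ((hc n).of_le (by simp)) z).trans ?_
    refine mul_le_mul' le_rfl ?_
    rw [Finset.mul_sum]
    refine Finset.sum_le_sum fun i _ => ?_
    simp only [(hg i).fderiv_conv (mol_contDiff _) (mol_hasCompactSupport _)]
    exact eLpNorm_mollify_le _ (by norm_num) (by simp)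
      (hg i).locallyIntegrable_deriv.aestronglyMeasurable

theorem integrable_mol_smul_comp_sub {t : ℝ} (ht : 0 < t) {u : EuclideanSpace ℝ (Fin N) → 𝕜}
    (hu : LocallyIntegrable u volume) (x : EuclideanSpace ℝ (Fin N)) :
    Integrable (fun y => mol ht y • u (x - y)) volume :=
  (mol_hasCompactSupport ht).convolutionExists_left (ContinuousLinearMap.lsmul ℝ ℝ (E := 𝕜))
    (mol_continuous ht) hu x

theorem sub_mollify_eq {t : ℝ} (ht : 0 < t) {u : EuclideanSpace ℝ (Fin N) → 𝕜}
    (hu : LocallyIntegrable u volume) (x : EuclideanSpace ℝ (Fin N)) :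
    u x - mollify ht u x = ∫ y, mol ht y • (u x - u (x - y)) := by
  simp only [smul_sub]
  rw [integral_sub ((mol_continuous ht).integrable_of_hasCompactSupport
    (mol_hasCompactSupport ht) |>.smul_const _) (integrable_mol_smul_comp_sub ht hu x),
    integral_mol_smul]
  rfl

theorem aestronglyMeasurable_comp_fst {u : EuclideanSpace ℝ (Fin N) → 𝕜}
    (hu : AEStronglyMeasurable u volume) :
    AEStronglyMeasurable (fun p : EuclideanSpace ℝ (Fin N) × EuclideanSpace ℝ (Fin N) =>
      u p.1) (volume.prod volume) :=
  hu.comp_quasiMeasurePreserving Measure.quasiMeasurePreserving_fst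

/-- Since the kernel has integral 1, the error is an average of the increments `u x - u (x - y)`
over `‖y‖ ≤ t`. -/
theorem eLpNorm_sub_mollify_le {t : ℝ} (ht : 0 < t) {u : EuclideanSpace ℝ (Fin N) → 𝕜}
    {g : Fin N → EuclideanSpace ℝ (Fin N) → 𝕜} (hg : ∀ i, HasWeakPartial i u (g i))
    (hu : LocallyIntegrable u volume) :
    eLpNorm (u - mollify ht u) 2 volume
      ≤ 2 ^ N * (ENNReal.ofReal t * (2 ^ N * ∑ i, eLpNorm (g i) 2 volume)) := by
  have h1 : u - mollify ht u = fun x => ∫ y, mol ht y • (u x - u (x - y)) :=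
    funext fun x => sub_mollify_eq ht hu x
  rw [h1]
  refine eLpNorm_integral_mol_le ht (f := fun x y => u x - u (x - y)) (by norm_num) (by simp)
    ((aestronglyMeasurable_comp_fst hu.aestronglyMeasurable).sub
      (aestronglyMeasurable_comp_sub hu.aestronglyMeasurable)) fun y hy => ?_
  have h2 := eLpNorm_sub_translate_le hg hu (-y)
  rw [enorm_neg] at h2
  rw [← eLpNorm_neg]
  refine (le_of_eq ?_).trans (h2.trans ?_)
  · congr 1; ext x; simp [sub_eq_add_neg, add_comm]
  · gcongr
    rw [← ofReal_norm]
    exact ENNReal.ofReal_le_ofReal hy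

/-- The second difference is the increment by `-z` of `x ↦ u (x + z) - u x`, whose weak derivatives
are themselves increments of the `g i`. The first-order estimate is used twice. -/
theorem eLpNorm_second_difference_le {u : EuclideanSpace ℝ (Fin N) → 𝕜}
    {g : Fin N → EuclideanSpace ℝ (Fin N) → 𝕜}
    {h : Fin N → Fin N → EuclideanSpace ℝ (Fin N) → 𝕜}
    (hg : ∀ i, HasWeakPartial i u (g i)) (hh : ∀ i j, HasWeakPartial j (g i) (h i j))
    (hu : LocallyIntegrable u volume) (z : EuclideanSpace ℝ (Fin N)) :
    eLpNorm (fun x => (u x - u (x - z)) + (u x - u (x + z))) 2 volume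
      ≤ ‖z‖ₑ * (2 ^ N * ∑ i, ‖z‖ₑ * (2 ^ N * ∑ j, eLpNorm (h i j) 2 volume)) := by
  have h1 : ∀ i, HasWeakPartial i (fun x => u (x + z) - u x) (fun x => g i (x + z) - g i x) :=
    fun i => ((hg i).translate z).sub (hg i)
  have h2 := eLpNorm_sub_translate_le h1
    ((LocallyIntegrable.comp_translate hu z).sub hu) (-z)
  rw [enorm_neg] at h2
  refine (le_of_eq ?_).trans (h2.trans ?_)
  · congr 1; ext x; simp only [neg_add_cancel_right]; rw [← sub_eq_add_neg]; ring
  · gcongr with i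
    exact eLpNorm_sub_translate_le (hh i) (hg i).locallyIntegrable_deriv z

theorem eLpNorm_sub_mollify_le₂ {t : ℝ} (ht : 0 < t) {u : EuclideanSpace ℝ (Fin N) → 𝕜}
    {g : Fin N → EuclideanSpace ℝ (Fin N) → 𝕜}
    {h : Fin N → Fin N → EuclideanSpace ℝ (Fin N) → 𝕜}
    (hg : ∀ i, HasWeakPartial i u (g i)) (hh : ∀ i j, HasWeakPartial j (g i) (h i j))
    (hu : LocallyIntegrable u volume) :
    eLpNorm (u - mollify ht u) 2 volume
      ≤ 2 ^ N * (ENNReal.ofReal t * (2 ^ N * ∑ i, ENNReal.ofReal t *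
        (2 ^ N * ∑ j, eLpNorm (h i j) 2 volume))) := by
  have hi := fun x => integrable_mol_smul_comp_sub ht hu x
  have hneg : ∀ x, (fun y => mol ht y • u (x + y)) = fun y => mol ht (-y) • u (x - -y) :=
    fun x => by ext y; rw [mol_neg, sub_neg_eq_add]
  -- Averaging the formula for the error with its reflection under `y ↦ -y`, which is allowed
  -- because the kernel is even, produces second differences and thereby the gain from `t` to `t²`.
  have h1 : (2 : 𝕜) • (u - mollify ht u)
      = fun x => ∫ y, mol ht y • ((u x - u (x - y)) + (u x - u (x + y))) := by
    ext x
    have h2 : ∫ y, mol ht y • (u x - u (x + y)) = u x - mollify ht u x := by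
      rw [sub_mollify_eq ht hu, ← integral_neg_eq_self]
      simp only [mol_neg, ← sub_eq_add_neg]
    have hc := (mol_continuous (N := N) ht).integrable_of_hasCompactSupport
      (mol_hasCompactSupport ht) (μ := volume)
    simp only [smul_add]
    rw [integral_add, h2, ← sub_mollify_eq ht hu]
    · simp [two_mul]
    · simp only [smul_sub]
      exact (hc.smul_const _).sub (hi x)
    · simp only [smul_sub]
      refine (hc.smul_const _).sub ?_
      rw [hneg]
      exact (hi x).comp_neg
  have h2 : eLpNorm ((2 : 𝕜) • (u - mollify ht u)) 2 volume
      ≤ 2 ^ N * (ENNReal.ofReal t * (2 ^ N * ∑ i, ENNReal.ofReal t *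
        (2 ^ N * ∑ j, eLpNorm (h i j) 2 volume))) := by
    rw [h1]
    have hm := hu.aestronglyMeasurable
    have hm2 : AEStronglyMeasurable (fun p : EuclideanSpace ℝ (Fin N) × EuclideanSpace ℝ (Fin N) =>
        u (p.1 + p.2)) (volume.prod volume) :=
      hm.comp_quasiMeasurePreserving (quasiMeasurePreserving_add volume volume)
    refine eLpNorm_integral_mol_le ht (f := fun x y => (u x - u (x - y)) + (u x - u (x + y)))
      (by norm_num) (by simp) (((aestronglyMeasurable_comp_fst hm).sub
      (aestronglyMeasurable_comp_sub hm)).add ((aestronglyMeasurable_comp_fst hm).sub hm2))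
      fun y hy => (eLpNorm_second_difference_le hg hh hu y).trans ?_
    have hy' : ‖y‖ₑ ≤ ENNReal.ofReal t := by
      rw [← ofReal_norm]
      exact ENNReal.ofReal_le_ofReal hy
    gcongr
  refine le_trans ?_ h2
  rw [eLpNorm_const_smul]
  refine le_mul_of_one_le_left' ?_
  rw [← ofReal_norm]
  simp

/-! ### Integration by parts -/

theorem integrable_inner_of_memLp {a b : EuclideanSpace ℝ (Fin N) → 𝕜} (ha : MemLp a 2 volume)
    (hb : MemLp b 2 volume) : Integrable (fun x => inner ℝ (a x) (b x)) volume := by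
  refine (ha.norm.integrable_mul hb.norm).mono' (ha.1.inner hb.1) (.of_forall fun x => ?_)
  exact norm_inner_le_norm _ _

/-- Square integrability of both functions and of the two derivatives replaces compact support. The
real scalar product on `𝕜` serves real and complex values at once. -/
theorem integral_inner_fderiv {a b : EuclideanSpace ℝ (Fin N) → 𝕜} (ha : ContDiff ℝ 1 a)
    (hb : ContDiff ℝ 1 b) (haL : MemLp a 2 volume) (hbL : MemLp b 2 volume)
    {e : EuclideanSpace ℝ (Fin N)} (ha' : MemLp (fun x => fderiv ℝ a x e) 2 volume)
    (hb' : MemLp (fun x => fderiv ℝ b x e) 2 volume) :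
    ∫ x, inner ℝ (a x) (fderiv ℝ b x e) = - ∫ x, inner ℝ (fderiv ℝ a x e) (b x) :=
  integral_bilinear_fderiv_right_eq_neg_left_of_integrable (B := innerSL ℝ)
    (integrable_inner_of_memLp ha' hbL) (integrable_inner_of_memLp haL hb')
    (integrable_inner_of_memLp haL hbL) (fun x _ => ha.differentiable (by simp) x)
    (fun x _ => hb.differentiable (by simp) x)

theorem integral_inner_le {a b : EuclideanSpace ℝ (Fin N) → 𝕜} (ha : MemLp a 2 volume)
    (hb : MemLp b 2 volume) : ∫ x, inner ℝ (a x) (b x) ≤ normLp 2 a * normLp 2 b := by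
  have h1 := real_inner_le_norm (ha.toLp a) (hb.toLp b)
  rw [L2.inner_def, Lp.norm_toLp, Lp.norm_toLp, ← normLp_two, ← normLp_two] at h1
  refine (integral_congr_ae ?_).trans_le h1
  filter_upwards [ha.coeFn_toLp, hb.coeFn_toLp] with x h2 h3
  rw [h2, h3]

theorem normLp_two_sq_inner {a : EuclideanSpace ℝ (Fin N) → 𝕜} (ha : MemLp a 2 volume) :
    normLp 2 a ^ 2 = ∫ x, inner ℝ (a x) (a x) := by
  rw [normLp_two_sq ha]
  simp only [real_inner_self_eq_norm_sq]

theorem integral_inner_sum_sum {ι : Type*} [Fintype ι] {a : ι → EuclideanSpace ℝ (Fin N) → 𝕜}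
    (ha : ∀ i, MemLp (a i) 2 volume) :
    ∫ x, inner ℝ ((∑ i, a i) x) ((∑ i, a i) x) = ∑ i, ∑ j, ∫ x, inner ℝ (a i x) (a j x) := by
  have h1 : ∀ x, inner ℝ ((∑ i, a i) x) ((∑ i, a i) x) = ∑ i, ∑ j, inner ℝ (a i x) (a j x) := by
    intro x
    rw [Finset.sum_apply, sum_inner]
    exact Finset.sum_congr rfl fun i _ => inner_sum _ _ _
  simp only [h1]
  rw [integral_finsetSum _ fun i _ => integrable_finsetSum _ fun j _ =>
    integrable_inner_of_memLp (ha i) (ha j)]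
  exact Finset.sum_congr rfl fun i _ => integral_finsetSum _ fun j _ =>
    integrable_inner_of_memLp (ha i) (ha j)

theorem fderiv_fderiv_comm {f : EuclideanSpace ℝ (Fin N) → 𝕜} (hf : ContDiff ℝ ∞ f)
    (x e e' : EuclideanSpace ℝ (Fin N)) :
    fderiv ℝ (fun z => fderiv ℝ f z e) x e' = fderiv ℝ (fun z => fderiv ℝ f z e') x e := by
  have h1 : DifferentiableAt ℝ (fderiv ℝ f) x :=
    (hf.fderiv_right (m := ∞) (by simp)).differentiable (by simp) x
  have h2 : IsSymmSndFDerivAt ℝ f x :=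
    hf.contDiffAt.isSymmSndFDerivAt (by simpa using ENat.LEInfty.out)
  rw [fderiv_clm_apply h1 (differentiableAt_const e), fderiv_clm_apply h1 (differentiableAt_const e')]
  simpa using h2 e' e

section Mollified

variable {t : ℝ} (ht : 0 < t) {u : EuclideanSpace ℝ (Fin N) → 𝕜}
  {g : Fin N → EuclideanSpace ℝ (Fin N) → 𝕜}
  {h : Fin N → Fin N → EuclideanSpace ℝ (Fin N) → 𝕜}

theorem mollify_contDiff (hu : LocallyIntegrable u volume) : ContDiff ℝ ∞ (mollify ht u) :=
  conv_contDiff (mol_contDiff ht) (mol_hasCompactSupport ht) hu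

theorem HasWeakPartial.fderiv_mollify {i : Fin N} {v : EuclideanSpace ℝ (Fin N) → 𝕜}
    (hv : HasWeakPartial i u v) :
    (fun x => fderiv ℝ (mollify ht u) x (EuclideanSpace.single i 1)) = mollify ht v :=
  funext fun x => hv.fderiv_conv (mol_contDiff ht) (mol_hasCompactSupport ht) x

theorem memLp_fderiv_mollify (hu : MemLp u 2 volume) (e : EuclideanSpace ℝ (Fin N)) :
    MemLp (fun x => fderiv ℝ (mollify ht u) x e) 2 volume := by
  have h1 : (fun x => fderiv ℝ (mollify ht u) x e) = conv (fun y => fderiv ℝ (mol ht) y e) u :=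
    funext fun x => fderiv_conv_apply (mol_contDiff ht) (mol_hasCompactSupport ht)
      (hu.locallyIntegrable (by norm_num)) e x
  rw [h1]
  exact memLp_conv (by norm_num) (by simp)
    (((mol_contDiff ht).continuous_fderiv (by simp)).clm_apply continuous_const)
    ((mol_hasCompactSupport ht).fderiv_apply ℝ e) hu

theorem memLp_mollify_two (hu : MemLp u 2 volume) : MemLp (mollify ht u) 2 volume :=
  memLp_mollify ht (by norm_num) (by simp) hu

theorem H2Data.mollify (H : H2Data u g h) :
    H2Data (mollify ht u) (fun i => MixedGN.mollify ht (g i)) (fun i j => MixedGN.mollify ht (h i j)) := by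
  have h1 : ∀ {i} {v w : EuclideanSpace ℝ (Fin N) → 𝕜}, HasWeakPartial i v w →
      HasWeakPartial i (MixedGN.mollify ht v) (MixedGN.mollify ht w) := fun {i v w} hv => by
    rw [← hv.fderiv_mollify ht]
    exact hasWeakPartial_of_contDiff
      ((mollify_contDiff ht hv.locallyIntegrable_fun).of_le (by simp)) i
  exact ⟨memLp_mollify_two ht H.memLp, fun i => memLp_mollify_two ht (H.memLp₁ i),
    fun i j => memLp_mollify_two ht (H.memLp₂ i j), fun i => h1 (H.partial₁ i),
    fun i j => h1 (H.partial₂ i j)⟩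

/-- Formally `∫ ∂ᵢ∂ⱼu ∂ᵢ∂ⱼu = -∫ ∂ᵢ∂ᵢ∂ⱼu ∂ⱼu = ∫ ∂ᵢ∂ᵢu ∂ⱼ∂ⱼu`. Mollification supplies the third
derivatives in `L²` and the symmetry of mixed derivatives. -/
theorem H2Data.integral_inner_mollify (H : H2Data u g h) (i j : Fin N) :
    ∫ x, inner ℝ (MixedGN.mollify ht (h i j) x) (MixedGN.mollify ht (h i j) x)
      = ∫ x, inner ℝ (MixedGN.mollify ht (h i i) x) (MixedGN.mollify ht (h j j) x) := by
  have hloc : ∀ {v : EuclideanSpace ℝ (Fin N) → 𝕜}, MemLp v 2 volume →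
      ContDiff ℝ ∞ (MixedGN.mollify ht v) := fun {v} hv =>
    mollify_contDiff ht (hv.locallyIntegrable (by norm_num))
  have hsymm : MixedGN.mollify ht (h i j) = MixedGN.mollify ht (h j i) := by
    rw [← (H.partial₂ i j).fderiv_mollify ht, ← (H.partial₂ j i).fderiv_mollify ht,
      ← (H.partial₁ i).fderiv_mollify ht, ← (H.partial₁ j).fderiv_mollify ht]
    ext x
    exact fderiv_fderiv_comm (hloc H.memLp) x _ _
  have hsymm' : ∀ x, fderiv ℝ (MixedGN.mollify ht (h i j)) x (EuclideanSpace.single i 1)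
      = fderiv ℝ (MixedGN.mollify ht (h i i)) x (EuclideanSpace.single j 1) := fun x => by
    rw [← (H.partial₂ i j).fderiv_mollify ht, ← (H.partial₂ i i).fderiv_mollify ht]
    exact fderiv_fderiv_comm (hloc (H.memLp₁ i)) x _ _
  have hd1 : (fun x => fderiv ℝ (MixedGN.mollify ht (g j)) x (EuclideanSpace.single i 1))
      = MixedGN.mollify ht (h i j) := by rw [(H.partial₂ j i).fderiv_mollify ht, hsymm]
  have hd2 := (H.partial₂ j j).fderiv_mollify ht
  have e1 := integral_inner_fderiv (a := MixedGN.mollify ht (h i j))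
    (b := MixedGN.mollify ht (g j)) (e := EuclideanSpace.single i 1)
    ((hloc (H.memLp₂ i j)).of_le (by simp)) ((hloc (H.memLp₁ j)).of_le (by simp))
    (memLp_mollify_two ht (H.memLp₂ i j)) (memLp_mollify_two ht (H.memLp₁ j))
    (memLp_fderiv_mollify ht (H.memLp₂ i j) _) (memLp_fderiv_mollify ht (H.memLp₁ j) _)
  have e2 := integral_inner_fderiv (a := MixedGN.mollify ht (h i i))
    (b := MixedGN.mollify ht (g j)) (e := EuclideanSpace.single j 1)
    ((hloc (H.memLp₂ i i)).of_le (by simp)) ((hloc (H.memLp₁ j)).of_le (by simp))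
    (memLp_mollify_two ht (H.memLp₂ i i)) (memLp_mollify_two ht (H.memLp₁ j))
    (memLp_fderiv_mollify ht (H.memLp₂ i i) _) (memLp_fderiv_mollify ht (H.memLp₁ j) _)
  have hd1' := fun x => congrFun hd1 x
  have hd2' := fun x => congrFun hd2 x
  simp only [hd1', hd2', hsymm'] at e1 e2
  rw [e1, e2]

theorem H2Data.sum_normLp_sq_mollify (H : H2Data u g h) :
    ∑ i, ∑ j, normLp 2 (MixedGN.mollify ht (h i j)) ^ 2
      = normLp 2 (∑ i, MixedGN.mollify ht (h i i)) ^ 2 := by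
  have hm := fun i j => memLp_mollify_two ht (H.memLp₂ i j)
  have hsum : MemLp (∑ i, MixedGN.mollify ht (h i i)) 2 volume :=
    memLp_finsetSum' _ fun i _ => hm i i
  have h1 := normLp_two_sq_inner hsum
  have h2 := integral_inner_sum_sum (a := fun i => MixedGN.mollify ht (h i i)) fun i => hm i i
  refine Eq.trans ?_ (h1.trans h2).symm
  refine Finset.sum_congr rfl fun i _ => Finset.sum_congr rfl fun j _ => ?_
  exact (normLp_two_sq_inner (hm i j)).trans (H.integral_inner_mollify ht i j)

theorem H2Data.mollify_lap (H : H2Data u g h) :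
    MixedGN.mollify ht (∑ i, h i i) = ∑ i, MixedGN.mollify ht (h i i) :=
  conv_sum (mol_continuous ht) (mol_hasCompactSupport ht) _
    fun i _ => (H.memLp₂ i i).locallyIntegrable (by norm_num)

theorem normLp_mollify_le (hu : MemLp u 2 volume) :
    normLp 2 (MixedGN.mollify ht u) ≤ 2 ^ N * normLp 2 u := by
  have h1 := eLpNorm_mollify_le ht (q := 2) (by norm_num) (by simp) hu.1
  have h2 := ENNReal.toReal_mono (ENNReal.mul_ne_top (by simp) hu.2.ne) h1
  rw [ENNReal.toReal_mul, ← normLp_two, ← normLp_two] at h2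
  simpa using h2

theorem normLp_le_of_mollify (hu : MemLp u 2 volume) {K : ℝ} (hK0 : 0 ≤ K)
    (hK : ∀ {t : ℝ} (ht : 0 < t), normLp 2 (MixedGN.mollify ht u) ≤ K) : normLp 2 u ≤ K := by
  have h1 : eLpNorm u 2 volume ≤ ENNReal.ofReal K :=
    eLpNorm_le_of_ae_tendsto (fun n => (memLp_mollify_two _ hu).1)
      (tendsto_mollify_ae (hu.locallyIntegrable (by norm_num))) fun n => by
        rw [← ofReal_normLp_two (memLp_mollify_two _ hu)]
        exact ENNReal.ofReal_le_ofReal (hK _)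
  rw [normLp_two]
  exact ENNReal.toReal_le_of_le_ofReal hK0 h1

/-- The second derivatives are controlled by the Laplacian. -/
theorem H2Data.normLp_second_le (H : H2Data u g h) (i j : Fin N) :
    normLp 2 (h i j) ≤ 2 ^ N * normD2 u := by
  have h0 := normD2_nonneg u
  refine normLp_le_of_mollify (H.memLp₂ i j) (by positivity) fun {t} ht => ?_
  rw [H.normD2_eq]
  -- For the mollified function the identity between Hessian and Laplacian is exact. The factor `2 ^
  -- N` only pays for mollifying the Laplacian.
  refine le_trans ?_ (normLp_mollify_le ht H.memLp_lap)
  rw [H.mollify_lap]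
  refine abs_le_of_sq_le_sq' ?_ (normLp_nonneg _ _) |>.2
  rw [← H.sum_normLp_sq_mollify]
  calc normLp 2 (MixedGN.mollify ht (h i j)) ^ 2
      ≤ ∑ j, normLp 2 (MixedGN.mollify ht (h i j)) ^ 2 :=
        Finset.single_le_sum (f := fun j => normLp 2 (MixedGN.mollify ht (h i j)) ^ 2)
          (fun j _ => sq_nonneg _) (Finset.mem_univ j)
    _ ≤ _ := Finset.single_le_sum (f := fun i => ∑ j, normLp 2 (MixedGN.mollify ht (h i j)) ^ 2)
          (fun i _ => Finset.sum_nonneg fun j _ => sq_nonneg _) (Finset.mem_univ i)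

theorem H2Data.normLp_partial_le (H : H2Data u g h) (i : Fin N) : normLp 2 (g i) ≤ normD1 u := by
  refine abs_le_of_sq_le_sq' ?_ (normD1_nonneg _) |>.2
  rw [H.normD1_sq]
  exact Finset.single_le_sum (f := fun i => normLp 2 (g i) ^ 2) (fun i _ => sq_nonneg _)
    (Finset.mem_univ i)

/-- The interpolation inequality `‖∇u‖₂² ≲ ‖u‖₂ ‖Δu‖₂`. -/
theorem H2Data.normD1_sq_le (H : H2Data u g h) :
    normD1 u ^ 2 ≤ N * 4 ^ N * (normLp 2 u * normD2 u) := by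
  have h0 : 0 ≤ normLp 2 u * normD2 u := mul_nonneg (normLp_nonneg _ _) (normD2_nonneg u)
  have h1 : ∀ i, normLp 2 (g i) ^ 2 ≤ 4 ^ N * (normLp 2 u * normD2 u) := by
    intro i
    have h2 : normLp 2 (g i) ≤ √(4 ^ N * (normLp 2 u * normD2 u)) := by
      refine normLp_le_of_mollify (H.memLp₁ i) (by positivity) fun {t} ht => Real.le_sqrt_of_sq_le ?_
      have hm := (H.mollify ht)
      have hc := mollify_contDiff ht (H.memLp.locallyIntegrable (by norm_num))
      -- Green's identity for the mollified function. After Cauchy–Schwarz, the mollifications of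
      -- `u` and of its Laplacian cost `2 ^ N` each, whence `4 ^ N`.
      have h3 : ∑ i, normLp 2 (MixedGN.mollify ht (g i)) ^ 2
          = - ∫ x, inner ℝ (MixedGN.mollify ht u x) (MixedGN.mollify ht (∑ i, h i i) x) := by
        rw [H.mollify_lap]
        simp only [Finset.sum_apply, inner_sum]
        rw [integral_finsetSum _ fun i _ => integrable_inner_of_memLp hm.memLp (hm.memLp₂ i i),
          ← Finset.sum_neg_distrib]
        refine Finset.sum_congr rfl fun i _ => ?_
        rw [normLp_two_sq_inner (hm.memLp₁ i)]
        have e1 := integral_inner_fderiv (a := MixedGN.mollify ht u)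
          (b := MixedGN.mollify ht (g i)) (e := EuclideanSpace.single i 1)
          (hc.of_le (by simp)) ((mollify_contDiff ht
            ((H.memLp₁ i).locallyIntegrable (by norm_num))).of_le (by simp)) hm.memLp
          (hm.memLp₁ i) (memLp_fderiv_mollify ht H.memLp _)
          (memLp_fderiv_mollify ht (H.memLp₁ i) _)
        have d1 := fun x => congrFun ((H.partial₁ i).fderiv_mollify ht) x
        have d2 := fun x => congrFun ((H.partial₂ i i).fderiv_mollify ht) x
        simp only [d1, d2] at e1
        rw [e1, neg_neg]
      have h4 : normLp 2 (MixedGN.mollify ht (g i)) ^ 2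
          ≤ ∑ i, normLp 2 (MixedGN.mollify ht (g i)) ^ 2 :=
        Finset.single_le_sum (f := fun i => normLp 2 (MixedGN.mollify ht (g i)) ^ 2)
          (fun i _ => sq_nonneg _) (Finset.mem_univ i)
      refine h4.trans ?_
      rw [h3, ← integral_neg]
      simp only [← inner_neg_left]
      have h5 := integral_inner_le hm.memLp.neg (memLp_mollify_two ht H.memLp_lap)
      refine h5.trans ?_
      have h6 : normLp 2 (-MixedGN.mollify ht u) = normLp 2 (MixedGN.mollify ht u) := by
        rw [normLp, normLp, eLpNorm_neg]
      rw [h6, H.normD2_eq]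
      calc _ ≤ (2 ^ N * normLp 2 u) * (2 ^ N * normLp 2 (∑ i, h i i)) :=
            mul_le_mul (normLp_mollify_le ht H.memLp) (normLp_mollify_le ht H.memLp_lap)
              (normLp_nonneg _ _) (mul_nonneg (by positivity) (normLp_nonneg _ _))
        _ = _ := by
            rw [show (4 : ℝ) = 2 * 2 by norm_num, mul_pow]; ring
    calc normLp 2 (g i) ^ 2 ≤ √(4 ^ N * (normLp 2 u * normD2 u)) ^ 2 :=
          pow_le_pow_left₀ (normLp_nonneg _ _) h2 2
      _ = _ := Real.sq_sqrt (by positivity)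
  rw [H.normD1_sq]
  refine (Finset.sum_le_sum fun i _ => h1 i).trans_eq ?_
  simp [mul_assoc]

variable (N) in
/-- The constant in the estimates of the mollification error. -/
def errConst : ℝ := 16 ^ N * (N + 1) ^ 2

theorem errConst_pos : 0 < errConst N := by unfold errConst; positivity

/-- The mollification error is of first order in `∇u`. -/
theorem H2Data.normLp_sub_mollify_le (H : H2Data u g h) :
    normLp 2 (u - MixedGN.mollify ht u) ≤ errConst N * (t * normD1 u) := by
  have h1 := eLpNorm_sub_mollify_le ht H.partial₁ (H.memLp.locallyIntegrable (by norm_num))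
  have h3 : ∑ i, eLpNorm (g i) 2 volume ≤ ENNReal.ofReal (N * normD1 u) := by
    simp only [← ofReal_normLp_two (H.memLp₁ _)]
    rw [← ENNReal.ofReal_sum_of_nonneg fun i _ => normLp_nonneg _ _]
    refine ENNReal.ofReal_le_ofReal ((Finset.sum_le_sum fun i _ => H.normLp_partial_le i).trans_eq ?_)
    simp
  have h0 := normD1_nonneg u
  have h2 : eLpNorm (u - MixedGN.mollify ht u) 2 volume
      ≤ ENNReal.ofReal (2 ^ N * (t * (2 ^ N * (N * normD1 u)))) := by
    refine h1.trans ?_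
    rw [ENNReal.ofReal_mul (by positivity), ENNReal.ofReal_mul ht.le,
      ENNReal.ofReal_mul (by positivity), ENNReal.ofReal_pow zero_le_two, ENNReal.ofReal_ofNat]
    gcongr
  rw [normLp_two]
  refine (ENNReal.toReal_le_of_le_ofReal (by positivity) h2).trans ?_
  have h4 : (2 : ℝ) ^ N * 2 ^ N ≤ 16 ^ N := by
    rw [← mul_pow]; gcongr; norm_num
  have h5 : (N : ℝ) ≤ (N + 1) ^ 2 := by nlinarith [(Nat.cast_nonneg N : (0 : ℝ) ≤ N)]
  calc (2 : ℝ) ^ N * (t * (2 ^ N * (N * normD1 u)))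
      = (2 ^ N * 2 ^ N) * N * (t * normD1 u) := by ring
    _ ≤ _ := by unfold errConst; gcongr

/-- The mollification error is of second order in `Δu`. -/
theorem H2Data.normLp_sub_mollify_le₂ (H : H2Data u g h) :
    normLp 2 (u - MixedGN.mollify ht u) ≤ errConst N * (t ^ 2 * normD2 u) := by
  have h1 := eLpNorm_sub_mollify_le₂ ht H.partial₁ H.partial₂
    (H.memLp.locallyIntegrable (by norm_num))
  have h0 := normD2_nonneg u
  have h3 : ∀ i, ∑ j, eLpNorm (h i j) 2 volume ≤ ENNReal.ofReal (N * (2 ^ N * normD2 u)) := by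
    intro i
    simp only [← ofReal_normLp_two (H.memLp₂ _ _)]
    rw [← ENNReal.ofReal_sum_of_nonneg fun i _ => normLp_nonneg _ _]
    refine ENNReal.ofReal_le_ofReal ((Finset.sum_le_sum fun j _ => H.normLp_second_le i j).trans_eq ?_)
    simp
  have h2 : eLpNorm (u - MixedGN.mollify ht u) 2 volume
      ≤ ENNReal.ofReal (2 ^ N * (t * (2 ^ N * (N * (t * (2 ^ N * (N * (2 ^ N * normD2 u)))))))) := by
    refine h1.trans ?_
    have h5 : ∑ i : Fin N, ENNReal.ofReal t * (2 ^ N * ∑ j, eLpNorm (h i j) 2 volume)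
        ≤ ENNReal.ofReal (N * (t * (2 ^ N * (N * (2 ^ N * normD2 u))))) := by
      refine (Finset.sum_le_sum fun i _ => mul_le_mul' le_rfl (mul_le_mul' le_rfl (h3 i))).trans_eq ?_
      simp only [Finset.sum_const, Finset.card_univ, Fintype.card_fin, nsmul_eq_mul,
        ENNReal.ofReal_mul (Nat.cast_nonneg N), ENNReal.ofReal_natCast, ENNReal.ofReal_mul ht.le,
        ENNReal.ofReal_mul (p := 2 ^ N) (by positivity), ENNReal.ofReal_pow zero_le_two,
        ENNReal.ofReal_ofNat]
    rw [ENNReal.ofReal_mul (by positivity), ENNReal.ofReal_mul ht.le,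
      ENNReal.ofReal_mul (by positivity), ENNReal.ofReal_pow zero_le_two, ENNReal.ofReal_ofNat]
    gcongr
  rw [normLp_two]
  refine (ENNReal.toReal_le_of_le_ofReal (by positivity) h2).trans ?_
  -- One factor comes from averaging over the kernel, two from the two increment estimates, and one
  -- from bounding second derivatives by the Laplacian.
  have h4 : (2 : ℝ) ^ N * 2 ^ N * 2 ^ N * 2 ^ N = 16 ^ N := by
    rw [← mul_pow, ← mul_pow, ← mul_pow]; norm_num
  have h5 : (N : ℝ) * N ≤ (N + 1) ^ 2 := by nlinarith [(Nat.cast_nonneg N : (0 : ℝ) ≤ N)]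
  calc _ = (2 ^ N * 2 ^ N * 2 ^ N * 2 ^ N) * (N * N) * (t ^ 2 * normD2 u) := by ring
    _ ≤ _ := by rw [h4]; unfold errConst; gcongr

end Mollified

/-! ### The mixed Gagliardo-Nirenberg inequality -/

/-- Real interpolation between two weak-type bounds. -/
theorem lintegral_rpow_le_of_weak {α : Type*} [MeasurableSpace α] {μ : Measure α} {f : α → ℝ}
    (hf0 : 0 ≤ f) (hf : AEMeasurable f μ) {a b p A B : ℝ} (ha : 0 < a) (hap : a < p) (hpb : p < b)
    (hA : 0 ≤ A) (hB : 0 ≤ B)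
    (h1 : ∀ s, 0 < s → μ {x | s < f x} ≤ ENNReal.ofReal (A * s ^ (-a)))
    (h2 : ∀ s, 0 < s → μ {x | s < f x} ≤ ENNReal.ofReal (B * s ^ (-b))) :
    ∫⁻ x, ENNReal.ofReal (f x ^ p) ∂μ ≤ ENNReal.ofReal (p * (1 / (p - a) + 1 / (b - p)) *
      (A ^ ((b - p) / (b - a)) * B ^ ((p - a) / (b - a)))) := by
  have hp : 0 < p := ha.trans hap
  have hpa : 0 < p - a := by linarith
  have hbp : 0 < b - p := by linarith
  have hba : 0 < b - a := by linarith
  rw [lintegral_rpow_eq_lintegral_meas_lt_mul μ (.of_forall hf0) hf hp]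
  -- If a constant vanishes, then so do all level sets above zero. This case is separated because
  -- the splitting height below is a power of `B / A`.
  have hzero : A = 0 ∨ B = 0 →
      ∫⁻ t in Set.Ioi (0 : ℝ), μ {x | t < f x} * ENNReal.ofReal (t ^ (p - 1)) = 0 := by
    intro h0
    refine (setLIntegral_congr_fun measurableSet_Ioi (g := fun _ => 0) fun t ht => ?_).trans (by simp)
    have : μ {x | t < f x} = 0 := by
      rcases h0 with h0 | h0
      · simpa [h0] using h1 t ht
      · simpa [h0] using h2 t ht
    simp [this]
  rcases hA.eq_or_lt with hA0 | hA
  · rw [hzero (.inl hA0.symm)]; simp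
  rcases hB.eq_or_lt with hB0 | hB
  · rw [hzero (.inr hB0.symm)]; simp
  -- At this height the two bounds `A s^(-a)` and `B s^(-b)` coincide. In the layer-cake integral
  -- the first is integrable below it, as `a < p`, and the second above it, as `p < b`.
  set s := (B / A) ^ (1 / (b - a)) with hs
  have hs0 : 0 < s := by positivity
  have hspow : ∀ r : ℝ, s ^ r = (B / A) ^ (r / (b - a)) := fun r => by
    rw [hs, ← Real.rpow_mul (by positivity)]; congr 1; ring
  have e1 : ∫⁻ t in Set.Ioc 0 s, μ {x | t < f x} * ENNReal.ofReal (t ^ (p - 1))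
      ≤ ENNReal.ofReal (A * (s ^ (p - a) / (p - a))) := by
    have hi : IntegrableOn (fun t : ℝ => A * t ^ (p - 1 - a)) (Set.Ioc 0 s) volume :=
      ((intervalIntegrable_iff_integrableOn_Ioc_of_le hs0.le).1
        (intervalIntegral.intervalIntegrable_rpow' (by linarith))).const_mul A
    have hint : ∫ t in Set.Ioc 0 s, A * t ^ (p - 1 - a) = A * (s ^ (p - a) / (p - a)) := by
      rw [integral_const_mul, ← intervalIntegral.integral_of_le hs0.le,
        integral_rpow (.inl (by linarith)), show p - 1 - a + 1 = p - a by ring,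
        Real.zero_rpow hpa.ne', sub_zero]
    rw [← hint, ofReal_integral_eq_lintegral_ofReal hi
      ((ae_restrict_iff' measurableSet_Ioc).2 (.of_forall fun t ht => by
        have := ht.1; simp only [Pi.zero_apply]; positivity))]
    refine setLIntegral_mono' measurableSet_Ioc fun t ht => ?_
    refine (mul_le_mul' (h1 t ht.1) le_rfl).trans_eq ?_
    have := ht.1
    rw [← ENNReal.ofReal_mul (by positivity), mul_assoc, ← Real.rpow_add ht.1]
    congr 3; ring
  have e2 : ∫⁻ t in Set.Ioi s, μ {x | t < f x} * ENNReal.ofReal (t ^ (p - 1))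
      ≤ ENNReal.ofReal (B * (s ^ (p - b) / (b - p))) := by
    have hi : IntegrableOn (fun t : ℝ => B * t ^ (p - 1 - b)) (Set.Ioi s) volume :=
      (integrableOn_Ioi_rpow_of_lt (by linarith) hs0).const_mul B
    have hint : ∫ t in Set.Ioi s, B * t ^ (p - 1 - b) = B * (s ^ (p - b) / (b - p)) := by
      rw [integral_const_mul, integral_Ioi_rpow_of_lt (by linarith) hs0,
        show p - 1 - b + 1 = -(b - p) by ring, neg_div_neg_eq, neg_sub]
    rw [← hint, ofReal_integral_eq_lintegral_ofReal hi
      ((ae_restrict_iff' measurableSet_Ioi).2 (.of_forall fun t ht => by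
        have : 0 < t := hs0.trans ht; simp only [Pi.zero_apply]; positivity))]
    refine setLIntegral_mono' measurableSet_Ioi fun t ht => ?_
    have ht0 : 0 < t := hs0.trans ht
    refine (mul_le_mul' (h2 t ht0) le_rfl).trans_eq ?_
    rw [← ENNReal.ofReal_mul (by positivity), mul_assoc, ← Real.rpow_add ht0]
    congr 3; ring
  rw [← Set.Ioc_union_Ioi_eq_Ioi hs0.le,
    lintegral_union measurableSet_Ioi (Set.Ioc_disjoint_Ioi le_rfl)]
  refine (mul_le_mul' le_rfl (add_le_add e1 e2)).trans_eq ?_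
  rw [← ENNReal.ofReal_add (by positivity) (by positivity), ← ENNReal.ofReal_mul hp.le, hspow, hspow]
  congr 1
  have f1 : A * (B / A) ^ ((p - a) / (b - a))
      = A ^ ((b - p) / (b - a)) * B ^ ((p - a) / (b - a)) := by
    rw [Real.div_rpow hB.le hA.le, show (b - p) / (b - a) = 1 - (p - a) / (b - a) by
      field_simp; ring, Real.rpow_sub hA, Real.rpow_one]
    field_simp
  have f2 : B * (B / A) ^ ((p - b) / (b - a))
      = A ^ ((b - p) / (b - a)) * B ^ ((p - a) / (b - a)) := by
    rw [Real.div_rpow hB.le hA.le, show (p - a) / (b - a) = 1 + (p - b) / (b - a) by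
      field_simp; ring, Real.rpow_add hB, Real.rpow_one,
      show (b - p) / (b - a) = -((p - b) / (b - a)) by ring, Real.rpow_neg hA.le]
    field_simp
  rw [← mul_div_assoc, f1, ← mul_div_assoc, f2]
  ring

section GN

variable {u : EuclideanSpace ℝ (Fin N) → 𝕜}

/-- The scale `t` is the one at which the sup bound for the mollification equals `s / 2`. Where `|u|
> s` the mollification error therefore exceeds `s / 2`, and Chebyshev's inequality applies. -/
theorem measure_norm_gt_le (hN : 1 ≤ N) (hu : MemH2 u) (hM : 0 < normLp 2 u) {s : ℝ} (hs : 0 < s)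
    {t : ℝ} (ht : t = (2 * molConst N * normLp 2 u / s) ^ (2 / (N : ℝ))) (ht0 : 0 < t) {e : ℝ}
    (he : normLp 2 (u - mollify ht0 u) ≤ e) :
    volume {x | s < ‖u x‖} ≤ ENNReal.ofReal (4 * e ^ 2 * s ^ (-2 : ℝ)) := by
  have hN0 : (0 : ℝ) < N := by exact_mod_cast hN
  have hc := molConst_pos (N := N)
  have h0 : 0 < 2 * molConst N * normLp 2 u / s := by positivity
  have hsup : ∀ x, ‖mollify ht0 u x‖ ≤ s / 2 := fun x => by
    refine (norm_mollify_le ht0 hu.memLp x).trans_eq ?_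
    rw [ht, ← Real.rpow_mul h0.le, show 2 / (N : ℝ) * (-N / 2) = -1 by field_simp,
      Real.rpow_neg_one]
    field_simp
  have hmem : MemLp (u - mollify ht0 u) 2 volume :=
    hu.memLp.sub (memLp_mollify_two ht0 hu.memLp)
  have h1 : {x | s < ‖u x‖} ⊆ {x | ENNReal.ofReal (s / 2) ≤ ‖(u - mollify ht0 u) x‖ₑ} := by
    intro x hx
    have hx' : s < ‖u x‖ := hx
    rw [Set.mem_ofPred_eq, ← ofReal_norm]
    refine ENNReal.ofReal_le_ofReal ?_
    have := norm_sub_norm_le (u x) (mollify ht0 u x)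
    have := hsup x
    simp only [Pi.sub_apply]
    linarith
  have h2 := meas_ge_le_mul_pow_eLpNorm_enorm (p := 2) volume (by simp) (by simp) hmem.1
    (ε := ENNReal.ofReal (s / 2)) (by simpa using hs) (by simp)
  refine (measure_mono h1).trans (h2.trans ?_)
  have he0 : 0 ≤ e := (normLp_nonneg _ _).trans he
  rw [← ofReal_normLp_two hmem, ← ENNReal.ofReal_inv_of_pos (by positivity),
    ENNReal.ofReal_rpow_of_nonneg (by positivity) (by simp),
    ENNReal.ofReal_rpow_of_nonneg (normLp_nonneg _ _) (by simp),
    ← ENNReal.ofReal_mul (by positivity)]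
  refine ENNReal.ofReal_le_ofReal ?_
  rw [Real.rpow_neg hs.le]
  simp only [ENNReal.toReal_ofNat, Real.rpow_ofNat]
  have : normLp 2 (u - mollify ht0 u) ^ 2 ≤ e ^ 2 := pow_le_pow_left₀ (normLp_nonneg _ _) he 2
  calc (s / 2)⁻¹ ^ 2 * normLp 2 (u - mollify ht0 u) ^ 2 ≤ (s / 2)⁻¹ ^ 2 * e ^ 2 := by gcongr
    _ = _ := by field_simp; ring

/-- With `t` proportional to `(‖u‖₂ / s)^(2/N)`, an error of order `t ^ k` becomes weak type `2 +
4k/N`. The cases `k = 1` (gradient) and `k = 2` (Laplacian) give the two ends of the range of `p`.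
-/
theorem weak_type_bound (hN : 1 ≤ N) (hu : MemH2 u) (hM : 0 < normLp 2 u) {k d : ℝ}
    (he : ∀ {t : ℝ} (ht : 0 < t), normLp 2 (u - mollify ht u) ≤ errConst N * (t ^ k * d))
    {s : ℝ} (hs : 0 < s) :
    volume {x | s < ‖u x‖} ≤ ENNReal.ofReal (4 * errConst N ^ 2 *
      (2 * molConst N) ^ (4 * k / N) * (normLp 2 u ^ (4 * k / N) * d ^ 2) * s ^ (-(2 + 4 * k / N))) := by
  have hc := molConst_pos (N := N)
  have h0 : 0 < 2 * molConst N * normLp 2 u / s := by positivity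
  have ht0 : 0 < (2 * molConst N * normLp 2 u / s) ^ (2 / (N : ℝ)) := by positivity
  refine (measure_norm_gt_le hN hu hM hs rfl ht0 (he ht0)).trans_eq ?_
  congr 1
  rw [mul_pow, mul_pow, ← Real.rpow_mul h0.le, ← Real.rpow_natCast _ 2, ← Real.rpow_natCast _ 2,
    ← Real.rpow_mul h0.le, Real.div_rpow (by positivity) hs.le,
    Real.mul_rpow (by positivity) hM.le, neg_add, Real.rpow_add hs]
  rw [show 2 / (N : ℝ) * k * (2 : ℕ) = 4 * k / N by push_cast; ring, Real.rpow_neg hs.le (4 * k / N)]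
  simp only [Nat.cast_ofNat, Real.rpow_ofNat]
  ring

theorem eLpNorm_rpow_eq {p : ℝ} (hp : 0 < p) (u : EuclideanSpace ℝ (Fin N) → 𝕜) :
    eLpNorm u (ENNReal.ofReal p) volume ^ p = ∫⁻ x, ENNReal.ofReal (‖u x‖ ^ p) := by
  rw [eLpNorm_eq_lintegral_rpow_enorm_toReal (by simpa using hp) (by simp),
    ENNReal.toReal_ofReal hp.le, ← ENNReal.rpow_mul, one_div, inv_mul_cancel₀ hp.ne',
    ENNReal.rpow_one]
  congr 1
  ext x
  rw [← ENNReal.ofReal_rpow_of_nonneg (norm_nonneg _) hp.le, ofReal_norm]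

theorem memLp_of_lintegral_le {p : ℝ} (hp : 0 < p) (hu : AEStronglyMeasurable u volume) {K : ℝ}
    (hK0 : 0 ≤ K) (hK : ∫⁻ x, ENNReal.ofReal (‖u x‖ ^ p) ≤ ENNReal.ofReal K) :
    MemLp u (ENNReal.ofReal p) volume ∧ normLp p u ^ p ≤ K := by
  rw [← eLpNorm_rpow_eq hp u] at hK
  refine ⟨⟨hu, ?_⟩, ?_⟩
  · have := hK.trans_lt ENNReal.ofReal_lt_top
    exact (ENNReal.rpow_lt_top_iff_of_pos hp).1 this
  · rw [normLp, ENNReal.toReal_rpow]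
    exact ENNReal.toReal_le_of_le_ofReal hK0 hK

theorem ae_eq_zero_of_normLp_two (hu : MemLp u 2 volume) (h : normLp 2 u = 0) : u =ᵐ[volume] 0 := by
  rw [normLp_two, ENNReal.toReal_eq_zero_iff] at h
  rcases h with h | h
  · exact (eLpNorm_eq_zero_iff hu.1 (by simp)).1 h
  · exact absurd h hu.2.ne

theorem mixedProduct_nonneg (p : ℝ) (u : EuclideanSpace ℝ (Fin N) → 𝕜) : 0 ≤ mixedProduct p u :=
  mul_nonneg (mul_nonneg (Real.rpow_nonneg (normD2_nonneg u) _) (Real.rpow_nonneg (normD1_nonneg u) _))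
    (Real.rpow_nonneg (normLp_nonneg _ u) _)

theorem normLp_eq_zero_of_ae {q : ℝ} (h : u =ᵐ[volume] 0) : normLp q u = 0 := by
  rw [normLp_congr h, normLp]; simp

variable (𝕜) in
-- Interpolation between weak types `2 + 4/N` and `2 + 8/N`. The interpolation weights reproduce
-- exactly the exponents of `mixedProduct`.
theorem exists_mixedGNInequality (hN : 1 ≤ N) {p : ℝ} (hp₁ : 2 + 4 / (N : ℝ) < p)
    (hp₂ : p < 2 + 8 / (N : ℝ)) : ∃ K : ℝ, 0 < K ∧ MixedGNInequality 𝕜 N p K := by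
  have hN0 : (0 : ℝ) < N := by exact_mod_cast hN
  have h4N : 0 < 4 / (N : ℝ) := by positivity
  have hp : 0 < p := by linarith
  have hc := molConst_pos (N := N)
  have hE := errConst_pos (N := N)
  set a := 2 + 4 / (N : ℝ) with ha
  set b := 2 + 8 / (N : ℝ) with hb
  have ha0 : 0 < a := by positivity
  have hpa : 0 < p - a := by linarith
  have hbp : 0 < b - p := by linarith
  set K₁ := 4 * errConst N ^ 2 * (2 * molConst N) ^ (4 * 1 / (N : ℝ)) with hK₁
  set K₂ := 4 * errConst N ^ 2 * (2 * molConst N) ^ (4 * 2 / (N : ℝ)) with hK₂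
  have hK₁0 : 0 < K₁ := by positivity
  have hK₂0 : 0 < K₂ := by positivity
  refine ⟨p * (1 / (p - a) + 1 / (b - p)) *
    (K₁ ^ ((b - p) / (b - a)) * K₂ ^ ((p - a) / (b - a))), by positivity, fun u hu => ?_⟩
  have hP := mixedProduct_nonneg p u
  refine memLp_of_lintegral_le hp hu.memLp.1 (by positivity) ?_
  rcases (normLp_nonneg 2 u).eq_or_lt with hM | hM
  · have hu0 := ae_eq_zero_of_normLp_two hu.memLp hM.symm
    have : ∫⁻ x, ENNReal.ofReal (‖u x‖ ^ p) = 0 := by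
      rw [← eLpNorm_rpow_eq hp, eLpNorm_congr_ae hu0]; simp [hp]
    rw [this]; exact zero_le
  have hG := normD1_nonneg u
  have hD := normD2_nonneg u
  have w1 := fun s hs => weak_type_bound hN hu hM (k := 1) (d := normD1 u)
    (fun ht => by simpa using hu.h2Data.normLp_sub_mollify_le ht) (s := s) hs
  have w2 := fun s hs => weak_type_bound hN hu hM (k := 2) (d := normD2 u)
    (fun ht => by simpa using hu.h2Data.normLp_sub_mollify_le₂ ht) (s := s) hs
  simp only [← hK₁, ← hK₂] at w1 w2
  clear_value K₁ K₂
  have hw := lintegral_rpow_le_of_weak (μ := volume) (f := fun x => ‖u x‖) (fun x => norm_nonneg _)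
    hu.memLp.1.norm.aemeasurable (a := a) (b := b) (p := p) ha0 hp₁ hp₂
    (A := K₁ * (normLp 2 u ^ (4 * 1 / (N : ℝ)) * normD1 u ^ 2))
    (B := K₂ * (normLp 2 u ^ (4 * 2 / (N : ℝ)) * normD2 u ^ 2)) (by positivity) (by positivity)
    (fun s hs => by simpa [ha] using w1 s hs)
    (fun s hs => by
      have := w2 s hs
      rwa [show 2 + 4 * 2 / (N : ℝ) = b by rw [hb]; ring] at this)
  refine hw.trans_eq ?_
  congr 1
  rw [mul_assoc (p * _)]
  congr 1
  have hba : b - a = 4 / N := by rw [ha, hb]; ring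
  have e1 : (b - p) / (b - a) = (8 - N * (p - 2)) / 4 := by
    rw [hba, hb]; field_simp; ring
  have e2 : (p - a) / (b - a) = (N * (p - 2) - 4) / 4 := by
    rw [hba, ha]; field_simp; ring
  rw [Real.mul_rpow hK₁0.le (by positivity), Real.mul_rpow hK₂0.le (by positivity),
    Real.mul_rpow (by positivity) (by positivity), Real.mul_rpow (by positivity) (by positivity),
    ← Real.rpow_mul hM.le, ← Real.rpow_mul hM.le, ← Real.rpow_natCast _ 2, ← Real.rpow_natCast _ 2,
    ← Real.rpow_mul hG, ← Real.rpow_mul hD, mixedProduct, e1, e2]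
  -- The two endpoint powers of the `L²` norm, weighted by the interpolation parameters, add up to
  -- `p - 2`.
  have e3 : normLp 2 u ^ (p - 2) = normLp 2 u ^ (4 * 1 / (N : ℝ) * ((8 - N * (p - 2)) / 4)) *
      normLp 2 u ^ (4 * 2 / (N : ℝ) * ((N * (p - 2) - 4) / 4)) := by
    rw [← Real.rpow_add hM]
    congr 1
    field_simp
    ring
  rw [e3, show ((2 : ℕ) : ℝ) * ((8 - N * (p - 2)) / 4) = (8 - N * (p - 2)) / 2 by push_cast; ring,
    show ((2 : ℕ) : ℝ) * ((N * (p - 2) - 4) / 4) = (N * (p - 2) - 4) / 2 by push_cast; ring]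
  ring

end GN

/-! ### The best constant and minimizing sequences -/

section Best

variable {u : EuclideanSpace ℝ (Fin N) → 𝕜} {p C : ℝ}

theorem exponent_pos (hN : 1 ≤ N) (hp₁ : 2 + 4 / (N : ℝ) < p) (hp₂ : p < 2 + 8 / (N : ℝ)) :
    0 < (N * (p - 2) - 4) / 2 ∧ 0 < (8 - N * (p - 2)) / 2 ∧ 0 < p - 2 := by
  have hN0 : (0 : ℝ) < N := by exact_mod_cast hN
  have h1 : 4 / (N : ℝ) < p - 2 := by linarith
  have h2 : p - 2 < 8 / (N : ℝ) := by linarith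
  rw [div_lt_iff₀ hN0] at h1
  rw [lt_div_iff₀ hN0] at h2
  have h3 : 0 < 4 / (N : ℝ) := by positivity
  exact ⟨by linarith, by linarith, by linarith⟩

theorem MemH2NeZero.normLp_two_pos (hu : MemH2NeZero u) : 0 < normLp 2 u :=
  (normLp_nonneg 2 u).lt_of_ne fun h => hu.2 (ae_eq_zero_of_normLp_two hu.1.memLp h.symm)

theorem normLp_pos (hp : 0 < p) (hu : MemLp u (ENNReal.ofReal p) volume) (h0 : ¬ u =ᵐ[volume] 0) :
    0 < normLp p u := by
  refine (normLp_nonneg p u).lt_of_ne fun h => h0 ?_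
  rw [normLp, eq_comm, ENNReal.toReal_eq_zero_iff] at h
  rcases h with h | h
  · exact (eLpNorm_eq_zero_iff hu.1 (by simpa using hp)).1 h
  · exact absurd h hu.2.ne

/-- The inequality itself gives this: a vanishing product would force the `L^p` norm to vanish. -/
theorem MixedGNInequality.mixedProduct_pos (hC : MixedGNInequality 𝕜 N p C) (hp : 0 < p)
    (hu : MemH2NeZero u) : 0 < mixedProduct p u := by
  have h1 := hC u hu.1
  refine (mixedProduct_nonneg p u).lt_of_ne fun h => ?_
  rw [← h, mul_zero] at h1
  exact absurd h1.2 (not_le.2 (Real.rpow_pos_of_pos (normLp_pos hp h1.1 hu.2) p))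

theorem MixedGNInequality.norms_pos (hC : MixedGNInequality 𝕜 N p C) (hN : 1 ≤ N)
    (hp₁ : 2 + 4 / (N : ℝ) < p) (hp₂ : p < 2 + 8 / (N : ℝ)) (hu : MemH2NeZero u) :
    0 < normD1 u ∧ 0 < normD2 u := by
  obtain ⟨hα, hβ, hγ⟩ := exponent_pos hN hp₁ hp₂
  have h1 := (hC.mixedProduct_pos (by linarith) hu).ne'
  constructor
  · refine (normD1_nonneg u).lt_of_ne fun h => h1 ?_
    rw [mixedProduct, ← h, Real.zero_rpow hβ.ne']; ring
  · refine (normD2_nonneg u).lt_of_ne fun h => h1 ?_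
    rw [mixedProduct, ← h, Real.zero_rpow hα.ne']; ring

theorem MixedGNInequality.inv_le_weinstein (hC : MixedGNInequality 𝕜 N p C) (hC0 : 0 < C) (hp : 0 < p)
    (hu : MemH2NeZero u) : C⁻¹ ≤ weinstein p u := by
  have h1 := hC u hu.1
  rw [weinstein, le_div_iff₀ (Real.rpow_pos_of_pos (normLp_pos hp h1.1 hu.2) p),
    inv_mul_le_iff₀ hC0]
  exact h1.2

variable (𝕜 N) in
theorem exists_memH2NeZero : ∃ u : EuclideanSpace ℝ (Fin N) → 𝕜, MemH2NeZero u := by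
  have hc : ContDiff ℝ ∞ fun x => ((mol (N := N) one_pos x : ℝ) : 𝕜) :=
    (RCLike.ofRealCLM (K := 𝕜)).contDiff.comp (mol_contDiff one_pos)
  have hs : HasCompactSupport fun x => ((mol (N := N) one_pos x : ℝ) : 𝕜) :=
    (mol_hasCompactSupport one_pos).comp_left (g := fun r : ℝ => (r : 𝕜)) (by simp)
  refine ⟨_, (h2Data_of_contDiff hc hs).memH2, fun h => ?_⟩
  have h1 : mol (N := N) one_pos =ᵐ[volume] 0 := by
    filter_upwards [h] with x hx
    simpa using hx
  have h2 := integral_mol (N := N) one_pos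
  rw [integral_congr_ae h1] at h2
  simp at h2

variable (𝕜) in
-- For each fixed `u` the condition on the constant is a closed half-line, so the infimum of the
-- admissible constants is admissible. A single nonzero `u₀` bounds it away from zero.
theorem exists_isBestConstant (hN : 1 ≤ N) (hp₁ : 2 + 4 / (N : ℝ) < p)
    (hp₂ : p < 2 + 8 / (N : ℝ)) : ∃ C : ℝ, 0 < C ∧ IsBestConstant 𝕜 N p C := by
  have hp : 0 < p := by linarith [(exponent_pos hN hp₁ hp₂).2.2]
  obtain ⟨K, -, hK⟩ := exists_mixedGNInequality 𝕜 hN hp₁ hp₂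
  obtain ⟨u₀, hu₀⟩ := exists_memH2NeZero 𝕜 N
  have hP := hK.mixedProduct_pos hp hu₀
  have hq := Real.rpow_pos_of_pos (normLp_pos hp (hK u₀ hu₀.1).1 hu₀.2) p
  have hlow : ∀ C ∈ {C : ℝ | MixedGNInequality 𝕜 N p C},
      normLp p u₀ ^ p / mixedProduct p u₀ ≤ C := fun C hC => by
    rw [div_le_iff₀ hP]; exact (hC u₀ hu₀.1).2
  have hbdd : BddBelow {C : ℝ | MixedGNInequality 𝕜 N p C} := ⟨_, hlow⟩
  refine ⟨sInf {C : ℝ | MixedGNInequality 𝕜 N p C}, ?_, ?_, fun C hC => csInf_le hbdd hC⟩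
  · exact (div_pos hq hP).trans_le (le_csInf ⟨K, hK⟩ hlow)
  · intro u hu
    refine ⟨(hK u hu).1, ?_⟩
    rcases (mixedProduct_nonneg p u).eq_or_lt with h | h
    · have := (hK u hu).2
      rwa [← h, mul_zero] at this ⊢
    · rw [← div_le_iff₀ h]
      refine le_csInf ⟨K, hK⟩ fun C hC => ?_
      rw [div_le_iff₀ h]; exact (hC u hu).2

theorem MemH2NeZero.rescale (hu : MemH2NeZero u) {a b : ℝ} (ha : 0 < a) (hb : 0 < b) :
    MemH2NeZero (rescale a b u) := by
  refine ⟨(hu.1.h2Data.rescale a hb).memH2, fun h => ?_⟩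
  have h1 := normLp_dilate two_pos hu.1.memLp.1 ha.le hb
  rw [normLp_eq_zero_of_ae h] at h1
  have := hu.normLp_two_pos
  have : 0 < a * b ^ (-(N : ℝ) / 2) * normLp 2 u := by positivity
  linarith

/-- The exponents are those for which the product scales like `‖·‖_p^p`: they sum to `p`, and twice
the exponent of `normD2` plus that of `normD1` is `N p / 2 - N`. -/
theorem mixedProduct_rescale (hu : MemH2 u) {a b : ℝ} (ha : 0 < a) (hb : 0 < b) :
    mixedProduct p (rescale a b u) = a ^ p * b ^ (-(N : ℝ)) * mixedProduct p u := by
  have h0 := normD1_nonneg u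
  have h0' := normD2_nonneg u
  have h0'' := normLp_nonneg 2 u
  rw [mixedProduct, normD1_rescale hu ha.le hb, normD2_rescale hu ha.le hb,
    normLp_dilate two_pos hu.memLp.1 ha.le hb, mixedProduct]
  have hb2 : b ^ 2 = b ^ (2 : ℝ) := by norm_cast
  rw [Real.mul_rpow (by positivity) h0', Real.mul_rpow (by positivity) h0,
    Real.mul_rpow (by positivity) h0'', Real.mul_rpow (by positivity) (by positivity),
    Real.mul_rpow (by positivity) (by positivity), Real.mul_rpow (by positivity) (by positivity),
    Real.mul_rpow (by positivity) (by positivity), Real.mul_rpow (by positivity) (by positivity),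
    hb2, ← Real.rpow_mul hb.le, ← Real.rpow_mul hb.le, ← Real.rpow_mul hb.le, ← Real.rpow_mul hb.le]
  have ea : a ^ p = a ^ ((N * (p - 2) - 4) / 2) * a ^ ((8 - N * (p - 2)) / 2) * a ^ (p - 2) := by
    rw [← Real.rpow_add ha, ← Real.rpow_add ha]; congr 1; ring
  have eb : b ^ (-(N : ℝ)) = b ^ (2 * ((N * (p - 2) - 4) / 2)) *
      b ^ (-(N : ℝ) / 2 * ((N * (p - 2) - 4) / 2)) * (b ^ ((8 - N * (p - 2)) / 2) *
      b ^ (-(N : ℝ) / 2 * ((8 - N * (p - 2)) / 2))) * b ^ (-(N : ℝ) / 2 * (p - 2)) := by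
    simp only [← Real.rpow_add hb]; congr 1; ring
  rw [ea, eb]
  ring

theorem normLp_rpow_rescale (hp : 0 < p) (hu : AEStronglyMeasurable u volume) {a b : ℝ} (ha : 0 < a)
    (hb : 0 < b) : normLp p (rescale a b u) ^ p = a ^ p * b ^ (-(N : ℝ)) * normLp p u ^ p := by
  have h0 := normLp_nonneg p u
  rw [normLp_dilate hp hu ha.le hb, Real.mul_rpow (by positivity) h0,
    Real.mul_rpow ha.le (by positivity), ← Real.rpow_mul hb.le, div_mul_cancel₀ _ hp.ne']

theorem weinstein_rescale (hp : 0 < p) (hu : MemH2 u) {a b : ℝ} (ha : 0 < a) (hb : 0 < b) :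
    weinstein p (rescale a b u) = weinstein p u := by
  rw [weinstein, weinstein, mixedProduct_rescale hu ha hb, normLp_rpow_rescale hp hu.memLp.1 ha hb,
    mul_div_mul_left _ _ (by positivity)]

theorem IsOptimizer.rescale (hp : 0 < p) (hu : IsOptimizer p C u) {a b : ℝ} (ha : 0 < a)
    (hb : 0 < b) : IsOptimizer p C (rescale a b u) := by
  refine ⟨hu.1.rescale ha hb, ?_⟩
  rw [mixedProduct_rescale hu.1.1 ha hb, normLp_rpow_rescale hp hu.1.1.memLp.1 ha hb, hu.2]
  ring

theorem exists_normalize (hu : MemH2 u) (h1 : 0 < normD1 u) (h2 : 0 < normD2 u) :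
    ∃ a b : ℝ, 0 < a ∧ 0 < b ∧ normD1 (rescale a b u) = 1 ∧ normD2 (rescale a b u) = 1 := by
  -- Dilation by `b` multiplies the ratio of the Laplacian norm to the gradient norm by `b`. This
  -- choice makes the two norms equal, and `a` then makes them 1.
  set b := normD1 u / normD2 u with hb
  have hb0 : 0 < b := div_pos h1 h2
  have hbN : 0 < b ^ (-(N : ℝ) / 2) := by positivity
  set a := (b * b ^ (-(N : ℝ) / 2) * normD1 u)⁻¹ with ha
  have ha0 : 0 < a := by positivity
  have e1 : a * b * b ^ (-(N : ℝ) / 2) * normD1 u = 1 := by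
    rw [ha]; field_simp
  refine ⟨a, b, ha0, hb0, ?_, ?_⟩
  · rw [normD1_rescale hu ha0.le hb0, e1]
  · rw [normD2_rescale hu ha0.le hb0, ← e1]
    have : b * normD2 u = normD1 u := by rw [hb]; field_simp
    rw [← this]; ring

theorem exists_isNormalizedMinimizingSeq (hN : 1 ≤ N) (hp₁ : 2 + 4 / (N : ℝ) < p)
    (hp₂ : p < 2 + 8 / (N : ℝ)) (hC0 : 0 < C) (hC : IsBestConstant 𝕜 N p C) :
    ∃ w : ℕ → EuclideanSpace ℝ (Fin N) → 𝕜, IsNormalizedMinimizingSeq p C w := by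
  have hp : 0 < p := by linarith [(exponent_pos hN hp₁ hp₂).2.2]
  have hGN : MixedGNInequality 𝕜 N p C := hC.1
  -- Each of these constants lies below the best one, so some function violates the inequality with
  -- it. The denominator `n + 2` keeps the constant positive already at `n = 0`.
  have hCn : Tendsto (fun n : ℕ => C - C * (1 / ((n : ℝ) + 1 + 1))) atTop (𝓝 C) := by
    have h1 := (tendsto_one_div_add_atTop_nhds_zero_nat (𝕜 := ℝ)).comp (tendsto_add_atTop_nat 1)
    have h2 := (h1.const_mul C).const_sub C
    simpa using h2
  have hpos : ∀ n : ℕ, 0 < C - C * (1 / ((n : ℝ) + 1 + 1)) := fun n => by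
    have : 1 / ((n : ℝ) + 1 + 1) < 1 := by
      rw [div_lt_one (by positivity)]; linarith [(Nat.cast_nonneg n : (0 : ℝ) ≤ n)]
    nlinarith
  have key : ∀ n : ℕ, ∃ w : EuclideanSpace ℝ (Fin N) → 𝕜, MemH2NeZero w ∧ normD1 w = 1 ∧
      normD2 w = 1 ∧ weinstein p w ≤ (C - C * (1 / ((n : ℝ) + 1 + 1)))⁻¹ := by
    intro n
    have h1 : ¬ MixedGNInequality 𝕜 N p (C - C * (1 / ((n : ℝ) + 1 + 1))) := fun h => by
      have h2 := hC.2 h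
      have : 0 < C * (1 / ((n : ℝ) + 1 + 1)) := by positivity
      linarith
    rw [MixedGNInequality] at h1
    push Not at h1
    obtain ⟨u, hu, h2⟩ := h1
    have h3 := h2 (hGN u hu).1
    have hu0 : MemH2NeZero u := ⟨hu, fun h => by
      rw [normLp_eq_zero_of_ae h, Real.zero_rpow hp.ne'] at h3
      exact absurd h3 (not_lt.2 (mul_nonneg (hpos n).le (mixedProduct_nonneg p u)))⟩
    obtain ⟨hg, hd⟩ := hGN.norms_pos hN hp₁ hp₂ hu0
    obtain ⟨a, b, ha, hb, e1, e2⟩ := exists_normalize hu hg hd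
    refine ⟨_, hu0.rescale ha hb, e1, e2, ?_⟩
    have h4 := Real.rpow_pos_of_pos (normLp_pos hp (hGN u hu).1 hu0.2) p
    rw [weinstein_rescale hp hu ha hb, weinstein, div_le_iff₀ h4, le_inv_mul_iff₀ (hpos n)]
    exact h3.le
  choose w hw h1 h2 h3 using key
  refine ⟨w, hw, h1, h2, ?_⟩
  exact tendsto_of_tendsto_of_tendsto_of_le_of_le tendsto_const_nhds (hCn.inv₀ hC0.ne')
    (fun n => hGN.inv_le_weinstein hC0 hp (hw n)) h3

end Best

/-! ### Bounds for normalized functions -/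

section Normalized

variable {u : EuclideanSpace ℝ (Fin N) → 𝕜} {p : ℝ}

theorem normLp_sub_le {q : ℝ} (hq : 1 ≤ q) {u v : EuclideanSpace ℝ (Fin N) → 𝕜}
    (hu : MemLp u (ENNReal.ofReal q) volume) (hv : MemLp v (ENNReal.ofReal q) volume) :
    normLp q (u - v) ≤ normLp q u + normLp q v := by
  rw [normLp, normLp, normLp, ← ENNReal.toReal_add hu.2.ne hv.2.ne]
  exact ENNReal.toReal_mono (ENNReal.add_ne_top.2 ⟨hu.2.ne, hv.2.ne⟩)
    (eLpNorm_sub_le hu.1 hv.1 (by simpa using hq))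

theorem normLp_le_sub_add {q : ℝ} (hq : 1 ≤ q) {u v : EuclideanSpace ℝ (Fin N) → 𝕜}
    (hu : MemLp u (ENNReal.ofReal q) volume) (hv : MemLp v (ENNReal.ofReal q) volume) :
    normLp q u ≤ normLp q (u - v) + normLp q v := by
  rw [normLp, normLp, normLp, ← ENNReal.toReal_add (hu.sub hv).2.ne hv.2.ne]
  refine ENNReal.toReal_mono (ENNReal.add_ne_top.2 ⟨(hu.sub hv).2.ne, hv.2.ne⟩) ?_
  have := eLpNorm_add_le (p := ENNReal.ofReal q) (hu.sub hv).1 hv.1 (by simpa using hq)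
  simpa using this

theorem normLp_sub_mollify_two {t : ℝ} (ht : 0 < t) (hu : MemLp u 2 volume) :
    normLp 2 (u - mollify ht u) ≤ (1 + 2 ^ N) * normLp 2 u := by
  have h1 := normLp_sub_le (q := 2) (by norm_num) (by simpa using hu)
    (by simpa using memLp_mollify_two ht hu)
  have h2 := normLp_mollify_le ht hu
  linarith

theorem normD1_sub_mollify_le {t : ℝ} (ht : 0 < t) (hu : MemH2 u) :
    normD1 (u - mollify ht u) ≤ (N + 1) * (1 + 2 ^ N) * normD1 u := by
  have H := hu.h2Data
  have h0 := normD1_nonneg u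
  refine abs_le_of_sq_le_sq' ?_ (by positivity) |>.2
  rw [(H.sub (H.mollify ht)).normD1_sq]
  have h1 : ∀ i, normLp 2 (weakPartial i u - mollify ht (weakPartial i u)) ^ 2
      ≤ ((1 + 2 ^ N) * normD1 u) ^ 2 := fun i => by
    refine pow_le_pow_left₀ (normLp_nonneg _ _) ((normLp_sub_mollify_two ht (H.memLp₁ i)).trans ?_) 2
    gcongr
    exact H.normLp_partial_le i
  refine (Finset.sum_le_sum fun i _ => h1 i).trans ?_
  rw [Finset.sum_const, Finset.card_univ, Fintype.card_fin, nsmul_eq_mul, mul_assoc, mul_pow (N + 1 : ℝ)]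
  gcongr
  nlinarith [(Nat.cast_nonneg N : (0 : ℝ) ≤ N)]

theorem normD2_sub_mollify_le {t : ℝ} (ht : 0 < t) (hu : MemH2 u) :
    normD2 (u - mollify ht u) ≤ (N + 1) * (1 + 2 ^ N) * normD2 u := by
  have H := hu.h2Data
  have h0 := normD2_nonneg u
  have h1 := normLp_sub_mollify_two ht H.memLp_lap
  rw [H.mollify_lap] at h1
  rw [(H.sub (H.mollify ht)).normD2_eq]
  simp only [Pi.sub_apply, Finset.sum_sub_distrib]
  refine h1.trans ?_
  rw [← H.normD2_eq, mul_assoc]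
  refine le_mul_of_one_le_left (by positivity) ?_
  linarith [(Nat.cast_nonneg N : (0 : ℝ) ≤ N)]

/-- The mixed inequality is applied to the mollification error: its first and second order norms
stay bounded while its `L²` norm is of order `t²`. The bound tends to zero with `t` and does not
involve the `L²` norm of `u`. -/
theorem MixedGNInequality.normLp_sub_mollify_le {K : ℝ} (hK : MixedGNInequality 𝕜 N p K) (hK0 : 0 ≤ K)
    (hN : 1 ≤ N) (hp₁ : 2 + 4 / (N : ℝ) < p) (hp₂ : p < 2 + 8 / (N : ℝ)) (hu : MemH2 u)
    (h1 : normD1 u = 1) (h2 : normD2 u = 1) {t : ℝ} (ht : 0 < t) :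
    normLp p (u - mollify ht u) ^ p ≤ K * ((((N + 1) * (1 + 2 ^ N) : ℝ) ^ ((N * (p - 2) - 4) / 2) *
      ((N + 1) * (1 + 2 ^ N) : ℝ) ^ ((8 - N * (p - 2)) / 2)) * (errConst N * t ^ 2) ^ (p - 2)) := by
  obtain ⟨hα, hβ, hγ⟩ := exponent_pos hN hp₁ hp₂
  have H := hu.h2Data
  refine (hK _ (H.sub (H.mollify ht)).memH2).2.trans ?_
  have e1 := normD1_sub_mollify_le ht hu
  have e2 := normD2_sub_mollify_le ht hu
  have e3 := H.normLp_sub_mollify_le₂ ht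
  rw [h1, mul_one] at e1
  rw [h2, mul_one] at e2
  rw [h2, mul_one] at e3
  have := normLp_nonneg 2 (u - mollify ht u)
  have := normD1_nonneg (u - mollify ht u)
  have := normD2_nonneg (u - mollify ht u)
  unfold mixedProduct
  gcongr

theorem normLp_rpow_le_of_bound {q S : ℝ} (hq : 0 < q) (hqp : q ≤ p) (hS : ∀ x, ‖u x‖ ≤ S)
    (huq : MemLp u (ENNReal.ofReal q) volume) (hup : MemLp u (ENNReal.ofReal p) volume) :
    normLp p u ^ p ≤ S ^ (p - q) * normLp q u ^ q := by
  have hp : 0 < p := hq.trans_le hqp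
  have hS0 : 0 ≤ S := (norm_nonneg _).trans (hS 0)
  rw [normLp_rpow hp hup, normLp_rpow hq huq, ← integral_const_mul]
  refine integral_mono ?_ (Integrable.const_mul ?_ _) fun x => ?_
  · simpa [ENNReal.toReal_ofReal hp.le] using hup.integrable_norm_rpow (by simpa using hp) (by simp)
  · simpa [ENNReal.toReal_ofReal hq.le] using huq.integrable_norm_rpow (by simpa using hq) (by simp)
  · rcases (norm_nonneg (u x)).eq_or_lt with h | h
    · simp only [← h, Real.zero_rpow hp.ne', Real.zero_rpow hq.ne', mul_zero, le_refl]
    · change ‖u x‖ ^ p ≤ S ^ (p - q) * ‖u x‖ ^ q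
      rw [show p = (p - q) + q by ring, Real.rpow_add h, add_sub_cancel_right]
      gcongr
      exact hS x

theorem norm_mollify_le_of_bound {t S : ℝ} (ht : 0 < t) (hu : LocallyIntegrable u volume)
    (hS : ∀ x, ‖u x‖ ≤ S) (x : EuclideanSpace ℝ (Fin N)) : ‖mollify ht u x‖ ≤ S := by
  have hi := (mol_continuous (N := N) ht).integrable_of_hasCompactSupport
    (mol_hasCompactSupport ht) (μ := volume)
  calc ‖mollify ht u x‖ ≤ ∫ y, ‖mol ht y • u (x - y)‖ := norm_integral_le_integral_norm _
    _ ≤ ∫ y, mol ht y * S := by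
        refine integral_mono (integrable_mol_smul_comp_sub ht hu x).norm (hi.mul_const S) fun y => ?_
        simp only [norm_smul, Real.norm_of_nonneg (mol_nonneg ht y)]
        gcongr
        · exact mol_nonneg ht y
        · exact hS _
    _ = S := by rw [integral_mul_const, integral_mol, one_mul]

/-- The gain is the power `3/4` instead of the trivial power 1. With `M` the `L²` norm, compare with
the coarser scale `T = √M`: the error `u - u_T` has `L²` norm of order `T = M^(1/2)`, and `u_T` is
bounded by a multiple of `T^(-N/2) M = M^(1 - N/4)`, where `N ≥ 1`. -/
theorem norm_mollify_one_le (hN : 1 ≤ N) (hu : MemH2 u) (h1 : normD1 u = 1) (hM : 1 ≤ normLp 2 u)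
    (x : EuclideanSpace ℝ (Fin N)) :
    ‖mollify one_pos u x‖ ≤ molConst N * (1 + errConst N) * normLp 2 u ^ (3 / 4 : ℝ) := by
  have hc := molConst_pos (N := N)
  have he := errConst_pos (N := N)
  set M := normLp 2 u with hMdef
  have hM0 : 0 < M := by linarith
  have hT : 0 < √M := Real.sqrt_pos.2 hM0
  have hl := hu.memLp.locallyIntegrable (by norm_num)
  have hv := memLp_mollify_two hT hu.memLp
  have hvl := hv.locallyIntegrable (by norm_num)
  have hdecomp : mollify one_pos u x
      = mollify one_pos (u - mollify hT u) x + mollify one_pos (mollify hT u) x := by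
    rw [mollify, mollify, conv_sub (mol_continuous _) (mol_hasCompactSupport _) hl hvl]
    simp [mollify]
  have e1 : ‖mollify one_pos (u - mollify hT u) x‖ ≤ molConst N * errConst N * M ^ (3 / 4 : ℝ) := by
    refine (norm_mollify_le one_pos (hu.memLp.sub hv) x).trans ?_
    have h2 := hu.h2Data.normLp_sub_mollify_le hT
    rw [h1, mul_one] at h2
    rw [Real.one_rpow, mul_one, mul_assoc]
    gcongr
    refine h2.trans ?_
    gcongr
    rw [Real.sqrt_eq_rpow]
    exact Real.rpow_le_rpow_of_exponent_le hM (by norm_num)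
  have e2 : ‖mollify one_pos (mollify hT u) x‖ ≤ molConst N * M ^ (3 / 4 : ℝ) := by
    refine norm_mollify_le_of_bound one_pos hvl (fun y => ?_) x
    refine (norm_mollify_le hT hu.memLp y).trans ?_
    rw [mul_assoc, ← hMdef, Real.sqrt_eq_rpow, ← Real.rpow_mul hM0.le]
    gcongr
    nth_rewrite 2 [← Real.rpow_one M]
    rw [← Real.rpow_add hM0]
    refine Real.rpow_le_rpow_of_exponent_le hM ?_
    have : (1 : ℝ) ≤ N := by exact_mod_cast hN
    linarith
  rw [hdecomp]
  refine (norm_add_le _ _).trans ((add_le_add e1 e2).trans_eq ?_)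
  ring

theorem add_rpow_le {x y p : ℝ} (hx : 0 ≤ x) (hy : 0 ≤ y) (hp : 0 < p) :
    (x + y) ^ p ≤ 2 ^ p * (x ^ p + y ^ p) := by
  have h1 : x + y ≤ 2 * max x y := by linarith [le_max_left x y, le_max_right x y]
  have h2 : (max x y) ^ p ≤ x ^ p + y ^ p := by
    have := Real.rpow_nonneg hx p
    have := Real.rpow_nonneg hy p
    rcases max_cases x y with ⟨h, -⟩ | ⟨h, -⟩ <;> rw [h] <;> linarith
  calc (x + y) ^ p ≤ (2 * max x y) ^ p := Real.rpow_le_rpow (by positivity) h1 hp.le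
    _ = 2 ^ p * (max x y) ^ p := Real.mul_rpow zero_le_two (le_max_of_le_left hx)
    _ ≤ _ := by gcongr

theorem weinstein_of_normalized (h1 : normD1 u = 1) (h2 : normD2 u = 1) :
    weinstein p u = normLp 2 u ^ (p - 2) / normLp p u ^ p := by
  rw [weinstein, mixedProduct, h1, h2]; simp

variable (𝕜) in
/-- The `L²` norm is bounded along normalized sequences with bounded Weinstein functional. -/
theorem exists_normLp_two_bound (hN : 1 ≤ N) (hp₁ : 2 + 4 / (N : ℝ) < p)
    (hp₂ : p < 2 + 8 / (N : ℝ)) (B : ℝ) : ∃ M₀ : ℝ, ∀ u : EuclideanSpace ℝ (Fin N) → 𝕜,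
      MemH2NeZero u → normD1 u = 1 → normD2 u = 1 → weinstein p u ≤ B → normLp 2 u ≤ M₀ := by
  obtain ⟨hα, hβ, hγ⟩ := exponent_pos hN hp₁ hp₂
  have hp : 0 < p := by linarith
  have h4N : 0 < 4 / (N : ℝ) := by
    have : (0 : ℝ) < N := by exact_mod_cast hN
    positivity
  -- Any exponent strictly between `2 + 4/N` and `p` would do. The mixed inequality holds at `q`
  -- too, and `p - q > 0` powers of the sup norm are left over.
  set q := (2 + 4 / (N : ℝ) + p) / 2 with hq
  have hq₁ : 2 + 4 / (N : ℝ) < q := by rw [hq]; linarith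
  have hqp : q < p := by rw [hq]; linarith
  have hq2 : 0 < q - 2 := by linarith
  obtain ⟨K, hK0, hK⟩ := exists_mixedGNInequality 𝕜 hN hp₁ hp₂
  obtain ⟨L, hL0, hL⟩ := exists_mixedGNInequality 𝕜 hN hq₁ (hqp.trans hp₂)
  have hc := molConst_pos (N := N)
  have he := errConst_pos (N := N)
  set A₁ := K * ((((N + 1) * (1 + 2 ^ N) : ℝ) ^ ((N * (p - 2) - 4) / 2) *
      ((N + 1) * (1 + 2 ^ N) : ℝ) ^ ((8 - N * (p - 2)) / 2)) * (errConst N * 1 ^ 2) ^ (p - 2)) with hA₁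
  have hA₁0 : 0 < A₁ := by positivity
  set A₂ := (molConst N * (1 + errConst N)) ^ (p - q) * ((2 ^ N) ^ q * L) with hA₂
  have hA₂0 : 0 < A₂ := by positivity
  -- This is the growth exponent of `‖u‖_p^p` in the `L²` norm `M`. It falls short of `p - 2` by `(p
  -- - q) / 4`, so a bounded Weinstein functional bounds `M`.
  set r := (3 / 4 : ℝ) * (p - q) + (q - 2) with hr
  have hr0 : 0 < r := by rw [hr]; nlinarith
  set A := |B| * (2 ^ p * (A₁ + A₂)) with hA
  have hA0 : 0 ≤ A := by positivity
  refine ⟨max 1 (A ^ (4 / (p - q))), fun u hu h1 h2 hW => ?_⟩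
  rcases le_total (normLp 2 u) 1 with hM | hM
  · exact hM.trans (le_max_left _ _)
  refine le_max_of_le_right ?_
  have hup := (hK u hu.1).1
  have hupos : 0 < normLp p u ^ p := Real.rpow_pos_of_pos (normLp_pos hp hup hu.2) p
  set M := normLp 2 u with hMdef
  have hM0 : 0 < M := by linarith
  set v := mollify one_pos u with hv
  have hvH : MemH2 v := (hu.1.h2Data.mollify one_pos).memH2
  have hvp := (hK v hvH).1
  have e1 : normLp p (u - v) ^ p ≤ A₁ :=
    hK.normLp_sub_mollify_le hK0.le hN hp₁ hp₂ hu.1 h1 h2 one_pos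
  -- Here `p - q` powers are estimated by the sup bound `M^(3/4)`, and the remaining `L^q` norm by
  -- the mixed inequality at `q`.
  have e2 : normLp p v ^ p ≤ A₂ * M ^ r := by
    have f1 := normLp_rpow_le_of_bound (by linarith) hqp.le (norm_mollify_one_le hN hu.1 h1 hM)
      (hL v hvH).1 hvp
    have f2 : normLp q v ≤ 2 ^ N * normLp q u := by
      have g1 := eLpNorm_mollify_le one_pos (q := ENNReal.ofReal q)
        (by simp; linarith) (by simp) hu.1.memLp.1
      have g2 := ENNReal.toReal_mono (ENNReal.mul_ne_top (by simp) (hL u hu.1).1.2.ne) g1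
      rw [ENNReal.toReal_mul] at g2
      simpa [normLp, hv] using g2
    have f3 : normLp q u ^ q ≤ L * M ^ (q - 2) := by
      have := (hL u hu.1).2
      rw [mixedProduct, h1, h2] at this
      simpa using this
    have f4 : normLp q v ^ q ≤ (2 ^ N) ^ q * (L * M ^ (q - 2)) := by
      refine (Real.rpow_le_rpow (normLp_nonneg _ _) f2 (by linarith)).trans ?_
      rw [Real.mul_rpow (by positivity) (normLp_nonneg _ _)]
      gcongr
    calc normLp p v ^ p ≤ _ := f1
      _ ≤ (molConst N * (1 + errConst N) * M ^ (3 / 4 : ℝ)) ^ (p - q) *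
          ((2 ^ N) ^ q * (L * M ^ (q - 2))) := by gcongr
      _ = A₂ * M ^ r := by
          rw [Real.mul_rpow (by positivity) (by positivity), ← Real.rpow_mul hM0.le, hA₂, hr,
            Real.rpow_add hM0]
          ring
  have e3 : normLp p u ^ p ≤ 2 ^ p * (A₁ + A₂) * M ^ r := by
    have f1 := normLp_le_sub_add (by linarith) hup hvp
    have f2 : 1 ≤ M ^ r := Real.one_le_rpow hM hr0.le
    calc normLp p u ^ p ≤ (normLp p (u - v) + normLp p v) ^ p :=
          Real.rpow_le_rpow (normLp_nonneg _ _) f1 hp.le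
      _ ≤ 2 ^ p * (normLp p (u - v) ^ p + normLp p v ^ p) :=
          add_rpow_le (normLp_nonneg _ _) (normLp_nonneg _ _) hp
      _ ≤ 2 ^ p * (A₁ * M ^ r + A₂ * M ^ r) := by
          gcongr
          exact e1.trans (le_mul_of_one_le_right hA₁0.le f2)
      _ = _ := by ring
  have e4 : M ^ (p - 2) ≤ A * M ^ r := by
    rw [weinstein_of_normalized h1 h2, div_le_iff₀ hupos] at hW
    calc M ^ (p - 2) ≤ B * normLp p u ^ p := hW
      _ ≤ |B| * (2 ^ p * (A₁ + A₂) * M ^ r) := by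
          gcongr
          exact le_abs_self B
      _ = A * M ^ r := by rw [hA]; ring
  have e5 : M ^ ((p - q) / 4) ≤ A := by
    have : p - 2 = (p - q) / 4 + r := by rw [hr]; ring
    rw [this, Real.rpow_add hM0] at e4
    exact le_of_mul_le_mul_right e4 (by positivity)
  have hpq : 0 < p - q := by linarith
  calc M = (M ^ ((p - q) / 4)) ^ (4 / (p - q)) := by
        rw [← Real.rpow_mul hM0.le]
        rw [show (p - q) / 4 * (4 / (p - q)) = 1 by field_simp, Real.rpow_one]
    _ ≤ A ^ (4 / (p - q)) := Real.rpow_le_rpow (by positivity) e5 (by positivity)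

theorem exists_pos_mul_rpow_lt {A δ r : ℝ} (hA : 0 ≤ A) (hδ : 0 < δ) (hr : 0 < r) :
    ∃ x : ℝ, 0 < x ∧ A * x ^ r < δ := by
  refine ⟨(δ / (A + 1)) ^ r⁻¹, by positivity, ?_⟩
  rw [← Real.rpow_mul (by positivity), inv_mul_cancel₀ hr.ne', Real.rpow_one, ← mul_div_assoc,
    div_lt_iff₀ (by positivity)]
  nlinarith

variable (𝕜) in
/-- Normalized functions with bounded Weinstein functional do not vanish uniformly. -/
theorem exists_nonvanishing (hN : 1 ≤ N) (hp₁ : 2 + 4 / (N : ℝ) < p)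
    (hp₂ : p < 2 + 8 / (N : ℝ)) (B M₀ : ℝ) : ∃ (t : ℝ) (ht : 0 < t) (κ : ℝ), 0 < κ ∧
      ∀ u : EuclideanSpace ℝ (Fin N) → 𝕜, MemH2NeZero u → normD1 u = 1 → normD2 u = 1 →
      weinstein p u ≤ B → normLp 2 u ≤ M₀ → ∃ y, κ ≤ ‖mollify ht u y‖ := by
  obtain ⟨hα, hβ, hγ⟩ := exponent_pos hN hp₁ hp₂
  have hp : 0 < p := by linarith
  have hN0 : (0 : ℝ) < N := by exact_mod_cast hN
  obtain ⟨K, hK0, hK⟩ := exists_mixedGNInequality 𝕜 hN hp₁ hp₂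
  have he := errConst_pos (N := N)
  -- By the interpolation inequality for the gradient, `c` bounds the `L²` norm below on normalized
  -- functions. Together with the bound on the Weinstein functional, `m` then bounds the `L^p` norm
  -- below.
  set c := (N * 4 ^ N : ℝ)⁻¹ with hc
  have hc0 : 0 < c := by positivity
  set m := (c ^ (p - 2) / (|B| + 1)) ^ p⁻¹ with hm
  have hm0 : 0 < m := by positivity
  -- `τ` stands for `errConst N * t ^ 2`, and makes the `L^p` mollification error less than `m / 2`.
  -- Then `κ` is chosen so that a mollification everywhere below `κ` would also have `L^p` norm less
  -- than `m / 2`.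
  obtain ⟨τ, hτ, hτ'⟩ := exists_pos_mul_rpow_lt (A := K * (((N + 1) * (1 + 2 ^ N) : ℝ) ^
    ((N * (p - 2) - 4) / 2) * ((N + 1) * (1 + 2 ^ N) : ℝ) ^ ((8 - N * (p - 2)) / 2)))
    (δ := (m / 2) ^ p) (by positivity) (by positivity) hγ
  obtain ⟨κ, hκ, hκ'⟩ := exists_pos_mul_rpow_lt (A := (2 ^ N * M₀) ^ 2) (δ := (m / 2) ^ p)
    (by positivity) (by positivity) hγ
  have ht : 0 < √(τ / errConst N) := by positivity
  refine ⟨_, ht, κ, hκ, fun u hu h1 h2 hW hM => ?_⟩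
  by_contra! hcon
  have hup := (hK u hu.1).1
  have hupos : 0 < normLp p u ^ p := Real.rpow_pos_of_pos (normLp_pos hp hup hu.2) p
  set v := mollify ht u with hv
  have hvH : MemH2 v := (hu.1.h2Data.mollify ht).memH2
  have hvp := (hK v hvH).1
  have f1 : m ≤ normLp p u := by
    have g1 := hu.1.h2Data.normD1_sq_le
    rw [h1, h2, mul_one, one_pow] at g1
    have g2 : c ≤ normLp 2 u := by
      rw [hc, inv_le_iff_one_le_mul₀ (by positivity), mul_comm]; exact g1
    rw [weinstein_of_normalized h1 h2, div_le_iff₀ hupos] at hW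
    have g3 : c ^ (p - 2) ≤ (|B| + 1) * normLp p u ^ p := by
      calc c ^ (p - 2) ≤ normLp 2 u ^ (p - 2) := Real.rpow_le_rpow hc0.le g2 hγ.le
        _ ≤ B * normLp p u ^ p := hW
        _ ≤ (|B| + 1) * normLp p u ^ p := by
            gcongr
            linarith [le_abs_self B]
    rw [hm, Real.rpow_inv_le_iff_of_pos (by positivity) (normLp_nonneg _ _) hp,
      div_le_iff₀ (by positivity), mul_comm]
    exact g3
  have f2 : normLp p (u - v) < m / 2 := by
    have g1 := hK.normLp_sub_mollify_le hK0.le hN hp₁ hp₂ hu.1 h1 h2 ht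
    rw [Real.sq_sqrt (by positivity), mul_div_cancel₀ _ he.ne', ← mul_assoc] at g1
    exact (Real.rpow_lt_rpow_iff (normLp_nonneg _ _) (by positivity) hp).1 (g1.trans_lt hτ')
  have f3 : normLp p v < m / 2 := by
    have g1 := normLp_rpow_le_of_bound (q := 2) two_pos (by linarith) (fun x => (hcon x).le)
      (by simpa using hvH.memLp) hvp
    have g2 : normLp 2 v ^ (2 : ℝ) ≤ (2 ^ N * M₀) ^ 2 := by
      rw [Real.rpow_two]
      refine pow_le_pow_left₀ (normLp_nonneg _ _) ((normLp_mollify_le ht hu.1.memLp).trans ?_) 2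
      gcongr
    refine (Real.rpow_lt_rpow_iff (normLp_nonneg _ _) (by positivity) hp).1 (lt_of_le_of_lt ?_ hκ')
    rw [mul_comm]
    exact g1.trans (by gcongr)
  have f4 := normLp_le_sub_add (by linarith) hup hvp
  linarith

end Normalized

/-! ### Weak convergence in `L²` -/

/-- The scalar products with a countable dense sequence lie in a countable product of compact balls,
so one subsequence makes all of them converge, for all `i` at once. Density and boundedness extend
this to every `f`, and Riesz representation turns the limits into vectors. -/
theorem exists_weak_subseq {H : Type*} [NormedAddCommGroup H] [InnerProductSpace 𝕜 H]
    [CompleteSpace H] [TopologicalSpace.SeparableSpace H] {ι : Type*} [Countable ι]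
    {x : ι → ℕ → H} {R : ℝ} (hx : ∀ i n, ‖x i n‖ ≤ R) :
    ∃ (k : ℕ → ℕ) (y : ι → H), StrictMono k ∧
      ∀ i f, Tendsto (fun n => inner 𝕜 (x i (k n)) f) atTop (𝓝 (inner 𝕜 (y i) f)) := by
  set e := TopologicalSpace.denseSeq H
  have hcomp : IsCompact (Set.univ.pi fun im : ι × ℕ =>
      Metric.closedBall (0 : 𝕜) (R * ‖e im.2‖)) :=
    isCompact_univ_pi fun _ => isCompact_closedBall _ _
  obtain ⟨a, -, k, hk, ha⟩ := hcomp.tendsto_subseq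
    (x := fun n (im : ι × ℕ) => inner 𝕜 (x im.1 n) (e im.2)) fun n im _ => by
      rw [mem_closedBall_zero_iff]
      exact (norm_inner_le_norm _ _).trans (by gcongr; exact hx _ _)
  rw [tendsto_pi_nhds] at ha
  have hcauchy : ∀ i f, ∃ l, Tendsto (fun n => inner 𝕜 (x i (k n)) f) atTop (𝓝 l) := by
    intro i f
    refine cauchySeq_tendsto_of_complete (Metric.cauchySeq_iff'.2 fun δ hδ => ?_)
    have hR : 0 ≤ R := (norm_nonneg _).trans (hx i 0)
    obtain ⟨m, hm⟩ := (TopologicalSpace.denseRange_denseSeq H).exists_dist_lt f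
      (show 0 < δ / (3 * (R + 1)) by positivity)
    rw [dist_eq_norm] at hm
    have hb : ∀ n, dist (inner 𝕜 (x i (k n)) f) (inner 𝕜 (x i (k n)) (e m)) ≤ δ / 3 := by
      intro n
      rw [dist_eq_norm, ← inner_sub_right]
      refine (norm_inner_le_norm _ _).trans ?_
      calc ‖x i (k n)‖ * ‖f - e m‖ ≤ (R + 1) * (δ / (3 * (R + 1))) := by
            gcongr
            linarith [hx i (k n)]
        _ = δ / 3 := by field_simp
    obtain ⟨n₀, hn₀⟩ := Metric.cauchySeq_iff'.1 (ha (i, m)).cauchySeq (δ / 3) (by positivity)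
    refine ⟨n₀, fun n hn => ?_⟩
    have h1 := hn₀ n hn
    have h2 := hb n
    have h3 := hb n₀
    simp only [Function.comp_apply] at h1
    rw [dist_comm] at h3
    have := dist_triangle4 (inner 𝕜 (x i (k n)) f) (inner 𝕜 (x i (k n)) (e m))
      (inner 𝕜 (x i (k n₀)) (e m)) (inner 𝕜 (x i (k n₀)) f)
    linarith
  choose l hl using hcauchy
  have hl' : ∀ i, Tendsto (fun n f => innerSL 𝕜 (x i (k n)) f) atTop (𝓝 (l i)) := fun i =>
    tendsto_pi_nhds.2 fun f => hl i f
  refine ⟨k, fun i => (InnerProductSpace.toDual 𝕜 H).symm (continuousLinearMapOfTendsto _ (hl' i)),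
    hk, fun i f => ?_⟩
  rw [InnerProductSpace.toDual_symm_apply]
  exact hl i f

/-- Weak convergence in `L²`. -/
def WeakL2 (f : ℕ → EuclideanSpace ℝ (Fin N) → 𝕜) (v : EuclideanSpace ℝ (Fin N) → 𝕜) : Prop :=
  ∀ φ : EuclideanSpace ℝ (Fin N) → 𝕜, MemLp φ 2 volume →
    Tendsto (fun n => ∫ x, inner 𝕜 (φ x) (f n x)) atTop (𝓝 (∫ x, inner 𝕜 (φ x) (v x)))

theorem inner_toLp {a b : EuclideanSpace ℝ (Fin N) → 𝕜} (ha : MemLp a 2 volume)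
    (hb : MemLp b 2 volume) : inner 𝕜 (ha.toLp a) (hb.toLp b) = ∫ x, inner 𝕜 (a x) (b x) := by
  rw [L2.inner_def]
  refine integral_congr_ae ?_
  filter_upwards [ha.coeFn_toLp, hb.coeFn_toLp] with x h1 h2
  rw [h1, h2]

theorem exists_weakL2_subseq {ι : Type*} [Countable ι] {f : ι → ℕ → EuclideanSpace ℝ (Fin N) → 𝕜}
    (hf : ∀ i n, MemLp (f i n) 2 volume) {R : ℝ} (hR : ∀ i n, normLp 2 (f i n) ≤ R) :
    ∃ (k : ℕ → ℕ) (v : ι → EuclideanSpace ℝ (Fin N) → 𝕜), StrictMono k ∧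
      (∀ i, MemLp (v i) 2 volume) ∧ ∀ i, WeakL2 (fun n => f i (k n)) (v i) := by
  have : Fact ((2 : ENNReal) ≠ ⊤) := ⟨by simp⟩
  obtain ⟨k, y, hk, hy⟩ := exists_weak_subseq (𝕜 := 𝕜) (x := fun i n => (hf i n).toLp (f i n))
    (R := R) fun i n => by rw [Lp.norm_toLp, ← normLp_two]; exact hR i n
  refine ⟨k, fun i => y i, hk, fun i => Lp.memLp (y i), fun i φ hφ => ?_⟩
  -- `exists_weak_subseq` has the sequence in the first slot of the inner product and `WeakL2` has
  -- it in the second; conjugation exchanges them.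
  have h1 := (hy i (hφ.toLp φ)).star
  simp only [RCLike.star_def, inner_conj_symm] at h1
  simp only [inner_toLp] at h1
  have h2 : y i = (Lp.memLp (y i)).toLp (y i) := (Lp.toLp_coeFn _ _).symm
  rw [h2, inner_toLp] at h1
  exact h1

section Weak

variable {f : ℕ → EuclideanSpace ℝ (Fin N) → 𝕜} {v : EuclideanSpace ℝ (Fin N) → 𝕜}

theorem WeakL2.comp (h : WeakL2 f v) {k : ℕ → ℕ} (hk : StrictMono k) :
    WeakL2 (fun n => f (k n)) v := fun φ hφ => (h φ hφ).comp hk.tendsto_atTop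

theorem WeakL2.tendsto_smul (h : WeakL2 f v) {ψ : EuclideanSpace ℝ (Fin N) → ℝ}
    (hψ : Continuous ψ) (hc : HasCompactSupport ψ) :
    Tendsto (fun n => ∫ x, ψ x • f n x) atTop (𝓝 (∫ x, ψ x • v x)) := by
  have h1 : MemLp (fun x => (ψ x : 𝕜)) 2 volume :=
    (RCLike.continuous_ofReal.comp hψ).memLp_of_hasCompactSupport
      (hc.comp_left (g := fun r : ℝ => (r : 𝕜)) (by simp))
  have h2 := h _ h1
  simpa only [RCLike.inner_apply, RCLike.conj_ofReal, RCLike.real_smul_eq_coe_mul, mul_comm] using h2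

theorem HasWeakPartial.of_weakL2 {i : Fin N} {g : ℕ → EuclideanSpace ℝ (Fin N) → 𝕜}
    {w : EuclideanSpace ℝ (Fin N) → 𝕜} (h : ∀ n, HasWeakPartial i (f n) (g n)) (hf : WeakL2 f v)
    (hg : WeakL2 g w) (hv : MemLp v 2 volume) (hw : MemLp w 2 volume) : HasWeakPartial i v w where
  locallyIntegrable_fun := hv.locallyIntegrable (by norm_num)
  locallyIntegrable_deriv := hw.locallyIntegrable (by norm_num)
  integral_eq φ hφ hc := by
    have h1 := hf.tendsto_smul (ψ := fun x => fderiv ℝ φ x (EuclideanSpace.single i 1))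
      ((hφ.continuous_fderiv (by simp)).clm_apply continuous_const) (hc.fderiv_apply ℝ _)
    have h2 := (hg.tendsto_smul hφ.continuous hc).neg
    simp only [fun n => (h n).integral_eq φ hφ hc] at h1
    exact tendsto_nhds_unique h1 h2

/-- At a fixed point the mollification is a pairing with a fixed test function, so weak convergence
becomes pointwise convergence. -/
theorem WeakL2.tendsto_mollify (h : WeakL2 f v) {t : ℝ} (ht : 0 < t)
    (x : EuclideanSpace ℝ (Fin N)) :
    Tendsto (fun n => mollify ht (f n) x) atTop (𝓝 (mollify ht v x)) := by
  simp only [mollify, conv_swap]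
  exact h.tendsto_smul ((mol_continuous ht).comp (continuous_sub_left x))
    ((mol_hasCompactSupport ht).comp_homeomorph (Homeomorph.subLeft x))

/-- Expand the square; the cross term converges to `2 ‖v‖₂²` because one factor is fixed. -/
theorem WeakL2.tendsto_norm_split (h : WeakL2 f v) (hf : ∀ n, MemLp (f n) 2 volume)
    (hv : MemLp v 2 volume) :
    Tendsto (fun n => normLp 2 (f n) ^ 2 - normLp 2 (f n - v) ^ 2) atTop (𝓝 (normLp 2 v ^ 2)) := by
  have h1 : ∀ n, normLp 2 (f n) ^ 2 - normLp 2 (f n - v) ^ 2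
      = 2 * RCLike.re (∫ x, inner 𝕜 (v x) (f n x)) - normLp 2 v ^ 2 := by
    intro n
    have h2 := norm_sub_sq (𝕜 := 𝕜) ((hf n).toLp (f n)) (hv.toLp v)
    rw [← MemLp.toLp_sub, Lp.norm_toLp, Lp.norm_toLp, Lp.norm_toLp, ← normLp_two, ← normLp_two,
      ← normLp_two, inner_re_symm, inner_toLp] at h2
    linarith
  have h3 := h v hv
  have h4 : RCLike.re (∫ x, inner 𝕜 (v x) (v x)) = normLp 2 v ^ 2 := by
    rw [← inner_toLp hv hv, inner_self_eq_norm_sq, Lp.norm_toLp, ← normLp_two]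
  have h5 := (((RCLike.continuous_re.tendsto _).comp h3).const_mul 2).sub_const (normLp 2 v ^ 2)
  rw [h4, show 2 * normLp 2 v ^ 2 - normLp 2 v ^ 2 = normLp 2 v ^ 2 by ring] at h5
  simp only [h1]
  exact h5

theorem WeakL2.sum {ι : Type*} [Fintype ι] {f : ι → ℕ → EuclideanSpace ℝ (Fin N) → 𝕜}
    {v : ι → EuclideanSpace ℝ (Fin N) → 𝕜} (h : ∀ i, WeakL2 (f i) (v i))
    (hf : ∀ i n, MemLp (f i n) 2 volume) (hv : ∀ i, MemLp (v i) 2 volume) :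
    WeakL2 (fun n => ∑ i, f i n) (∑ i, v i) := by
  intro φ hφ
  have h1 : ∀ {a : ι → EuclideanSpace ℝ (Fin N) → 𝕜}, (∀ i, MemLp (a i) 2 volume) →
      ∫ x, inner 𝕜 (φ x) ((∑ i, a i) x) = ∑ i, ∫ x, inner 𝕜 (φ x) (a i x) := fun {a} ha => by
    simp only [Finset.sum_apply, inner_sum]
    refine integral_finsetSum _ fun i _ => ?_
    refine (hφ.norm.integrable_mul (ha i).norm).mono' (hφ.1.inner (ha i).1) (.of_forall fun x => ?_)
    exact norm_inner_le_norm _ _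
  simp only [h1 (fun i => hf i _), h1 hv]
  exact tendsto_finsetSum _ fun i _ => h i φ hφ

/-! ### Local compactness -/

/-- With a finite measure below Lebesgue measure and having the same null sets, local compactness is
proved on the whole space at once, with no diagonal argument over balls. -/
theorem exists_finite_measure_le {α : Type*} [MeasurableSpace α] (μ : Measure α) [SigmaFinite μ] :
    ∃ ρ : Measure α, IsFiniteMeasure ρ ∧ ρ ≤ μ ∧ μ ≪ ρ := by
  obtain ⟨g, hg0, hgm, hg⟩ := exists_pos_lintegral_lt_of_sigmaFinite μ (ε := 1) one_ne_zero
  have hm : Measurable fun x => min (g x : ENNReal) 1 := (hgm.coe_nnreal_ennreal).min measurable_const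
  refine ⟨μ.withDensity fun x => min (g x : ENNReal) 1, isFiniteMeasure_withDensity ?_, ?_, ?_⟩
  · exact ((lintegral_mono fun x => min_le_left _ _).trans_lt (hg.trans ENNReal.one_lt_top)).ne
  · refine (withDensity_mono (g := 1) (.of_forall fun x => min_le_right _ _)).trans_eq ?_
    exact withDensity_one
  · refine withDensity_absolutelyContinuous' hm.aemeasurable (.of_forall fun x => ?_)
    have := hg0 x
    exact (lt_min (by exact_mod_cast this) one_pos).ne'

/-- This replaces Rellich's theorem. At a fixed scale the mollifications tend to zero pointwise and
are uniformly bounded, so dominated convergence applies on a finite measure. The error is at most `t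
G` uniformly in `n`. -/
theorem tendsto_eLpNorm_of_weakL2_zero {ρ : Measure (EuclideanSpace ℝ (Fin N))} [IsFiniteMeasure ρ]
    (hρ : ρ ≤ volume) (h : WeakL2 f 0) (hf : ∀ n, MemLp (f n) 2 volume) {R G : ℝ}
    (hR : ∀ n, normLp 2 (f n) ≤ R)
    (hG : ∀ n {t : ℝ} (ht : 0 < t), normLp 2 (f n - mollify ht (f n)) ≤ t * G) :
    Tendsto (fun n => eLpNorm (f n) 2 ρ) atTop (𝓝 0) := by
  have hR0 : 0 ≤ R := (normLp_nonneg _ _).trans (hR 0)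
  have hG0 : 0 ≤ G := by
    have := (normLp_nonneg _ _).trans (hG 0 one_pos)
    linarith
  have hmol : ∀ {t : ℝ} (ht : 0 < t),
      Tendsto (fun n => eLpNorm (mollify ht (f n)) 2 ρ) atTop (𝓝 0) := by
    intro t ht
    have hcont : ∀ n, Continuous (mollify ht (f n)) := fun n =>
      (mollify_contDiff ht ((hf n).locallyIntegrable (by norm_num))).continuous
    set S := molConst N * t ^ (-(N : ℝ) / 2) * R with hS
    have hbound : ∀ n x, ‖mollify ht (f n) x‖ₑ ^ (2 : ℝ) ≤ ENNReal.ofReal S ^ (2 : ℝ) := fun n x => by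
      refine ENNReal.rpow_le_rpow ?_ zero_le_two
      rw [← ofReal_norm]
      refine ENNReal.ofReal_le_ofReal ((norm_mollify_le ht (hf n) x).trans ?_)
      have := molConst_pos (N := N)
      rw [hS]
      gcongr
      exact hR n
    have h1 : Tendsto (fun n => ∫⁻ x, ‖mollify ht (f n) x‖ₑ ^ (2 : ℝ) ∂ρ) atTop
        (𝓝 (∫⁻ _, 0 ∂ρ)) := by
      refine tendsto_lintegral_of_dominated_convergence (fun _ => ENNReal.ofReal S ^ (2 : ℝ))
        (fun n => ?_) (fun n => .of_forall (hbound n)) ?_ (.of_forall fun x => ?_)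
      · exact ((hcont n).enorm.measurable).pow_const _
      · rw [lintegral_const]
        exact ENNReal.mul_ne_top (by simp) (measure_ne_top _ _)
      · have h2 := h.tendsto_mollify ht x
        have h3 : mollify ht (0 : EuclideanSpace ℝ (Fin N) → 𝕜) x = 0 := by
          simp [mollify, conv_apply]
        rw [h3] at h2
        have h4 := (h2.enorm).ennrpow_const 2
        simpa using h4
    rw [lintegral_zero] at h1
    have h2 := h1.ennrpow_const (1 / 2)
    simp only [eLpNorm_eq_lintegral_rpow_enorm_toReal two_ne_zero ENNReal.ofNat_ne_top]
    simpa using h2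
  rw [ENNReal.tendsto_nhds_zero]
  intro δ hδ
  rcases eq_or_ne δ ⊤ with rfl | hδt
  · exact .of_forall fun _ => le_top
  have hδr : 0 < δ.toReal := ENNReal.toReal_pos hδ.ne' hδt
  have ht : 0 < δ.toReal / (2 * (G + 1)) := by positivity
  have h2 : (0 : ENNReal) < δ / 2 := ENNReal.half_pos hδ.ne'
  filter_upwards [ENNReal.tendsto_nhds_zero.1 (hmol ht) (δ / 2) h2] with n hn
  have hv := memLp_mollify_two ht (hf n)
  have hac := hρ.absolutelyContinuous
  have e1 : eLpNorm (f n - mollify ht (f n)) 2 ρ ≤ δ / 2 := by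
    refine (eLpNorm_mono_measure _ hρ).trans ?_
    rw [← ofReal_normLp_two ((hf n).sub hv)]
    refine (ENNReal.ofReal_le_ofReal (hG n ht)).trans ?_
    rw [← ENNReal.ofReal_toReal hδt, ← ENNReal.ofReal_ofNat, ← ENNReal.ofReal_div_of_pos two_pos]
    refine ENNReal.ofReal_le_ofReal ?_
    rw [ENNReal.toReal_ofReal hδr.le, div_mul_eq_mul_div, div_le_iff₀ (by positivity)]
    nlinarith
  calc eLpNorm (f n) 2 ρ = eLpNorm ((f n - mollify ht (f n)) + mollify ht (f n)) 2 ρ := by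
        rw [sub_add_cancel]
    _ ≤ _ := eLpNorm_add_le (((hf n).sub hv).1.mono_ac hac) (hv.1.mono_ac hac) (by norm_num)
    _ ≤ δ / 2 + δ / 2 := add_le_add e1 hn
    _ = δ := ENNReal.add_halves δ

theorem exists_subseq_tendsto_ae (h : WeakL2 f v) (hf : ∀ n, MemLp (f n) 2 volume)
    (hv : MemLp v 2 volume) {R G : ℝ} (hR : ∀ n, normLp 2 (f n - v) ≤ R)
    (hG : ∀ n {t : ℝ} (ht : 0 < t), normLp 2 ((f n - v) - mollify ht (f n - v)) ≤ t * G) :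
    ∃ k : ℕ → ℕ, StrictMono k ∧ ∀ᵐ x, Tendsto (fun n => f (k n) x) atTop (𝓝 (v x)) := by
  obtain ⟨ρ, _, hρ, hρ'⟩ := exists_finite_measure_le
    (volume : Measure (EuclideanSpace ℝ (Fin N)))
  have hr : WeakL2 (fun n => f n - v) 0 := by
    intro φ hφ
    have h1 : ∀ n, ∫ x, inner 𝕜 (φ x) ((f n - v) x)
        = (∫ x, inner 𝕜 (φ x) (f n x)) - ∫ x, inner 𝕜 (φ x) (v x) := fun n => by
      rw [← inner_toLp hφ ((hf n).sub hv), ← inner_toLp hφ (hf n), ← inner_toLp hφ hv,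
        MemLp.toLp_sub, inner_sub_right]
    have h2 := (h φ hφ).sub_const (∫ x, inner 𝕜 (φ x) (v x))
    simp only [h1]
    simpa using h2
  have hac := hρ.absolutelyContinuous
  have h1 := tendsto_eLpNorm_of_weakL2_zero hρ hr (fun n => (hf n).sub hv) hR hG
  have h2 := tendstoInMeasure_of_tendsto_eLpNorm two_ne_zero (fun n => (hf n).1.mono_ac hac)
    (hv.1.mono_ac hac) h1
  obtain ⟨k, hk, hk'⟩ := h2.exists_seq_tendsto_ae
  exact ⟨k, hk, hρ'.ae_le hk'⟩

end Weak

/-! ### The Brezis-Lieb lemma -/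

theorem exists_add_rpow_le {p ε : ℝ} (hp : 1 < p) (hε : 0 < ε) :
    ∃ K : ℝ, 0 ≤ K ∧ ∀ x y : ℝ, 0 ≤ x → 0 ≤ y → (x + y) ^ p ≤ (1 + ε) * x ^ p + K * y ^ p := by
  have hp0 : 0 < p := by linarith
  have hp1 : p - 1 ≠ 0 := by linarith
  -- Convexity of the power is applied to `x + y = l (x / l) + (1 - l) (y / (1 - l))`, with the
  -- weight `l` determined by `l ^ (1 - p) = 1 + ε`.
  set l := (1 + ε) ^ (-(1 / (p - 1))) with hl
  have hl0 : 0 < l := by positivity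
  have hl1 : l < 1 := Real.rpow_lt_one_of_one_lt_of_neg (by linarith)
    (neg_neg_of_pos (one_div_pos.2 (by linarith)))
  have hl2 : l * l⁻¹ ^ p = 1 + ε := by
    rw [← Real.rpow_neg_one, ← Real.rpow_mul hl0.le]
    nth_rewrite 1 [← Real.rpow_one l]
    rw [← Real.rpow_add hl0, hl, ← Real.rpow_mul (by positivity),
      show -(1 / (p - 1)) * (1 + -1 * p) = 1 by field_simp; ring, Real.rpow_one]
  have hl3 : 0 < 1 - l := by linarith
  refine ⟨(1 - l) * (1 - l)⁻¹ ^ p, by positivity, fun x y hx hy => ?_⟩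
  have h1 := (convexOn_rpow hp.le).2 (x := l⁻¹ * x) (y := (1 - l)⁻¹ * y)
    (Set.mem_Ici.2 (by positivity)) (Set.mem_Ici.2 (by positivity)) hl0.le hl3.le (by ring)
  simp only [smul_eq_mul] at h1
  rw [mul_inv_cancel_left₀ hl0.ne', mul_inv_cancel_left₀ hl3.ne', Real.mul_rpow (by positivity) hx,
    Real.mul_rpow (by positivity) hy, ← mul_assoc, hl2, ← mul_assoc] at h1
  exact h1

theorem exists_abs_norm_rpow_sub_le {F : Type*} [NormedAddCommGroup F] {p ε : ℝ} (hp : 1 < p)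
    (hε : 0 < ε) : ∃ K : ℝ, 0 ≤ K ∧ ∀ a b : F,
      |‖a + b‖ ^ p - ‖a‖ ^ p| ≤ ε * ‖a‖ ^ p + K * ‖b‖ ^ p := by
  obtain ⟨K, hK0, hK⟩ := exists_add_rpow_le hp hε
  have hp0 : 0 ≤ p := by linarith
  refine ⟨K, hK0, fun a b => abs_le.2 ⟨?_, ?_⟩⟩
  · have h1 : ‖a‖ ^ p ≤ (‖a + b‖ + ‖b‖) ^ p := by
      refine Real.rpow_le_rpow (norm_nonneg _) ?_ hp0
      have := norm_sub_le (a + b) b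
      rwa [add_sub_cancel_right] at this
    have h2 := hK ‖a + b‖ ‖b‖ (norm_nonneg _) (norm_nonneg _)
    have h3 : 0 ≤ ‖a‖ ^ p := by positivity
    have h4 : 0 ≤ K * ‖b‖ ^ p := by positivity
    rcases le_total (‖a + b‖ ^ p) (‖a‖ ^ p) with h | h
    · nlinarith
    · nlinarith
  · have h1 : ‖a + b‖ ^ p ≤ (‖a‖ + ‖b‖) ^ p :=
      Real.rpow_le_rpow (norm_nonneg _) (norm_add_le _ _) hp0
    have h2 := hK ‖a‖ ‖b‖ (norm_nonneg _) (norm_nonneg _)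
    linarith

theorem integrable_norm_rpow {p : ℝ} (hp : 0 < p) {u : EuclideanSpace ℝ (Fin N) → 𝕜}
    (hu : MemLp u (ENNReal.ofReal p) volume) : Integrable (fun x => ‖u x‖ ^ p) volume := by
  simpa [ENNReal.toReal_ofReal hp.le] using hu.integrable_norm_rpow (by simpa using hp) (by simp)

/-- The defect `W n` is at most `ε |f n - v|^p` plus a fixed integrable function. The positive part
of `W n - ε |f n - v|^p` thus tends to zero in `L¹` by dominated convergence, and the rest
contributes at most `ε R`. -/
theorem brezis_lieb {p : ℝ} (hp : 1 < p) {f : ℕ → EuclideanSpace ℝ (Fin N) → 𝕜}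
    {v : EuclideanSpace ℝ (Fin N) → 𝕜} (hf : ∀ n, MemLp (f n) (ENNReal.ofReal p) volume)
    (hv : MemLp v (ENNReal.ofReal p) volume) {R : ℝ} (hR : ∀ n, normLp p (f n - v) ^ p ≤ R)
    (hae : ∀ᵐ x, Tendsto (fun n => f n x) atTop (𝓝 (v x))) :
    Tendsto (fun n => normLp p (f n) ^ p - normLp p (f n - v) ^ p) atTop (𝓝 (normLp p v ^ p)) := by
  have hp0 : 0 < p := by linarith
  have hi := fun n => integrable_norm_rpow hp0 (hf n)
  have hir := fun n => integrable_norm_rpow hp0 ((hf n).sub hv)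
  have hiv := integrable_norm_rpow hp0 hv
  have hR0 : 0 ≤ R := (Real.rpow_nonneg (normLp_nonneg _ _) _).trans (hR 0)
  set W : ℕ → EuclideanSpace ℝ (Fin N) → ℝ := fun n x =>
    |‖f n x‖ ^ p - ‖(f n - v) x‖ ^ p - ‖v x‖ ^ p| with hW
  have hiW : ∀ n, Integrable (W n) volume := fun n => (((hi n).sub (hir n)).sub hiv).abs
  have hWlim : Tendsto (fun n => ∫ x, W n x) atTop (𝓝 0) := by
    rw [Metric.tendsto_atTop]
    intro δ hδ
    obtain ⟨K, hK0, hK⟩ := exists_abs_norm_rpow_sub_le (F := 𝕜) hp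
      (show 0 < δ / (2 * (R + 1)) by positivity)
    set ε := δ / (2 * (R + 1)) with hε
    have hε0 : 0 < ε := by positivity
    have hWle : ∀ n x, W n x ≤ ε * ‖(f n - v) x‖ ^ p + (K + 1) * ‖v x‖ ^ p := fun n x => by
      have h1 := hK ((f n - v) x) (v x)
      simp only [Pi.sub_apply, sub_add_cancel] at h1
      have h2 : 0 ≤ ‖v x‖ ^ p := by positivity
      have h3 := abs_sub (‖f n x‖ ^ p - ‖(f n - v) x‖ ^ p) (‖v x‖ ^ p)
      rw [abs_of_nonneg h2] at h3
      simp only [hW, Pi.sub_apply] at h3 ⊢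
      linarith
    have h1 : Tendsto (fun n => ∫ x, max (W n x - ε * ‖(f n - v) x‖ ^ p) 0) atTop
        (𝓝 (∫ _ : EuclideanSpace ℝ (Fin N), (0 : ℝ))) := by
      refine tendsto_integral_of_dominated_convergence (fun x => (K + 1) * ‖v x‖ ^ p) (fun n => ?_)
        (hiv.const_mul _) (fun n => .of_forall fun x => ?_) ?_
      · exact (((hiW n).sub ((hir n).const_mul ε)).1.sup aestronglyMeasurable_const)
      · rw [Real.norm_of_nonneg (le_max_right _ _)]
        refine max_le ?_ (by positivity)
        linarith [hWle n x]
      · filter_upwards [hae] with x hx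
        have e1 : Tendsto (fun n => ‖(f n - v) x‖ ^ p) atTop (𝓝 0) := by
          have := (hx.sub_const (v x)).norm
          rw [sub_self, norm_zero] at this
          have := this.rpow_const (p := p) (.inr hp0.le)
          rwa [Real.zero_rpow hp0.ne'] at this
        have e2 := hx.norm.rpow_const (p := p) (.inr hp0.le)
        have e3 := ((e2.sub e1).sub_const (‖v x‖ ^ p)).abs
        have e4 := (e3.sub (e1.const_mul ε)).max (tendsto_const_nhds (x := (0 : ℝ)))
        simpa [hW] using e4
    rw [integral_zero] at h1
    obtain ⟨n₀, hn₀⟩ := Metric.tendsto_atTop.1 h1 (δ / 2) (by positivity)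
    refine ⟨n₀, fun n hn => ?_⟩
    have h2 := hn₀ n hn
    rw [Real.dist_0_eq_abs] at h2 ⊢
    have hpos : 0 ≤ ∫ x, W n x := integral_nonneg fun x => abs_nonneg _
    rw [abs_of_nonneg hpos]
    have hipos : Integrable (fun x => max (W n x - ε * ‖(f n - v) x‖ ^ p) 0) volume :=
      ((hiW n).sub ((hir n).const_mul ε)).pos_part
    have hie : Integrable (fun x => ε * ‖(f n - v) x‖ ^ p) volume := (hir n).const_mul ε
    have h3 : ∫ x, W n x ≤ ∫ x, (max (W n x - ε * ‖(f n - v) x‖ ^ p) 0 + ε * ‖(f n - v) x‖ ^ p) := by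
      refine integral_mono (hiW n) (hipos.add hie) fun x => ?_
      have := le_max_left (W n x - ε * ‖(f n - v) x‖ ^ p) 0
      simp only
      linarith
    rw [integral_add hipos hie, integral_const_mul, ← normLp_rpow hp0 ((hf n).sub hv)] at h3
    have h4 : ε * normLp p (f n - v) ^ p ≤ δ / 2 := by
      calc ε * normLp p (f n - v) ^ p ≤ ε * (R + 1) := by
            gcongr; linarith [hR n]
        _ = δ / 2 := by rw [hε]; field_simp
    linarith [le_abs_self (∫ x, max (W n x - ε * ‖(f n - v) x‖ ^ p) 0)]
  rw [tendsto_iff_norm_sub_tendsto_zero]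
  refine squeeze_zero (fun n => norm_nonneg _) (fun n => ?_) hWlim
  have hid : Integrable (fun x => ‖f n x‖ ^ p - ‖(f n - v) x‖ ^ p) volume := (hi n).sub (hir n)
  rw [normLp_rpow hp0 (hf n), normLp_rpow hp0 ((hf n).sub hv), normLp_rpow hp0 hv,
    ← integral_sub (hi n) (hir n), ← integral_sub hid hiv]
  exact norm_integral_le_integral_norm _

/-- A strict concavity argument ruling out splitting. -/
theorem eq_one_of_one_le_split {α β γ a b c : ℝ} (hα : 0 < α) (hβ : 0 < β) (hγ : 0 < γ)
    (hs : 1 < α + β + γ) (ha : a ∈ Set.Icc (0 : ℝ) 1) (hb : b ∈ Set.Icc (0 : ℝ) 1)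
    (hc : c ∈ Set.Icc (0 : ℝ) 1) (hc0 : 0 < c)
    (h : 1 ≤ a ^ α * b ^ β * c ^ γ + (1 - a) ^ α * (1 - b) ^ β * (1 - c) ^ γ) :
    a = 1 ∧ b = 1 ∧ c = 1 := by
  obtain ⟨ha0, ha1⟩ := ha
  obtain ⟨hb0, hb1⟩ := hb
  obtain ⟨-, hc1⟩ := hc
  set s := α + β + γ with hsdef
  have hs0 : 0 < s := by linarith
  have hw : α / s + β / s + γ / s = 1 := by rw [← add_div, ← add_div, div_self hs0.ne']
  -- Weighted AM–GM raised to the power `s`. Both products are thereby controlled by the same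
  -- weighted mean, evaluated at `(a, b, c)` and at the complementary point.
  have key : ∀ x y z : ℝ, 0 ≤ x → 0 ≤ y → 0 ≤ z →
      x ^ α * y ^ β * z ^ γ ≤ (α / s * x + β / s * y + γ / s * z) ^ s := by
    intro x y z hx hy hz
    have h1 := Real.geom_mean_le_arith_mean3_weighted (div_pos hα hs0).le (div_pos hβ hs0).le
      (div_pos hγ hs0).le hx hy hz hw
    have h2 := Real.rpow_le_rpow (by positivity) h1 hs0.le
    rw [Real.mul_rpow (by positivity) (by positivity), Real.mul_rpow (by positivity) (by positivity),
      ← Real.rpow_mul hx, ← Real.rpow_mul hy, ← Real.rpow_mul hz, div_mul_cancel₀ _ hs0.ne',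
      div_mul_cancel₀ _ hs0.ne', div_mul_cancel₀ _ hs0.ne'] at h2
    exact h2
  have k1 := key a b c ha0 hb0 hc0.le
  have k2 := key (1 - a) (1 - b) (1 - c) (by linarith) (by linarith) (by linarith)
  have wa : 0 < α / s := div_pos hα hs0
  have wb : 0 < β / s := div_pos hβ hs0
  have wc : 0 < γ / s := div_pos hγ hs0
  set m := α / s * a + β / s * b + γ / s * c with hm
  have hm' : α / s * (1 - a) + β / s * (1 - b) + γ / s * (1 - c) = 1 - m := by
    rw [hm]; linear_combination hw
  rw [hm'] at k2
  have hm0 : 0 < m := by positivity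
  have hm1 : m ≤ 1 := by
    have : 0 ≤ 1 - m := by
      rw [← hm']
      have := sub_nonneg.2 ha1; have := sub_nonneg.2 hb1; have := sub_nonneg.2 hc1
      positivity
    linarith
  -- For `0 < m < 1` and `s > 1` one has `m^s + (1-m)^s < 1`. The value `m = 0` is already excluded
  -- by `c > 0`, which is where the nonvanishing of the weak limit enters.
  have hme : m = 1 := by
    by_contra hne
    have hlt : m < 1 := lt_of_le_of_ne hm1 hne
    have e1 : m ^ s < m := by
      have := Real.rpow_lt_rpow_of_exponent_gt hm0 hlt hs
      rwa [Real.rpow_one] at this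
    have e2 : (1 - m) ^ s < 1 - m := by
      have := Real.rpow_lt_rpow_of_exponent_gt (show 0 < 1 - m by linarith) (by linarith) hs
      rwa [Real.rpow_one] at this
    linarith
  have hsum : α / s * (1 - a) + β / s * (1 - b) + γ / s * (1 - c) = 0 := by rw [hm', hme]; ring
  have t1 := mul_nonneg wa.le (sub_nonneg.2 ha1)
  have t2 := mul_nonneg wb.le (sub_nonneg.2 hb1)
  have t3 := mul_nonneg wc.le (sub_nonneg.2 hc1)
  have r1 : α / s * (1 - a) = 0 := by linarith
  have r2 : β / s * (1 - b) = 0 := by linarith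
  have r3 : γ / s * (1 - c) = 0 := by linarith
  rw [mul_eq_zero] at r1 r2 r3
  refine ⟨?_, ?_, ?_⟩
  · linarith [r1.resolve_left wa.ne']
  · linarith [r2.resolve_left wb.ne']
  · linarith [r3.resolve_left wc.ne']

/-! ### Compactness of normalized minimizing sequences -/

section Compactness

variable {p C : ℝ} {z : ℕ → EuclideanSpace ℝ (Fin N) → 𝕜} {v : EuclideanSpace ℝ (Fin N) → 𝕜}

/-- Weak convergence in `H²`, expressed through weak partial derivatives up to second order. -/
structure WeakH2 (z : ℕ → EuclideanSpace ℝ (Fin N) → 𝕜) (v : EuclideanSpace ℝ (Fin N) → 𝕜)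
    (g : Fin N → EuclideanSpace ℝ (Fin N) → 𝕜)
    (h : Fin N → Fin N → EuclideanSpace ℝ (Fin N) → 𝕜) : Prop where
  mem : ∀ n, MemH2 (z n)
  data : H2Data v g h
  weak : WeakL2 z v
  weak₁ : ∀ i, WeakL2 (fun n => weakPartial i (z n)) (g i)
  weak₂ : ∀ i j, WeakL2 (fun n => weakPartial j (weakPartial i (z n))) (h i j)

theorem WeakH2.comp {g : Fin N → EuclideanSpace ℝ (Fin N) → 𝕜}
    {h : Fin N → Fin N → EuclideanSpace ℝ (Fin N) → 𝕜} (H : WeakH2 z v g h) {k : ℕ → ℕ}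
    (hk : StrictMono k) : WeakH2 (fun n => z (k n)) v g h :=
  ⟨fun n => H.mem (k n), H.data, H.weak.comp hk, fun i => (H.weak₁ i).comp hk,
    fun i j => (H.weak₂ i j).comp hk⟩

theorem exists_weakH2_subseq (hz : ∀ n, MemH2 (z n)) {M₀ M₁ M₂ : ℝ} (h0 : ∀ n, normLp 2 (z n) ≤ M₀)
    (h1 : ∀ n, normD1 (z n) ≤ M₁) (h2 : ∀ n, normD2 (z n) ≤ M₂) :
    ∃ (k : ℕ → ℕ) (v : EuclideanSpace ℝ (Fin N) → 𝕜) (g : Fin N → EuclideanSpace ℝ (Fin N) → 𝕜)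
      (h : Fin N → Fin N → EuclideanSpace ℝ (Fin N) → 𝕜), StrictMono k ∧
      WeakH2 (fun n => z (k n)) v g h := by
  have H := fun n => (hz n).h2Data
  -- The function and its derivatives of both orders form one countable family, so a single
  -- extraction serves them all.
  set f : Unit ⊕ Fin N ⊕ Fin N × Fin N → ℕ → EuclideanSpace ℝ (Fin N) → 𝕜 := fun i n =>
    match i with
    | .inl _ => z n
    | .inr (.inl i) => weakPartial i (z n)
    | .inr (.inr (i, j)) => weakPartial j (weakPartial i (z n)) with hf
  have hmem : ∀ i n, MemLp (f i n) 2 volume := by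
    rintro (_ | i | ⟨i, j⟩) n
    · exact (H n).memLp
    · exact (H n).memLp₁ i
    · exact (H n).memLp₂ i j
  have hR : ∀ i n, normLp 2 (f i n) ≤ max M₀ (max M₁ (2 ^ N * M₂)) := by
    rintro (_ | i | ⟨i, j⟩) n
    · exact (h0 n).trans (le_max_left _ _)
    · exact ((H n).normLp_partial_le i).trans ((h1 n).trans
        ((le_max_left _ _).trans (le_max_right _ _)))
    · refine ((H n).normLp_second_le i j).trans (le_trans ?_
        ((le_max_right _ _).trans (le_max_right _ _)))
      have := h2 n
      gcongr
  obtain ⟨k, V, hk, hV, hw⟩ := exists_weakL2_subseq hmem hR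
  refine ⟨k, V (.inl ()), fun i => V (.inr (.inl i)), fun i j => V (.inr (.inr (i, j))), hk,
    fun n => hz (k n), ⟨hV _, fun i => hV _, fun i j => hV _, fun i => ?_, fun i j => ?_⟩,
    hw (.inl ()), fun i => hw (.inr (.inl i)), fun i j => hw (.inr (.inr (i, j)))⟩
  · exact HasWeakPartial.of_weakL2 (fun n => (H (k n)).partial₁ i) (hw (.inl ()))
      (hw (.inr (.inl i))) (hV _) (hV _)
  · exact HasWeakPartial.of_weakL2 (fun n => (H (k n)).partial₂ i j) (hw (.inr (.inl i)))
      (hw (.inr (.inr (i, j)))) (hV _) (hV _)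

variable {g : Fin N → EuclideanSpace ℝ (Fin N) → 𝕜}
  {h : Fin N → Fin N → EuclideanSpace ℝ (Fin N) → 𝕜}

theorem WeakH2.normLp_split (H : WeakH2 z v g h) :
    Tendsto (fun n => normLp 2 (z n) ^ 2 - normLp 2 (z n - v) ^ 2) atTop (𝓝 (normLp 2 v ^ 2)) :=
  H.weak.tendsto_norm_split (fun n => (H.mem n).memLp) H.data.memLp

theorem WeakH2.normD1_split (H : WeakH2 z v g h) :
    Tendsto (fun n => normD1 (z n) ^ 2 - normD1 (z n - v) ^ 2) atTop (𝓝 (normD1 v ^ 2)) := by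
  simp only [fun n => (H.mem n).h2Data.normD1_sq, fun n => ((H.mem n).h2Data.sub H.data).normD1_sq,
    H.data.normD1_sq, ← Finset.sum_sub_distrib]
  exact tendsto_finsetSum _ fun i _ => (H.weak₁ i).tendsto_norm_split
    (fun n => (H.mem n).h2Data.memLp₁ i) (H.data.memLp₁ i)

theorem WeakH2.normD2_split (H : WeakH2 z v g h) :
    Tendsto (fun n => normD2 (z n) ^ 2 - normD2 (z n - v) ^ 2) atTop (𝓝 (normD2 v ^ 2)) := by
  have h1 := WeakL2.sum (fun i => H.weak₂ i i) (fun i n => (H.mem n).h2Data.memLp₂ i i)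
    (fun i => H.data.memLp₂ i i)
  have h2 := h1.tendsto_norm_split (fun n => (H.mem n).h2Data.memLp_lap) H.data.memLp_lap
  have h3 : ∀ n, normD2 (z n - v)
      = normLp 2 ((∑ i, weakPartial i (weakPartial i (z n))) - ∑ i, h i i) := fun n => by
    rw [((H.mem n).h2Data.sub H.data).normD2_eq]
    simp only [Pi.sub_apply, Finset.sum_sub_distrib]
  simp only [fun n => (H.mem n).h2Data.normD2_eq, h3, H.data.normD2_eq]
  exact h2

theorem WeakH2.exists_subseq_ae (H : WeakH2 z v g h) {M₀ M₁ : ℝ} (h0 : ∀ n, normLp 2 (z n) ≤ M₀)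
    (h1 : ∀ n, normD1 (z n) ≤ M₁) :
    ∃ k : ℕ → ℕ, StrictMono k ∧ ∀ᵐ x, Tendsto (fun n => z (k n) x) atTop (𝓝 (v x)) := by
  -- A convergent sequence is bounded below, which here bounds the gradients of the remainders `z n
  -- - v` as needed for local compactness.
  obtain ⟨b, hb⟩ := H.normD1_split.bddBelow_range
  have hG : ∀ n, normD1 (z n - v) ≤ √(M₁ ^ 2 - b) := fun n => by
    refine Real.le_sqrt_of_sq_le ?_
    have h2 := hb ⟨n, rfl⟩
    have h3 := pow_le_pow_left₀ (normD1_nonneg (z n)) (h1 n) 2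
    simp only at h2
    linarith
  refine exists_subseq_tendsto_ae H.weak (fun n => (H.mem n).memLp) H.data.memLp
    (R := M₀ + normLp 2 v) (G := errConst N * √(M₁ ^ 2 - b)) (fun n => ?_) fun n {t} ht => ?_
  · refine (normLp_sub_le (by norm_num) (by simpa using (H.mem n).memLp)
      (by simpa using H.data.memLp)).trans ?_
    linarith [h0 n]
  · refine (((H.mem n).h2Data.sub H.data).normLp_sub_mollify_le ht).trans ?_
    have := errConst_pos (N := N)
    calc errConst N * (t * normD1 (z n - v)) ≤ errConst N * (t * √(M₁ ^ 2 - b)) := by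
          gcongr
          exact hG n
      _ = _ := by ring

theorem rpow_eq_sq_rpow {x : ℝ} (hx : 0 ≤ x) (r : ℝ) : x ^ r = (x ^ 2) ^ (r / 2) := by
  rw [← Real.rpow_natCast, ← Real.rpow_mul hx]; congr 1; push_cast; ring

theorem mixedProduct_eq_sq (p : ℝ) (u : EuclideanSpace ℝ (Fin N) → 𝕜) :
    mixedProduct p u = (normD2 u ^ 2) ^ ((N * (p - 2) - 4) / 2 / 2) *
      (normD1 u ^ 2) ^ ((8 - N * (p - 2)) / 2 / 2) * (normLp 2 u ^ 2) ^ ((p - 2) / 2) := by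
  rw [mixedProduct, rpow_eq_sq_rpow (normD2_nonneg u), rpow_eq_sq_rpow (normD1_nonneg u),
    rpow_eq_sq_rpow (normLp_nonneg 2 u)]

theorem tendsto_zero_of_sq {a : ℕ → ℝ} (ha : ∀ n, 0 ≤ a n)
    (h : Tendsto (fun n => a n ^ 2) atTop (𝓝 0)) : Tendsto a atTop (𝓝 0) := by
  have := h.sqrt
  rw [Real.sqrt_zero] at this
  simpa only [Real.sqrt_sq (ha _)] using this

/-- Weak limits of normalized minimizing sequences that do not vanish are strong limits. -/
theorem WeakH2.tendstoH2 (H : WeakH2 z v g h) (hN : 1 ≤ N) (hp₁ : 2 + 4 / (N : ℝ) < p)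
    (hp₂ : p < 2 + 8 / (N : ℝ)) (hC0 : 0 < C) (hC : MixedGNInequality 𝕜 N p C)
    (hz : IsNormalizedMinimizingSeq p C z) {M : ℝ}
    (hM : Tendsto (fun n => normLp 2 (z n)) atTop (𝓝 M)) (hv : ¬ v =ᵐ[volume] 0)
    (hae : ∀ᵐ x, Tendsto (fun n => z n x) atTop (𝓝 (v x))) :
    TendstoH2 z v ∧ IsNormalizedOptimizer p C v := by
  obtain ⟨hα, hβ, hγ⟩ := exponent_pos hN hp₁ hp₂
  have hp : 0 < p := by linarith
  set α := (N * (p - 2) - 4) / 2 with hαdef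
  set β := (8 - N * (p - 2)) / 2 with hβdef
  have hvH : MemH2NeZero v := ⟨H.data.memH2, hv⟩
  have hv2 := hvH.normLp_two_pos
  have hzp := fun n => (hC (z n) (H.mem n)).1
  have hvp := (hC v hvH.1).1
  have hM0 : 0 ≤ M := ge_of_tendsto' hM fun n => normLp_nonneg _ _
  have t0 : Tendsto (fun n => normLp 2 (z n - v) ^ 2) atTop (𝓝 (M ^ 2 - normLp 2 v ^ 2)) := by
    have := (hM.pow 2).sub H.normLp_split
    simpa using this
  have t1 : Tendsto (fun n => normD1 (z n - v) ^ 2) atTop (𝓝 (1 - normD1 v ^ 2)) := by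
    have h1 := H.normD1_split
    simp only [hz.normD1_eq, one_pow] at h1
    simpa using h1.const_sub 1
  have t2 : Tendsto (fun n => normD2 (z n - v) ^ 2) atTop (𝓝 (1 - normD2 v ^ 2)) := by
    have h1 := H.normD2_split
    simp only [hz.normD2_eq, one_pow] at h1
    simpa using h1.const_sub 1
  have n0 : 0 ≤ M ^ 2 - normLp 2 v ^ 2 := ge_of_tendsto' t0 fun n => sq_nonneg _
  have n1 : 0 ≤ 1 - normD1 v ^ 2 := ge_of_tendsto' t1 fun n => sq_nonneg _
  have n2 : 0 ≤ 1 - normD2 v ^ 2 := ge_of_tendsto' t2 fun n => sq_nonneg _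
  have hMpos : 0 < M := by
    refine hM0.lt_of_ne fun h0 => ?_
    rw [← h0] at n0
    nlinarith
  -- The fraction of the limiting squared `L²` norm retained by `v`. For first and second order
  -- norms the corresponding totals are 1 by normalization.
  set c := normLp 2 v ^ 2 / M ^ 2 with hc
  have hcM : M ^ 2 * c = normLp 2 v ^ 2 := by rw [hc]; field_simp
  have hcM' : M ^ 2 * (1 - c) = M ^ 2 - normLp 2 v ^ 2 := by rw [mul_sub, hcM, mul_one]
  have hc0 : 0 < c := by positivity
  have hc1 : c ≤ 1 := by rw [hc, div_le_one (by positivity)]; linarith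
  have tP : Tendsto (fun n => mixedProduct p (z n - v)) atTop (𝓝 ((1 - normD2 v ^ 2) ^ (α / 2) *
      (1 - normD1 v ^ 2) ^ (β / 2) * (M ^ 2 - normLp 2 v ^ 2) ^ ((p - 2) / 2))) := by
    simp only [mixedProduct_eq_sq]
    exact ((t2.rpow_const (.inr (by positivity))).mul (t1.rpow_const (.inr (by positivity)))).mul
      (t0.rpow_const (.inr (by positivity)))
  have hGN : ∀ n, normLp p (z n - v) ^ p ≤ C * mixedProduct p (z n - v) := fun n =>
    (hC _ ((H.mem n).h2Data.sub H.data).memH2).2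
  have tCP := tP.const_mul C
  obtain ⟨R, hR⟩ := tCP.bddAbove_range
  have hBL := brezis_lieb (by linarith) hzp hvp (fun n => (hGN n).trans (hR ⟨n, rfl⟩)) hae
  -- By normalization the `L^p` norm is determined by the `L²` norm and the Weinstein functional,
  -- both of which converge.
  have tz : Tendsto (fun n => normLp p (z n) ^ p) atTop (𝓝 (C * M ^ (p - 2))) := by
    have h1 : ∀ n, normLp p (z n) ^ p = normLp 2 (z n) ^ (p - 2) / weinstein p (z n) := fun n => by
      have := Real.rpow_pos_of_pos (normLp_pos hp (hzp n) (hz.mem n).2) p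
      have h2 := Real.rpow_pos_of_pos (hz.mem n).normLp_two_pos (p - 2)
      rw [weinstein_of_normalized (hz.normD1_eq n) (hz.normD2_eq n)]
      field_simp
    simp only [h1]
    have := (hM.rpow_const (p := p - 2) (.inr hγ.le)).div hz.tendsto (by positivity)
    rwa [div_inv_eq_mul, mul_comm] at this
  have td : Tendsto (fun n => normLp p (z n - v) ^ p) atTop
      (𝓝 (C * M ^ (p - 2) - normLp p v ^ p)) := by
    simpa using tz.sub hBL
  have hle := le_of_tendsto_of_tendsto' td tCP hGN
  have hle2 := (hC v hvH.1).2
  rw [mixedProduct_eq_sq, ← hαdef, ← hβdef] at hle2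
  have hMγ : ∀ x, 0 ≤ x → (M ^ 2 * x) ^ ((p - 2) / 2) = M ^ (p - 2) * x ^ ((p - 2) / 2) :=
    fun x hx => by rw [Real.mul_rpow (by positivity) hx, ← rpow_eq_sq_rpow hM0]
  rw [← hcM', hMγ _ (by linarith)] at hle
  rw [← hcM, hMγ _ hc0.le] at hle2
  have hMγ0 : 0 < M ^ (p - 2) := Real.rpow_pos_of_pos hMpos _
  -- The total `C M^(p-2)` of the `L^p` parts is at most the sum of the mixed bounds for `v` and for
  -- the remainder. The exponents of the squared norms sum to `p / 2 > 1`.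
  have hsplit : 1 ≤ (normD2 v ^ 2) ^ (α / 2) * (normD1 v ^ 2) ^ (β / 2) * c ^ ((p - 2) / 2) +
      (1 - normD2 v ^ 2) ^ (α / 2) * (1 - normD1 v ^ 2) ^ (β / 2) * (1 - c) ^ ((p - 2) / 2) := by
    have h1 : 0 < C * M ^ (p - 2) := by positivity
    refine le_of_mul_le_mul_left ?_ h1
    calc C * M ^ (p - 2) * 1 = (C * M ^ (p - 2) - normLp p v ^ p) + normLp p v ^ p := by ring
      _ ≤ _ := add_le_add hle hle2
      _ = _ := by ring
  obtain ⟨e2, e1, e0⟩ := eq_one_of_one_le_split (by positivity) (by positivity) (by positivity)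
    (by rw [hαdef, hβdef]; linarith) ⟨sq_nonneg _, by linarith⟩ ⟨sq_nonneg _, by linarith⟩
    ⟨hc0.le, hc1⟩ hc0 hsplit
  have e0' : normLp 2 v ^ 2 = M ^ 2 := by rw [← hcM, e0, mul_one]
  have hvM : normLp 2 v = M := (pow_left_inj₀ (normLp_nonneg _ _) hM0 two_ne_zero).1 e0'
  have hD1 : normD1 v = 1 := (pow_eq_one_iff_of_nonneg (normD1_nonneg _) two_ne_zero).1 e1
  have hD2 : normD2 v = 1 := (pow_eq_one_iff_of_nonneg (normD2_nonneg _) two_ne_zero).1 e2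
  rw [e0', sub_self] at t0
  rw [e1, sub_self] at t1
  rw [e2, sub_self] at t2
  -- The remainder's mixed product tends to zero, hence so does its `L^p` norm, and `v` carries the
  -- whole limit.
  have hfin : normLp p v ^ p = C * M ^ (p - 2) := by
    have h1 : C * ((1 - normD2 v ^ 2) ^ (α / 2) * (1 - normD1 v ^ 2) ^ (β / 2) *
        (M ^ 2 - normLp 2 v ^ 2) ^ ((p - 2) / 2)) = 0 := by
      rw [e2, sub_self, Real.zero_rpow (by positivity)]; ring
    rw [h1] at tCP
    have h2 := tendsto_of_tendsto_of_tendsto_of_le_of_le tendsto_const_nhds tCP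
      (fun n => Real.rpow_nonneg (normLp_nonneg p (z n - v)) p) hGN
    have h3 := tendsto_nhds_unique td h2
    linarith
  have hopt : normLp p v ^ p = C * mixedProduct p v := by
    rw [hfin, mixedProduct, hD1, hD2, hvM]; simp
  refine ⟨⟨tendsto_zero_of_sq (fun n => normLp_nonneg _ _) t0,
    tendsto_zero_of_sq (fun n => normD1_nonneg _) t1,
    tendsto_zero_of_sq (fun n => normD2_nonneg _) t2⟩, ⟨hvH, hopt⟩, hD1, hD2, ?_⟩
  rw [weinstein, hopt, div_mul_cancel_right₀ (hC.mixedProduct_pos hp hvH).ne']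

theorem IsNormalizedMinimizingSeq.comp (hz : IsNormalizedMinimizingSeq p C z) {k : ℕ → ℕ}
    (hk : StrictMono k) : IsNormalizedMinimizingSeq p C fun n => z (k n) :=
  ⟨fun _ => hz.mem _, fun _ => hz.normD1_eq _, fun _ => hz.normD2_eq _,
    hz.tendsto.comp hk.tendsto_atTop⟩

theorem mixedProduct_translate {u : EuclideanSpace ℝ (Fin N) → 𝕜} (hu : MemH2 u)
    (y : EuclideanSpace ℝ (Fin N)) : mixedProduct p (fun x => u (x + y)) = mixedProduct p u := by
  rw [mixedProduct, mixedProduct, normD1_translate hu, normD2_translate hu,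
    normLp_translate hu.memLp.1]

theorem weinstein_translate {u : EuclideanSpace ℝ (Fin N) → 𝕜} (hu : MemH2 u)
    (y : EuclideanSpace ℝ (Fin N)) : weinstein p (fun x => u (x + y)) = weinstein p u := by
  rw [weinstein, weinstein, mixedProduct_translate hu, normLp_translate hu.memLp.1]

theorem MemH2NeZero.translate {u : EuclideanSpace ℝ (Fin N) → 𝕜} (hu : MemH2NeZero u)
    (y : EuclideanSpace ℝ (Fin N)) : MemH2NeZero fun x => u (x + y) := by
  refine ⟨(hu.1.h2Data.translate y).memH2, fun h => ?_⟩
  have h1 := hu.normLp_two_pos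
  rw [← normLp_translate hu.1.memLp.1 y, normLp_eq_zero_of_ae h] at h1
  exact h1.false

theorem IsNormalizedMinimizingSeq.translate (hz : IsNormalizedMinimizingSeq p C z)
    (y : ℕ → EuclideanSpace ℝ (Fin N)) : IsNormalizedMinimizingSeq p C fun n x => z n (x + y n) :=
  ⟨fun n => (hz.mem n).translate _, fun n => by rw [normD1_translate (hz.mem n).1, hz.normD1_eq],
    fun n => by rw [normD2_translate (hz.mem n).1, hz.normD2_eq], by
    simpa only [fun n => weinstein_translate (p := p) (hz.mem n).1 (y n)] using hz.tendsto⟩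

theorem IsNormalizedMinimizingSeq.exists_tendstoH2 (hN : 1 ≤ N) (hp₁ : 2 + 4 / (N : ℝ) < p)
    (hp₂ : p < 2 + 8 / (N : ℝ)) (hC0 : 0 < C) (hC : MixedGNInequality 𝕜 N p C)
    (hz : IsNormalizedMinimizingSeq p C z) :
    ∃ (k : ℕ → ℕ) (y : ℕ → EuclideanSpace ℝ (Fin N)) (v : EuclideanSpace ℝ (Fin N) → 𝕜),
      StrictMono k ∧ TendstoH2 (fun n x => z (k n) (x + y n)) v ∧ IsNormalizedOptimizer p C v := by
  obtain ⟨B, hB⟩ := hz.tendsto.bddAbove_range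
  have hB' : ∀ n, weinstein p (z n) ≤ B := fun n => hB ⟨n, rfl⟩
  obtain ⟨M₀, hM₀⟩ := exists_normLp_two_bound 𝕜 hN hp₁ hp₂ B
  have hM₀' := fun n => hM₀ (z n) (hz.mem n) (hz.normD1_eq n) (hz.normD2_eq n) (hB' n)
  obtain ⟨t, ht, κ, hκ, hnv⟩ := exists_nonvanishing 𝕜 hN hp₁ hp₂ B M₀
  choose y hy using fun n => hnv (z n) (hz.mem n) (hz.normD1_eq n) (hz.normD2_eq n) (hB' n) (hM₀' n)
  have hw := hz.translate y
  have hwM : ∀ n, normLp 2 (fun x => z n (x + y n)) ≤ M₀ := fun n => by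
    rw [normLp_translate (hz.mem n).1.memLp.1]; exact hM₀' n
  obtain ⟨k₁, v, g, h, hk₁, H₁⟩ := exists_weakH2_subseq (fun n => (hw.mem n).1) hwM
    (fun n => (hw.normD1_eq n).le) (fun n => (hw.normD2_eq n).le)
  -- After translation the peak of the mollification sits at the origin, and its height `κ` survives
  -- the weak limit.
  have hv : ¬ v =ᵐ[volume] 0 := fun h0 => by
    have h1 := (H₁.weak.tendsto_mollify ht 0).norm
    have h2 : ∀ n, κ ≤ ‖mollify ht (fun x => z (k₁ n) (x + y (k₁ n))) 0‖ := fun n => by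
      rw [mollify, conv_translate, zero_add]
      exact hy (k₁ n)
    have h3 := ge_of_tendsto' h1 h2
    rw [mollify, conv_congr _ h0] at h3
    simp only [conv_apply, Pi.zero_apply, smul_zero, integral_zero, norm_zero] at h3
    linarith
  obtain ⟨k₂, hk₂, hae⟩ := H₁.exists_subseq_ae (fun n => hwM (k₁ n))
    (fun n => (hw.normD1_eq (k₁ n)).le)
  obtain ⟨M, -, k₃, hk₃, hM⟩ := (isCompact_Icc (a := (0 : ℝ)) (b := M₀)).tendsto_subseq
    (x := fun n => normLp 2 fun x => z (k₁ (k₂ n)) (x + y (k₁ (k₂ n))))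
    fun n => ⟨normLp_nonneg _ _, hwM _⟩
  have hk := (hk₁.comp hk₂).comp hk₃
  obtain ⟨r1, r2⟩ := ((H₁.comp hk₂).comp hk₃).tendstoH2 hN hp₁ hp₂ hC0 hC (hw.comp hk) hM hv (by
    filter_upwards [hae] with x hx
    exact hx.comp hk₃.tendsto_atTop)
  exact ⟨_, fun n => y (k₁ (k₂ (k₃ n))), v, hk, r1, r2⟩

end Compactness

/-! ### The Euler-Lagrange equation -/

section EulerLagrange

variable {u v : EuclideanSpace ℝ (Fin N) → 𝕜} {p C : ℝ}

theorem hasDerivAt_normLp_two_sq {a b : EuclideanSpace ℝ (Fin N) → 𝕜} (ha : MemLp a 2 volume)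
    (hb : MemLp b 2 volume) :
    HasDerivAt (fun s : ℝ => normLp 2 (a + (s : 𝕜) • b) ^ 2) (2 * ∫ x, inner ℝ (b x) (a x)) 0 := by
  have h1 : ∀ s : ℝ, normLp 2 (a + (s : 𝕜) • b) ^ 2
      = normLp 2 a ^ 2 + s * (2 * ∫ x, inner ℝ (b x) (a x)) + s ^ 2 * normLp 2 b ^ 2 := fun s => by
    rw [normLp_two_sq_inner ha, normLp_two_sq_inner hb,
      normLp_two_sq_inner (ha.add (hb.const_smul (s : 𝕜)))]
    have haa := integrable_inner_of_memLp ha ha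
    have hba := integrable_inner_of_memLp hb ha
    have hbb := integrable_inner_of_memLp hb hb
    rw [← integral_const_mul, ← integral_const_mul, ← integral_const_mul,
      ← integral_add haa ((hba.const_mul 2).const_mul s),
      ← integral_add (by exact haa.add ((hba.const_mul 2).const_mul s)) (hbb.const_mul _)]
    refine integral_congr_ae (.of_forall fun x => ?_)
    have : ((s : 𝕜) • b) x = s • b x := by simp [RCLike.real_smul_eq_coe_mul]
    simp only [Pi.add_apply, this, inner_add_left, inner_add_right, real_inner_smul_left,
      real_inner_smul_right, real_inner_comm (b x) (a x)]
    ring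
  simp only [h1]
  refine ((((hasDerivAt_id (0 : ℝ)).mul_const (2 * ∫ x, inner ℝ (b x) (a x))).const_add
    (normLp 2 a ^ 2)).fun_add
      (((hasDerivAt_id (0 : ℝ)).fun_pow 2).mul_const (normLp 2 b ^ 2))).congr_deriv ?_
  simp

/-- Differentiation under the integral sign: for `|s| < 1` the derivative is dominated by the
integrable function `p (|a| + |b|)^p`. -/
theorem hasDerivAt_integral_norm_rpow (hp : 1 < p) {a b : EuclideanSpace ℝ (Fin N) → 𝕜}
    (ha : MemLp a (ENNReal.ofReal p) volume) (hb : MemLp b (ENNReal.ofReal p) volume) :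
    HasDerivAt (fun s : ℝ => ∫ x, ‖a x + s • b x‖ ^ p)
      (p * ∫ x, inner ℝ (b x) (‖a x‖ ^ (p - 2) • a x)) 0 := by
  have hp0 : 0 < p := by linarith
  have hd : ∀ x (s : ℝ), HasDerivAt (fun s : ℝ => ‖a x + s • b x‖ ^ p)
      (p * inner ℝ (b x) (‖a x + s • b x‖ ^ (p - 2) • (a x + s • b x))) s := fun x s => by
    have h1 : HasDerivAt (fun s : ℝ => a x + s • b x) (b x) s := by
      simpa using ((hasDerivAt_id s).smul_const (b x)).const_add (a x)
    refine ((hasFDerivAt_norm_rpow (a x + s • b x) hp).comp_hasDerivAt s h1).congr_deriv ?_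
    simp only [smul_apply, innerSL_apply_apply, smul_eq_mul, real_inner_smul_right,
      real_inner_comm (b x)]
    ring
  have hm : ∀ s : ℝ, MemLp (fun x => a x + s • b x) (ENNReal.ofReal p) volume := fun s =>
    ha.add (hb.const_smul s)
  have hdom : MemLp (fun x => ‖a x‖ + ‖b x‖) (ENNReal.ofReal p) volume := ha.norm.add hb.norm
  have key := hasDerivAt_integral_of_dominated_loc_of_deriv_le (μ := volume)
    (F := fun (s : ℝ) x => ‖a x + s • b x‖ ^ p)
    (F' := fun (s : ℝ) x => p * inner ℝ (b x) (‖a x + s • b x‖ ^ (p - 2) • (a x + s • b x)))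
    (x₀ := 0) (s := Metric.ball 0 1) (bound := fun x => p * (‖a x‖ + ‖b x‖) ^ p)
    (Metric.ball_mem_nhds _ one_pos)
    (.of_forall fun s => (integrable_norm_rpow hp0 (hm s)).1)
    (by simpa using integrable_norm_rpow hp0 ha)
    ?_ (.of_forall fun x s hs => ?_) ?_ (.of_forall fun x s _ => hd x s)
  · refine key.2.congr_deriv ?_
    simp [integral_const_mul]
  · have h1 : AEStronglyMeasurable (fun x => ‖a x‖ ^ (p - 2)) volume :=
      (ha.1.norm.aemeasurable.pow_const (p - 2)).aestronglyMeasurable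
    have h2 : AEStronglyMeasurable (fun x => inner ℝ (b x) (‖a x‖ ^ (p - 2) • a x)) volume :=
      hb.1.inner (h1.smul ha.1)
    simpa using h2.const_mul p
  · have hs1 : |s| ≤ 1 := by simpa using (Metric.mem_ball.1 hs).le
    rw [norm_mul, Real.norm_of_nonneg hp0.le]
    refine mul_le_mul_of_nonneg_left ?_ hp0.le
    set w := a x + s • b x
    have hw : ‖w‖ ≤ ‖a x‖ + ‖b x‖ := (norm_add_le _ _).trans (by
      rw [norm_smul, Real.norm_eq_abs]
      nlinarith [norm_nonneg (b x)])
    have h1 : ‖‖w‖ ^ (p - 2) • w‖ ≤ ‖w‖ ^ (p - 1) := by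
      rcases eq_or_ne w 0 with h0 | h0
      · rw [h0]; simp; positivity
      · rw [norm_smul, Real.norm_of_nonneg (by positivity), ← Real.rpow_add_one (norm_ne_zero_iff.2 h0)]
        ring_nf; rfl
    have h2 := Real.rpow_le_rpow (norm_nonneg _) hw (by linarith : 0 ≤ p - 1)
    calc ‖inner ℝ (b x) (‖w‖ ^ (p - 2) • w)‖ ≤ ‖b x‖ * ‖‖w‖ ^ (p - 2) • w‖ := norm_inner_le_norm _ _
      _ ≤ (‖a x‖ + ‖b x‖) * (‖a x‖ + ‖b x‖) ^ (p - 1) := by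
        gcongr
        · linarith [norm_nonneg (a x)]
        · exact h1.trans h2
      _ = (‖a x‖ + ‖b x‖) ^ p := by
        have h0 : 0 ≤ ‖a x‖ + ‖b x‖ := by positivity
        rw [← Real.rpow_one_add' h0 (by linarith)]
        ring_nf
  · have := (integrable_norm_rpow hp0 hdom).const_mul p
    refine this.congr (.of_forall fun x => ?_)
    simp only [Real.norm_of_nonneg (add_nonneg (norm_nonneg (a x)) (norm_nonneg (b x)))]

/-- The vanishing first variation of the mixed Gagliardo-Nirenberg quotient at an optimizer. -/
theorem IsNormalizedOptimizer.first_variation (hN : 1 ≤ N) (hp₁ : 2 + 4 / (N : ℝ) < p)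
    (hp₂ : p < 2 + 8 / (N : ℝ)) (hC : MixedGNInequality 𝕜 N p C)
    (hv : IsNormalizedOptimizer p C v) {ψ : EuclideanSpace ℝ (Fin N) → 𝕜}
    {g : Fin N → EuclideanSpace ℝ (Fin N) → 𝕜}
    {h : Fin N → Fin N → EuclideanSpace ℝ (Fin N) → 𝕜} (Hψ : H2Data ψ g h) :
    (N * (p - 2) - 4) / 2 * (∫ x, inner ℝ ((∑ i, h i i) x) (weakLaplacian v x))
      + (8 - N * (p - 2)) / 2 * (∑ i, ∫ x, inner ℝ (g i x) (weakPartial i v x))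
      + (p - 2) / normLp 2 v ^ 2 * (∫ x, inner ℝ (ψ x) (v x))
    = p / normLp p v ^ p * ∫ x, inner ℝ (ψ x) (‖v x‖ ^ (p - 2) • v x) := by
  obtain ⟨hα, hβ, hγ⟩ := exponent_pos hN hp₁ hp₂
  have hp0 : 0 < p := by linarith
  have hvM := hv.optimizer.1.1
  have H := hvM.h2Data
  have hM := hv.optimizer.1.normLp_two_pos
  have hI : 0 < normLp p v ^ p :=
    Real.rpow_pos_of_pos (normLp_pos hp0 (hC v hvM).1 hv.optimizer.1.2) p
  have Hs : ∀ s : ℝ, H2Data (v + (s : 𝕜) • ψ) ((fun i => weakPartial i v) + (s : 𝕜) • g)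
      ((fun i j => weakPartial j (weakPartial i v)) + (s : 𝕜) • h) := fun s =>
    H.add (Hψ.const_smul (s : 𝕜))
  have hlap : weakLaplacian v = ∑ i, weakPartial i (weakPartial i v) := by
    ext x; simp [weakLaplacian]
  have hD2 : HasDerivAt (fun s : ℝ => normD2 (v + (s : 𝕜) • ψ) ^ 2)
      (2 * ∫ x, inner ℝ ((∑ i, h i i) x) (weakLaplacian v x)) 0 := by
    have := hasDerivAt_normLp_two_sq H.memLp_lap Hψ.memLp_lap
    rw [← hlap] at this
    refine this.congr_of_eventuallyEq (.of_forall fun s => ?_)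
    simp only [(Hs s).normD2_eq]
    congr 2
    ext x
    simp [weakLaplacian, Finset.sum_add_distrib, Finset.smul_sum]
  have hD1 : HasDerivAt (fun s : ℝ => normD1 (v + (s : 𝕜) • ψ) ^ 2)
      (∑ i, 2 * ∫ x, inner ℝ (g i x) (weakPartial i v x)) 0 := by
    have := HasDerivAt.fun_sum fun i (_ : i ∈ Finset.univ) =>
      hasDerivAt_normLp_two_sq (H.memLp₁ i) (Hψ.memLp₁ i)
    refine this.congr_of_eventuallyEq (.of_forall fun s => ?_)
    exact (Hs s).normD1_sq
  have hD0 := hasDerivAt_normLp_two_sq H.memLp Hψ.memLp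
  have hP : HasDerivAt (fun s : ℝ => ∫ x, ‖(v + (s : 𝕜) • ψ) x‖ ^ p)
      (p * ∫ x, inner ℝ (ψ x) (‖v x‖ ^ (p - 2) • v x)) 0 := by
    refine (hasDerivAt_integral_norm_rpow (by linarith) (hC v hvM).1
      (hC ψ Hψ.memH2).1).congr_of_eventuallyEq (.of_forall fun s => ?_)
    simp [RCLike.real_smul_eq_coe_mul]
  have hv0 : v + ((0 : ℝ) : 𝕜) • ψ = v := by simp
  have hprod := ((hD2.rpow_const (p := (N * (p - 2) - 4) / 2 / 2) (Or.inl (by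
      simp only [hv0, hv.normD2_eq]; norm_num))).fun_mul
    (hD1.rpow_const (p := (8 - N * (p - 2)) / 2 / 2) (Or.inl (by
      simp only [hv0, hv.normD1_eq]; norm_num)))).fun_mul
    (hD0.rpow_const (p := (p - 2) / 2) (Or.inl (by simp only [hv0]; positivity)))
  have hF := (hprod.const_mul C).fun_sub hP
  -- The mixed inequality makes `C P_p - ‖·‖_p^p` nonnegative, and it vanishes at the optimizer.
  -- Squared norms are used because they are polynomials in `s` and positive at `s = 0`, so their
  -- real powers can be differentiated there.
  have hmin : IsLocalMin (fun s : ℝ => C * ((normD2 (v + (s : 𝕜) • ψ) ^ 2) ^ ((N * (p - 2) - 4) / 2 / 2)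
      * (normD1 (v + (s : 𝕜) • ψ) ^ 2) ^ ((8 - N * (p - 2)) / 2 / 2)
      * (normLp 2 (v + (s : 𝕜) • ψ) ^ 2) ^ ((p - 2) / 2))
      - ∫ x, ‖(v + (s : 𝕜) • ψ) x‖ ^ p) 0 := by
    refine .of_forall fun s => ?_
    have h1 := hC _ (Hs s).memH2
    simp only [← mixedProduct_eq_sq, hv0, ← normLp_rpow hp0 h1.1, ← normLp_rpow hp0 (hC v hvM).1]
    linarith [h1.2, hv.optimizer.2]
  have h0 := hmin.hasDerivAt_eq_zero hF
  have hPv := hv.optimizer.2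
  rw [mixedProduct_eq_sq] at hPv
  simp only [hv0, hv.normD2_eq, hv.normD1_eq, one_pow, Real.one_rpow, one_mul, mul_one] at h0 hPv
  rw [Real.rpow_sub_one (by positivity)] at h0
  rw [← Finset.mul_sum] at h0
  generalize (∫ x, inner ℝ ((∑ i, h i i) x) (weakLaplacian v x)) = X at h0 ⊢
  generalize (∑ i, ∫ x, inner ℝ (g i x) (weakPartial i v x)) = Y at h0 ⊢
  generalize (∫ x, inner ℝ (ψ x) (v x)) = Z at h0 ⊢
  generalize (∫ x, inner ℝ (ψ x) (‖v x‖ ^ (p - 2) • v x)) = T at h0 ⊢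
  set J := (normLp 2 v ^ 2) ^ ((p - 2) / 2)
  rw [hPv] at hI ⊢
  generalize normLp 2 v = m at h0 hM ⊢
  rw [eq_comm, div_mul_eq_mul_div, div_eq_iff hI.ne']
  field_simp at h0 ⊢
  linear_combination -h0

theorem laplacian_eq_sum_fderiv {φ : EuclideanSpace ℝ (Fin N) → ℝ} (hφ : ContDiff ℝ ∞ φ)
    (x : EuclideanSpace ℝ (Fin N)) :
    Δ φ x = ∑ i, fderiv ℝ (fun z => fderiv ℝ φ z (EuclideanSpace.single i 1)) x
      (EuclideanSpace.single i 1) := by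
  rw [InnerProductSpace.laplacian_eq_iteratedFDeriv_orthonormalBasis φ
    (EuclideanSpace.basisFun (Fin N) ℝ)]
  refine Finset.sum_congr rfl fun i _ => ?_
  have hd : DifferentiableAt ℝ (fderiv ℝ φ) x :=
    ((hφ.fderiv_right (m := 1) (by norm_cast)).differentiable (by simp)) x
  rw [iteratedFDeriv_two_apply, fderiv_clm_apply hd (by fun_prop)]
  simp

/-- The nonlinearity is dominated by `1 + |u|^p`, as `p - 1` lies between 0 and `p`. -/
theorem locallyIntegrable_norm_rpow_smul (hp : 2 < p)
    (hu : MemLp u (ENNReal.ofReal p) volume) :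
    LocallyIntegrable (fun x => ‖u x‖ ^ (p - 2) • u x) volume := by
  have h1 : LocallyIntegrable (fun x => 1 + ‖u x‖ ^ p) volume :=
    continuous_const.locallyIntegrable.add (integrable_norm_rpow (by linarith) hu).locallyIntegrable
  refine h1.mono (((hu.1.norm.aemeasurable.pow_const (p - 2)).aestronglyMeasurable).smul hu.1)
    (.of_forall fun x => ?_)
  have h0 := norm_nonneg (u x)
  rw [norm_smul, Real.norm_of_nonneg (by positivity), Real.norm_of_nonneg (by positivity)]
  rcases le_total ‖u x‖ 1 with h | h
  · have := Real.rpow_le_one h0 h (by linarith : 0 ≤ p - 2)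
    have := mul_le_one₀ this h0 h
    have : 0 ≤ ‖u x‖ ^ p := by positivity
    linarith
  · rw [← Real.rpow_add_one (by linarith)]
    have := Real.rpow_le_rpow_of_exponent_le h (by linarith : p - 2 + 1 ≤ p)
    linarith

theorem integral_inner_test_smul {φ : EuclideanSpace ℝ (Fin N) → ℝ}
    (h : Integrable (fun x => φ x • u x) volume) (z : 𝕜) :
    ∫ x, inner ℝ (φ x • z) (u x) = inner ℝ z (∫ x, φ x • u x) := by
  rw [← integral_inner h]
  simp only [real_inner_smul_left, real_inner_smul_right]

/-- A normalized optimizer solves the Euler-Lagrange equation weakly. -/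
theorem IsNormalizedOptimizer.euler_lagrange (hN : 1 ≤ N) (hp₁ : 2 + 4 / (N : ℝ) < p)
    (hp₂ : p < 2 + 8 / (N : ℝ)) (hC : MixedGNInequality 𝕜 N p C)
    (hv : IsNormalizedOptimizer p C v) {φ : EuclideanSpace ℝ (Fin N) → ℝ} (hφ : ContDiff ℝ ∞ φ)
    (hc : HasCompactSupport φ) :
    ((N * (p - 2) - 4) / 2) • (∫ x, (Δ φ x) • weakLaplacian v x)
      + ((8 - N * (p - 2)) / 2) •
        (∫ x, ∑ i, (fderiv ℝ φ x (EuclideanSpace.single i 1)) • weakPartial i v x)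
      + ((p - 2) / normLp 2 v ^ 2) • (∫ x, φ x • v x)
    = (p / normLp p v ^ p) • ∫ x, φ x • (‖v x‖ ^ (p - 2) • v x) := by
  obtain ⟨-, -, hγ⟩ := exponent_pos hN hp₁ hp₂
  have hvM := hv.optimizer.1.1
  have H := hvM.h2Data
  have hd : ∀ (f : EuclideanSpace ℝ (Fin N) → ℝ), ContDiff ℝ ∞ f → ∀ e,
      ContDiff ℝ ∞ (fun x => fderiv ℝ f x e) := fun f hf e =>
    (hf.fderiv_right (m := ∞) (by simp)).clm_apply contDiff_const
  have hlap : weakLaplacian v = ∑ i, weakPartial i (weakPartial i v) := by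
    ext x; simp [weakLaplacian]
  have hlapφ : Δ φ = fun x => ∑ i, fderiv ℝ (fun z => fderiv ℝ φ z (EuclideanSpace.single i 1)) x
      (EuclideanSpace.single i 1) := funext (laplacian_eq_sum_fderiv hφ)
  have hli : ∀ {w : EuclideanSpace ℝ (Fin N) → 𝕜}, MemLp w 2 volume → LocallyIntegrable w volume :=
    fun hw => hw.locallyIntegrable (by norm_num)
  have hi2 : Integrable (fun x => Δ φ x • weakLaplacian v x) volume := by
    have hw : LocallyIntegrable (weakLaplacian v) volume := by rw [hlap]; exact hli H.memLp_lap
    simp only [hlapφ, Finset.sum_smul]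
    exact integrable_finsetSum _ fun i _ =>
      integrable_fderiv_test_smul (hd φ hφ _) (hc.fderiv_apply ℝ _) hw _
  have hi1 : ∀ i, Integrable (fun x => fderiv ℝ φ x (EuclideanSpace.single i 1) •
      weakPartial i v x) volume := fun i =>
    integrable_fderiv_test_smul hφ hc (hli (H.memLp₁ i)) _
  have hi0 := integrable_test_smul hφ hc (hli H.memLp)
  have hip := integrable_test_smul hφ hc
    (locallyIntegrable_norm_rpow_smul (by linarith) (hC v hvM).1)
  -- The first variation is a real identity. Using it for the variations `φ • z` with every constant
  -- `z` recovers the `𝕜`-valued equation.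
  refine ext_inner_left ℝ fun z => ?_
  have hψ : ContDiff ℝ ∞ fun x => φ x • z := hφ.smul contDiff_const
  have key := hv.first_variation hN hp₁ hp₂ hC (h2Data_of_contDiff hψ (hc.smul_right))
  have hf1 : ∀ x e, fderiv ℝ (fun x => φ x • z) x e = fderiv ℝ φ x e • z := fun x e => by
    rw [fderiv_smul_const ((hφ.differentiable (by simp)) x)]; rfl
  have hf2 : ∀ x e, fderiv ℝ (fun x => fderiv ℝ φ x e • z) x e
      = fderiv ℝ (fun x => fderiv ℝ φ x e) x e • z := fun x e => by
    rw [fderiv_smul_const (((hd φ hφ e).differentiable (by simp)) x)]; rfl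
  have hsum : ∀ x, (∑ i, fun x => fderiv ℝ (fun z => fderiv ℝ φ z (EuclideanSpace.single i 1)) x
      (EuclideanSpace.single i 1) • z) x = Δ φ x • z := fun x => by
    rw [hlapφ, Finset.sum_apply, Finset.sum_smul]
  simp only [hf1, hf2] at key
  simp only [hsum] at key
  rw [integral_inner_test_smul hi2, integral_inner_test_smul hi0, integral_inner_test_smul hip,
    Finset.sum_congr rfl fun i _ => integral_inner_test_smul (hi1 i) z, ← inner_sum] at key
  rw [integral_finsetSum _ fun i _ => hi1 i]
  simpa only [inner_add_right, real_inner_smul_right] using key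

/-- Formally `v` solves `α Δ²v - β Δv + θ v = κ |v|^(p-2) v`. For `Q = a v(b ·)` this becomes, after
normalizing the coefficient of `-ΔQ`, an equation with coefficients `α / (β b²)`, 1, `b² θ / β` and
`b² κ / (β a^(p-2))`. The conditions that the first be `ε` and the last be 1 determine `b` and `a`.
-/
theorem IsNormalizedOptimizer.rescalesToSolution (hN : 1 ≤ N) (hp₁ : 2 + 4 / (N : ℝ) < p)
    (hp₂ : p < 2 + 8 / (N : ℝ)) {ε : ℝ} (hε : 0 < ε) (hC : MixedGNInequality 𝕜 N p C)
    (hv : IsNormalizedOptimizer p C v) : RescalesToSolution p C ε v := by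
  obtain ⟨hα, hβ, hγ⟩ := exponent_pos hN hp₁ hp₂
  have hp0 : 0 < p := by linarith
  have hvM := hv.optimizer.1.1
  have hM := hv.optimizer.1.normLp_two_pos
  have hI : 0 < normLp p v ^ p :=
    Real.rpow_pos_of_pos (normLp_pos hp0 (hC v hvM).1 hv.optimizer.1.2) p
  have hEL := fun φ hφ hc => hv.euler_lagrange hN hp₁ hp₂ hC (φ := φ) hφ hc
  have hκ : 0 < p / normLp p v ^ p := by positivity
  have hθ : 0 < (p - 2) / normLp 2 v ^ 2 := by positivity
  generalize (N * (p - 2) - 4) / 2 = α at hEL hα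
  generalize (8 - N * (p - 2)) / 2 = β at hEL hβ
  generalize (p - 2) / normLp 2 v ^ 2 = θ at hEL hθ
  generalize p / normLp p v ^ p = κ at hEL hκ
  obtain ⟨b, hb, hb2⟩ : ∃ b : ℝ, 0 < b ∧ b ^ 2 = α / (β * ε) :=
    ⟨√(α / (β * ε)), by positivity, Real.sq_sqrt (by positivity)⟩
  obtain ⟨a, ha, hap⟩ : ∃ a : ℝ, 0 < a ∧ a ^ (p - 2) = b ^ 2 * κ / β :=
    ⟨(b ^ 2 * κ / β) ^ (p - 2)⁻¹, by positivity, by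
      rw [← Real.rpow_mul (by positivity), inv_mul_cancel₀ hγ.ne', Real.rpow_one]⟩
  have hopt := hv.optimizer.rescale hp0 ha hb
  refine ⟨a, b, b ^ 2 * θ / β, ha, hb, by positivity, hopt, hopt.1.1, (hC _ hopt.1.1).1,
    fun φ hφ hc => ?_⟩
  have H := hvM.h2Data.rescale a hb
  have h2 : weakLaplacian (MixedGN.rescale a b v)
      =ᵐ[volume] fun x => (a * b ^ 2) • weakLaplacian v (b • x) := by
    filter_upwards [H.weakLaplacian_ae] with x hx
    rw [hx]
    simp [weakLaplacian, MixedGN.rescale, Finset.smul_sum]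
  -- The inversely dilated test function, so that a change of variables with Jacobian factor `c`
  -- turns every term into the corresponding one for `v`.
  set ψ : EuclideanSpace ℝ (Fin N) → ℝ := fun x => φ (b⁻¹ • x) with hψ_def
  have hψ : ContDiff ℝ ∞ ψ := hφ.comp (contDiff_const_smul _)
  have hψc : HasCompactSupport ψ :=
    hc.comp_homeomorph (Homeomorph.smulOfNeZero b⁻¹ (inv_ne_zero hb.ne'))
  have hφψ : φ = fun x => ψ (b • x) := by
    ext x; simp [hψ_def, inv_smul_smul₀ hb.ne']
  have hd1 : ∀ x e, fderiv ℝ φ x e = b * fderiv ℝ ψ (b • x) e := fun x e => by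
    rw [hφψ, fderiv_comp_smul]; rfl
  have hd2 : ∀ x e, fderiv ℝ (fun z => fderiv ℝ φ z e) x e
      = b ^ 2 * fderiv ℝ (fun z => fderiv ℝ ψ z e) (b • x) e := fun x e => by
    have hd : DifferentiableAt ℝ (fun z => fderiv ℝ ψ (b • z) e) x := by
      have : ContDiff ℝ 1 (fun z => fderiv ℝ ψ z e) :=
        (hψ.fderiv_right (m := 1) (by norm_cast)).clm_apply contDiff_const
      exact ((this.comp (contDiff_const_smul b)).differentiable (by simp)) x
    simp only [hd1]
    rw [fderiv_const_mul hd, fderiv_comp_smul (f := fun z => fderiv ℝ ψ z e)]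
    simp only [smul_apply, smul_eq_mul]
    ring
  have hlap : ∀ x, Δ φ x = b ^ 2 * Δ ψ (b • x) := fun x => by
    simp only [laplacian_eq_sum_fderiv hφ, laplacian_eq_sum_fderiv hψ, hd2, Finset.mul_sum]
  set c : ℝ := |(b ^ Module.finrank ℝ (EuclideanSpace ℝ (Fin N)))⁻¹|
  have hcv : ∀ f : EuclideanSpace ℝ (Fin N) → 𝕜, ∫ x, f (b • x) = c • ∫ x, f x := fun f =>
    Measure.integral_comp_smul volume f b
  have e2 : ∫ x, Δ φ x • weakLaplacian (MixedGN.rescale a b v) x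
      = (a * b ^ 4 * c) • ∫ x, Δ ψ x • weakLaplacian v x := by
    rw [mul_smul, ← hcv, ← integral_smul]
    refine integral_congr_ae ?_
    filter_upwards [h2] with x hx
    rw [hx, hlap]
    simp only [smul_smul]
    ring_nf
  have e1 : ∫ x, ∑ i, fderiv ℝ φ x (EuclideanSpace.single i 1) •
        weakPartial i (MixedGN.rescale a b v) x
      = (a * b ^ 2 * c) • ∫ x, ∑ i, fderiv ℝ ψ x (EuclideanSpace.single i 1) •
        weakPartial i v x := by
    rw [mul_smul, ← hcv, ← integral_smul]
    refine integral_congr_ae ?_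
    filter_upwards [ae_all_iff.2 H.weakPartial_ae] with x hx
    simp only [hx, hd1, MixedGN.rescale, Finset.smul_sum, smul_smul]
    refine Finset.sum_congr rfl fun i _ => ?_
    ring_nf
  have e0 : ∫ x, φ x • MixedGN.rescale a b v x = (a * c) • ∫ x, ψ x • v x := by
    rw [mul_smul, ← hcv, ← integral_smul]
    refine integral_congr_ae (.of_forall fun x => ?_)
    simp only [hφψ, MixedGN.rescale]
    rw [smul_comm]
  have ep : ∫ x, φ x • (‖MixedGN.rescale a b v x‖ ^ (p - 2) • MixedGN.rescale a b v x)
      = (a ^ (p - 2) * a * c) • ∫ x, ψ x • (‖v x‖ ^ (p - 2) • v x) := by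
    rw [mul_smul, ← hcv, ← integral_smul]
    refine integral_congr_ae (.of_forall fun x => ?_)
    simp only [hφψ, MixedGN.rescale, norm_smul, Real.norm_of_nonneg ha.le,
      Real.mul_rpow ha.le (norm_nonneg _), smul_smul]
    ring_nf
  rw [e2, e1, e0, ep, hap]
  have h4 : b ^ 4 = b ^ 2 * (α / (β * ε)) := by rw [← hb2]; ring
  -- This multiple of the equation for `v` matches the gradient terms; the choices of `a` and `b`
  -- then match the others.
  have hEL := congrArg (fun t => (a * b ^ 2 / β * c) • t) (hEL ψ hψ hψc)
  simp only [smul_add, smul_smul] at hEL ⊢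
  convert hEL using 2
  · congr 2
    · rw [h4]; field_simp
    · field_simp
  · congr 1; field_simp
  · field_simp

end EulerLagrange
end MixedGN

end

/-! ### Existence and compactness of optimizers. -/

theorem proposition4p1 {𝕜 : Type*} [RCLike 𝕜] (N : ℕ) (hN : 1 ≤ N) (p ε : ℝ)
    (hp₁ : 2 + 4 / (N : ℝ) < p) (hp₂ : p < 2 + 8 / (N : ℝ)) (hε : 0 < ε) :
    ∃ C : ℝ, 0 < C ∧ MixedGN.IsBestConstant 𝕜 N p C ∧
      -- an optimizer `Q`, rescaled from a normalized one, that solves the equation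
      (∃ v : EuclideanSpace ℝ (Fin N) → 𝕜,
        MixedGN.IsNormalizedOptimizer p C v ∧ MixedGN.RescalesToSolution p C ε v) ∧
      -- normalized minimizing sequences exist
      (∃ w : ℕ → EuclideanSpace ℝ (Fin N) → 𝕜, MixedGN.IsNormalizedMinimizingSeq p C w) ∧
      -- and each of them yields such a `v` as a limit, up to a subsequence and translations
      (∀ w : ℕ → EuclideanSpace ℝ (Fin N) → 𝕜, MixedGN.IsNormalizedMinimizingSeq p C w →
        ∃ (k : ℕ → ℕ) (y : ℕ → EuclideanSpace ℝ (Fin N)) (v : EuclideanSpace ℝ (Fin N) → 𝕜),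
          StrictMono k ∧ MixedGN.TendstoH2 (fun n x => w (k n) (x + y n)) v ∧
          MixedGN.IsNormalizedOptimizer p C v ∧ MixedGN.RescalesToSolution p C ε v) := by
  obtain ⟨C, hC0, hC⟩ := MixedGN.exists_isBestConstant 𝕜 hN hp₁ hp₂
  obtain ⟨w, hw⟩ := MixedGN.exists_isNormalizedMinimizingSeq hN hp₁ hp₂ hC0 hC
  obtain ⟨-, -, v, -, -, hv⟩ := hw.exists_tendstoH2 hN hp₁ hp₂ hC0 hC.1
  refine ⟨C, hC0, hC, ⟨v, hv, hv.rescalesToSolution hN hp₁ hp₂ hε hC.1⟩, ⟨w, hw⟩, fun w hw => ?_⟩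
  obtain ⟨k, y, v, hk, ht, hv⟩ := hw.exists_tendstoH2 hN hp₁ hp₂ hC0 hC.1
  exact ⟨k, y, v, hk, ht, hv, hv.rescalesToSolution hN hp₁ hp₂ hε hC.1⟩
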